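/- Let $m\ge 2$ be even, let $\xi,L\ge 1$ and $n=\xi m$. Arrange $n$ qubits on a ring, label them by $\mathbb Z/n\mathbb Z$, and let $S_k$ $(k\in\mathbb Z/\xi\mathbb Z)$ be the group of $m$ consecutive qubits $km,\dots,km+m-1$. Consider an $n$-qubit alternating layered ansatz with $L$ layers of $\xi$ unitary blocks each: every block acts on $m$ consecutive qubits, the blocks of the last layer act on the $S_k$, and the blocks of consecutive layers are displaced against each other by $m/2$ qubits. Let $W$ be a block of the $l$-th layer ($1\le l\le L$), and let $W=W_{\rm A}(\mathbf 1\otimes R)W_{\rm B}$, where $R$ is a single-qubit gate on one of the qubits of $W$, of the form $R=\sum_{\mu=0}^{p-1}q_\mu\varsigma_\mu$ with $q\in\mathbb R^p$ a unit vector and $(\varsigma_\mu)=(I,-iX,-iY,-iZ)$ ($p=4$), or $(-iX,-iY,-iZ)$ ($p=3$), or $(I,-i\,\boldsymbol a\cdot\vec\sigma)$ with a fixed unit vector $\boldsymbol a\in\mathbb R^3$ ($p=2$). Suppose that $W_{\rm A}$, $W_{\rm B}$ and all blocks other than $W$ are independent random unitaries on $m$ qubits, each distributed according to a unitary 2-design.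 Let $U_1$ and $U_2$ be the parts of the circuit before and after $R$. Let $\rho_{\rm in}$ be an $n$-qubit density matrix and $$H=c_0I^{\otimes n}+\sum_i c_ih_i,\qquad c_0,c_i\in\mathbb R,$$ a finite sum, where the $h_i$ are pairwise different tensor products of Pauli matrices, each acting non-trivially at most on some $m$ neighbouring qubits of the ring. With $\rho'=U_1\rho_{\rm in}U_1^\dagger$ and $H'=U_2^\dagger HU_2$ let $S$ be the real symmetric $p\times p$ matrix $$S_{\mu\nu}=\tfrac12{\rm tr}\big[\rho'(\varsigma_\mu^\dagger H'\varsigma_\nu+\varsigma_\nu^\dagger H'\varsigma_\mu)\big],$$ let $S_{\rm c}=S-\frac{{\rm tr}[S]}{p}I_{p\times p}$, and let $r(S_{\rm c})$ be its spectral radius. Then $r(S_{\rm c})^2$ is integrable and $$\mathbb E_{U_1,U_2}\big[r(S_{\rm c})^2\big]\ \ge\ \frac{(p+2)(p-1)\,2^{m(l+1)-1}}{p\,(2^{2m}-1)^2\,(2^m+1)^{L+l}}\ \sum_{i\in i_{\mathcal L}}\ \sum_{\substack{(k,k')\in k_{\mathcal L_{\rm B}}\\ k'\ge k}} c_i^2\,\epsilon(\rho_{k,k'})\,\epsilon(h_i).$$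 Here $\epsilon(M)=D_{\rm HS}\big(M,{\rm tr}(M)\mathbf 1/d_M\big)$, where $D_{\rm HS}(A,B)={\rm tr}[(A-B)^\dagger(A-B)]$ and $d_M$ is the dimension of $M$, and $h_i$ is taken as an operator on its $m$ neighbouring qubits. The state $\rho_{k,k'}$ is the reduced density matrix of $\rho_{\rm in}$ on $S_kS_{k+1}\cdots S_{k'}$. The forward (backward) light-cone of $W$ consists of $W$ and of all blocks that are reached from $W$ by repeatedly passing to a block of the next (previous) layer that shares a qubit with the block before. The set $i_{\mathcal L}$ consists of the $i$ such that all qubits on which $h_i$ acts non-trivially belong to blocks of the forward light-cone, and the pairs $(k,k')$ run over the indices with $S_k$ and $S_{k'}$ contained in the set of qubits of the backward light-cone. If a light-cone is so wide that it wraps around the ring, it is computed in the unrolled circuit on the line $\mathbb Z$, with $k,k'\in\mathbb Z$ and $k\le k'<k+\xi$, and $i\in i_{\mathcal L}$ means that the $m$-qubit window of $h_i$ has a lift to $\mathbb Z$ in which all sites where $h_i$ acts non-trivially belong to the cone. Consequently, consider, for fixed $m$, a sequence of such settings with $n\to\infty$. (a) If $L=\mathcal O(\log n)$ and at least one term $c_i^2\epsilon(\rho_{k,k'})\epsilon(h_i)$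 of the sum is $\Omega(1/{\rm poly}(n))$, then $\mathbb E_{U_1,U_2}[r(S_{\rm c})^2]=\Omega(1/{\rm poly}(n))$; so the spectrum of $S$ does not concentrate exponentially. (b) If $L=\mathcal O({\rm poly}(\log n))$ and at least one such term is $\Omega(1/2^{{\rm poly}(\log n)})$, then $\mathbb E_{U_1,U_2}[r(S_{\rm c})^2]=\Omega(1/2^{{\rm poly}(\log n)})$. -/

import Mathlib

open MeasureTheory Matrix
open scoped ComplexOrder

namespace ALA

/-! ### Operators on registers of qubits -/

/-- Operators on a register of qubits labelled by `ι`, in the computational basis `ι → Fin 2`. -/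
abbrev Op (ι : Type) : Type := Matrix (ι → Fin 2) (ι → Fin 2) ℂ

/-- `A ⊗ 1`: the operator `A` on `κ` qubits, placed on the qubits `e i` (`e` injective). -/
def onQubits {ι κ : Type} [Fintype ι] [Fintype κ] [DecidableEq ι]
    (e : κ → ι) (A : Op κ) : Op ι :=
  Matrix.of fun x y =>
    if ∀ q, (∀ i, e i ≠ q) → x q = y q then A (fun i => x (e i)) (fun i => y (e i)) else 0

/-- `1 ⊗ R`: the single-qubit operator `R` on the qubit `q`. -/
def onQubit {ι : Type} [Fintype ι] [DecidableEq ι]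
    (q : ι) (R : Matrix (Fin 2) (Fin 2) ℂ) : Op ι :=
  onQubits (fun _ : Unit => q) (Matrix.of fun x y => R (x ()) (y ()))

/-- The basis label on all qubits that restricts to `a` on `A` and to `z` off `A`. -/
def glue {ι : Type} [DecidableEq ι] (A : Finset ι) (a : A → Fin 2)
    (z : {q // q ∉ A} → Fin 2) : ι → Fin 2 :=
  fun q => if h : q ∈ A then a ⟨q, h⟩ else z ⟨q, h⟩

/-- The reduced operator on the qubits in `A` (partial trace over all other qubits). -/
def reduced {ι : Type} [Fintype ι] [DecidableEq ι] (A : Finset ι) (ρ : Op ι) : Op A :=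
  Matrix.of fun a b => ∑ z : {q // q ∉ A} → Fin 2, ρ (glue A a z) (glue A b z)

/-- The Hilbert–Schmidt distance `tr[(A - B)† (A - B)]` (the squared Hilbert–Schmidt norm). -/
noncomputable def hsDist {n : Type} [Fintype n] (A B : Matrix n n ℂ) : ℝ :=
  (((A - B)ᴴ * (A - B)).trace).re

/-- `ε(M) = D_HS(M, tr(M) 1 / d_M)`. -/
noncomputable def epsilon {n : Type} [Fintype n] [DecidableEq n] (M : Matrix n n ℂ) : ℝ :=
  hsDist M ((M.trace / (Fintype.card n : ℂ)) • (1 : Matrix n n ℂ))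

/-- The identity and the Pauli matrices `X`, `Y`, `Z`. -/
noncomputable def pauli : Fin 4 → Matrix (Fin 2) (Fin 2) ℂ :=
  ![1, !![0, 1; 1, 0], !![0, -Complex.I; Complex.I, 0], !![1, 0; 0, -1]]

/-- The tensor product of the Pauli matrices (or identities) `pauli (P i)`. -/
noncomputable def pauliString {κ : Type} [Fintype κ] (P : κ → Fin 4) : Op κ :=
  Matrix.of fun x y => ∏ i, pauli (P i) (x i) (y i)

/-! ### Target single-qubit gates of the sequential optimizers -/

/-- The three kinds of target gate: a general single-qubit gate (FQS), a rotation by `π` about a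
free axis (Fraxis), a rotation by a free angle about the fixed unit axis `a` (NFT/Rotosolve). -/
inductive Optimizer : Type
  | fqs : Optimizer
  | fraxis : Optimizer
  | nft (a : EuclideanSpace ℝ (Fin 3)) (ha : ‖a‖ = 1) : Optimizer

/-- The size `p` of the matrix `S`. -/
def Optimizer.p : Optimizer → ℕ
  | .fqs => 4
  | .fraxis => 3
  | .nft _ _ => 2

/-- The matrices `ς_μ`, `0 ≤ μ < p`: the target gate is `∑ μ, q_μ ς_μ` with `q ∈ ℝ^p` a unit
vector. -/
noncomputable def Optimizer.gen : (o : Optimizer) → Fin o.p → Matrix (Fin 2) (Fin 2) ℂ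
  | .fqs => (![pauli 0, -Complex.I • pauli 1, -Complex.I • pauli 2, -Complex.I • pauli 3] :
      Fin 4 → Matrix (Fin 2) (Fin 2) ℂ)
  | .fraxis => (![-Complex.I • pauli 1, -Complex.I • pauli 2, -Complex.I • pauli 3] :
      Fin 3 → Matrix (Fin 2) (Fin 2) ℂ)
  | .nft a _ => (![pauli 0,
      -Complex.I • ((a 0 : ℂ) • pauli 1 + (a 1 : ℂ) • pauli 2 + (a 2 : ℂ) • pauli 3)] :
      Fin 2 → Matrix (Fin 2) (Fin 2) ℂ)

/-- `S_{μν} = (1/2) tr[ρ' (ς_μ† H' ς_ν + ς_ν† H' ς_μ)]`. The trace is a real number whenever `ρ'`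
and `H'` are Hermitian. -/
noncomputable def quadMatrix {ι : Type} [Fintype ι] [DecidableEq ι] {p : ℕ}
    (ρ' H' : Op ι) (s : Fin p → Op ι) : Matrix (Fin p) (Fin p) ℝ :=
  Matrix.of fun μ ν => ((1 / 2 : ℂ) *
    (ρ' * ((s μ)ᴴ * H' * s ν + (s ν)ᴴ * H' * s μ)).trace).re

/-- `S - (tr S / p) I`. -/
noncomputable def centered {p : ℕ} (S : Matrix (Fin p) (Fin p) ℝ) : Matrix (Fin p) (Fin p) ℝ :=
  S - (S.trace / p) • (1 : Matrix (Fin p) (Fin p) ℝ)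

/-! ### Unitary 2-designs -/

/-- Unitary operators on `m` qubits, with the Borel σ-algebra. -/
abbrev BlockUnitary (m : ℕ) : Type := ↥(Matrix.unitaryGroup (Fin m → Fin 2) ℂ)

noncomputable instance (m : ℕ) : MeasurableSpace (BlockUnitary m) := borel _

instance (m : ℕ) : BorelSpace (BlockUnitary m) := ⟨rfl⟩

instance (m : ℕ) : CompactSpace (BlockUnitary m) := by
  refine isCompact_iff_compactSpace.mp ?_
  have hsub : ((Matrix.unitaryGroup (Fin m → Fin 2) ℂ : Submonoid (Op (Fin m))) :
      Set (Op (Fin m))) ⊆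
      Set.pi Set.univ fun _ => Set.pi Set.univ fun _ => Metric.closedBall (0 : ℂ) 1 := by
    intro U hU i _ j _
    simpa using entry_norm_bound_of_unitary hU i j
  refine IsCompact.of_isClosed_subset
    (isCompact_univ_pi fun _ => isCompact_univ_pi fun _ => isCompact_closedBall (0 : ℂ) 1) ?_ hsub
  have : ((Matrix.unitaryGroup (Fin m → Fin 2) ℂ : Submonoid (Op (Fin m))) : Set (Op (Fin m))) =
      {U | U * star U = 1} := by
    ext U
    exact Matrix.mem_unitaryGroup_iff
  rw [this]
  exact isClosed_eq (continuous_id.mul continuous_id.star) continuous_const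

/-- The Haar probability measure on the unitary group of `m` qubits. -/
noncomputable def haarU (m : ℕ) : Measure (BlockUnitary m) := Measure.haarMeasure ⊤

/-- A probability distribution on unitaries whose moments of order two, that is the expectations of
`U ⊗ U ⊗ U* ⊗ U*`, agree with those of the Haar measure. -/
def IsTwoDesign {m : ℕ} (μ : Measure (BlockUnitary m)) : Prop :=
  IsProbabilityMeasure μ ∧ ∀ i j k l i' j' k' l' : Fin m → Fin 2,
    ∫ U : BlockUnitary m, U.1 i j * U.1 k l * star (U.1 i' j') * star (U.1 k' l') ∂μ =
    ∫ U : BlockUnitary m, U.1 i j * U.1 k l * star (U.1 i' j') * star (U.1 k' l') ∂(haarU m)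

/-! ### Geometry of the alternating layered ansatz

The `n = ξ m` qubits are arranged cyclically. Layers are indexed from `0` (the first layer) to
`L - 1` (the last layer). The blocks of the last layer act on the consecutive groups of `m` qubits,
and from one layer to the next the blocks are displaced by `m / 2` qubits. -/

/-- The labels of the qubits. -/
abbrev Qubit (ξ m : ℕ) : Type := ZMod (ξ * m)

/-- The displacement of the blocks of layer `j`. -/
def layerShift (m L : ℕ) (j : Fin L) : ℕ := if Even (L - 1 - (j : ℕ)) then 0 else m / 2

/-- The `i`-th qubit of the `k`-th block of layer `j`. -/
def blockQubit (ξ m L : ℕ) (j : Fin L) (k : Fin ξ) (i : Fin m) : Qubit ξ m :=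
  (((k : ℕ) * m + layerShift m L j + (i : ℕ) : ℕ) : ZMod (ξ * m))

/-- Blocks of the circuit unrolled along the line `ℤ`, whose sites are the qubits modulo `ξ m`:
layer and position. -/
abbrev LineBlock (L : ℕ) : Type := Fin L × ℤ

/-- The sites on which a block acts. -/
def blockSites (m : ℕ) {L : ℕ} (b : LineBlock L) : Set ℤ :=
  Set.Ico (b.2 * m + layerShift m L b.1) (b.2 * m + layerShift m L b.1 + m)

/-- An output qubit of the block `b` is an input qubit of the block `b'` of the next layer. -/
def Feeds (m : ℕ) {L : ℕ} (b b' : LineBlock L) : Prop :=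
  (b'.1 : ℕ) = (b.1 : ℕ) + 1 ∧ (blockSites m b ∩ blockSites m b').Nonempty

/-- The forward light-cone of a block. -/
def forwardCone (m : ℕ) {L : ℕ} (b : LineBlock L) : Set (LineBlock L) :=
  {b' | Relation.ReflTransGen (Feeds m) b b'}

/-- The backward light-cone of a block. -/
def backwardCone (m : ℕ) {L : ℕ} (b : LineBlock L) : Set (LineBlock L) :=
  {b' | Relation.ReflTransGen (Feeds m) b' b}

/-- The sites on which the blocks of a light-cone act. -/
def coneSites (m : ℕ) {L : ℕ} (C : Set (LineBlock L)) : Set ℤ := ⋃ b ∈ C, blockSites m b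

/-- The sites `S_k S_{k+1} ⋯ S_{k'}`. -/
noncomputable def subsysSites (m : ℕ) (k k' : ℤ) : Finset ℤ := Finset.Ico (k * m) ((k' + 1) * m)

/-- The `k` such that the subsystem `S_k` is in the backward light-cone of `b`. -/
def backwardIndices (m : ℕ) {L : ℕ} (b : LineBlock L) : Set ℤ :=
  {k | (subsysSites m k k : Set ℤ) ⊆ coneSites m (backwardCone m b)}

/-- The pairs `(k, k')` with `k ≤ k'`, both `S_k` and `S_{k'}` in the backward light-cone of `b`,
such that `S_k, …, S_{k'}` are pairwise different subsystems of the ring. -/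
def backwardPairs (ξ m : ℕ) {L : ℕ} (b : LineBlock L) : Set (ℤ × ℤ) :=
  {kk | kk.1 ∈ backwardIndices m b ∧ kk.2 ∈ backwardIndices m b ∧ kk.1 ≤ kk.2 ∧
    kk.2 - kk.1 < ξ}

theorem layerShift_lt (m L : ℕ) [NeZero m] (j : Fin L) : layerShift m L j < m := by
  have hm : 0 < m := Nat.pos_of_ne_zero (NeZero.ne m)
  unfold layerShift
  split_ifs <;> omega

/-- A light-cone stays within a bounded distance of its apex. -/
theorem cone_bound (m : ℕ) [NeZero m] {L : ℕ} {b b' : LineBlock L}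
    (h : Relation.ReflTransGen (Feeds m) b' b) :
    b'.2 - b.2 ≤ ((b.1 : ℕ) : ℤ) - (b'.1 : ℕ) ∧ b.2 - b'.2 ≤ ((b.1 : ℕ) : ℤ) - (b'.1 : ℕ) := by
  have hm : (0 : ℤ) < m := by exact_mod_cast Nat.pos_of_ne_zero (NeZero.ne m)
  induction h with
  | refl => simp
  | @tail c d _ hcd ih =>
    obtain ⟨h1, z, hz1, hz2⟩ := hcd
    simp only [blockSites, Set.mem_Ico] at hz1 hz2
    have hc : (layerShift m L c.1 : ℤ) < m := by exact_mod_cast layerShift_lt m L c.1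
    have hd : (layerShift m L d.1 : ℤ) < m := by exact_mod_cast layerShift_lt m L d.1
    have hc0 : (0 : ℤ) ≤ layerShift m L c.1 := by positivity
    have hd0 : (0 : ℤ) ≤ layerShift m L d.1 := by positivity
    have e1 : c.2 - d.2 < 2 := by
      by_contra hcon
      nlinarith
    have e2 : d.2 - c.2 < 2 := by
      by_contra hcon
      nlinarith
    have h1' : ((d.1 : ℕ) : ℤ) = (c.1 : ℕ) + 1 := by exact_mod_cast h1
    omega

/-- There are finitely many pairs. -/
theorem finite_backwardPairs (ξ m : ℕ) [NeZero m] {L : ℕ} (b : LineBlock L) :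
    (backwardPairs ξ m b).Finite := by
  have hm : (0 : ℤ) < m := by exact_mod_cast Nat.pos_of_ne_zero (NeZero.ne m)
  have key : ∀ k ∈ backwardIndices m b, k ∈ Set.Icc (b.2 - L - 1) (b.2 + L + 1) := by
    intro k hk
    have h0 : k * (m : ℤ) ∈ coneSites m (backwardCone m b) := by
      apply hk
      simp only [subsysSites, Finset.coe_Ico, Set.mem_Ico, le_refl, true_and]
      nlinarith
    simp only [coneSites, Set.mem_iUnion] at h0
    obtain ⟨b', hb', hs⟩ := h0
    have hb := cone_bound m hb'
    simp only [blockSites, Set.mem_Ico] at hs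
    have hc : (layerShift m L b'.1 : ℤ) < m := by exact_mod_cast layerShift_lt m L b'.1
    have hc0 : (0 : ℤ) ≤ layerShift m L b'.1 := by positivity
    have e1 : b'.2 - k < 1 := by
      by_contra hcon
      nlinarith
    have e2 : k - b'.2 < 2 := by
      by_contra hcon
      nlinarith
    have hL := b.1.2
    simp only [Set.mem_Icc]
    omega
  refine ((Set.finite_Icc (b.2 - L - 1) (b.2 + L + 1)).prod
    (Set.finite_Icc (b.2 - L - 1) (b.2 + L + 1))).subset ?_
  intro kk hkk
  exact ⟨key _ hkk.1, key _ hkk.2.1⟩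

/-! ### The random circuit and the second moment -/

/-- An alternating layered ansatz with `m`-qubit blocks, a target gate in one of its blocks, an
input state, a Hamiltonian, and the distributions of the random blocks. -/
structure Setting (m : ℕ) [NeZero m] where
  /-- number of blocks in each layer -/
  ξ : ℕ
  [ξ_ne : NeZero ξ]
  /-- number of layers -/
  L : ℕ
  /-- layer of the target block `W`, counted from `0` -/
  layer : Fin L
  /-- position of `W` in its layer -/
  block : Fin ξ
  /-- the qubit of `W` on which the target gate `R` acts: `W = W_A (1 ⊗ R) W_B` -/
  pos : Fin m
  /-- kind of target gate -/
  opt : Optimizer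
  /-- distributions of the independent random unitaries: `none` stands for `W_A`,
  `some (layer, block)` stands for `W_B`, and `some b` for the block `b` if `b` is not `W` -/
  law : Option (Fin L × Fin ξ) → Measure (BlockUnitary m)
  law_twoDesign : ∀ b, IsTwoDesign (law b)
  /-- number of terms of the Hamiltonian -/
  N : ℕ
  /-- coefficient of the identity -/
  c₀ : ℝ
  /-- coefficients of the Pauli terms -/
  c : Fin N → ℝ
  /-- `h_i` acts on the `m` neighbouring qubits starting at `start i` -/
  start : Fin N → Qubit ξ m
  /-- `h_i` as a tensor product of Pauli matrices on these `m` qubits -/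
  h : Fin N → Fin m → Fin 4
  /-- the terms `h_i` are pairwise different operators on the `n` qubits -/
  h_injective : Function.Injective fun i : Fin N =>
    onQubits (fun a : Fin m => start i + ((a : ℕ) : Qubit ξ m)) (pauliString (h i))
  /-- input state -/
  ρ : Op (Qubit ξ m)
  ρ_posSemidef : ρ.PosSemidef
  ρ_trace : ρ.trace = 1

attribute [instance] Setting.ξ_ne

namespace Setting

variable {m : ℕ} [NeZero m] (X : Setting m)

/-- The number of qubits. -/
def n : ℕ := X.ξ * m

/-- The layer number `l` of the target block, counted from `1`. -/
def l : ℕ := (X.layer : ℕ) + 1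

/-- The number `p`, one more than the number of degrees of freedom of the target gate. -/
def p : ℕ := X.opt.p

/-- Values of all random unitaries. -/
abbrev Gates : Type := Option (Fin X.L × Fin X.ξ) → BlockUnitary m

/-- The joint distribution of the independent random unitaries. -/
noncomputable def gatesLaw : Measure X.Gates := Measure.pi X.law

/-- The Hamiltonian `H = c₀ 1 + ∑ i, c_i h_i`. -/
noncomputable def H : Op (Qubit X.ξ m) :=
  (X.c₀ : ℂ) • (1 : Op (Qubit X.ξ m)) + ∑ i, (X.c i : ℂ) •
    onQubits (fun a : Fin m => X.start i + ((a : ℕ) : Qubit X.ξ m)) (pauliString (X.h i))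

/-- Layer `j`, the tensor product of its blocks, with `W_B` in place of `W`. -/
noncomputable def layerOp (g : X.Gates) (j : Fin X.L) : Op (Qubit X.ξ m) :=
  Matrix.of fun x y => ∏ k : Fin X.ξ,
    (g (some (j, k))).1 (fun i => x (blockQubit X.ξ m X.L j k i))
      (fun i => y (blockQubit X.ξ m X.L j k i))

/-- The circuit `U₁` before the target gate. -/
noncomputable def U₁ (g : X.Gates) : Op (Qubit X.ξ m) :=
  ((((List.finRange X.L).filter (fun j => j ≤ X.layer)).reverse).map (X.layerOp g)).prod

/-- The circuit `U₂` after the target gate. -/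
noncomputable def U₂ (g : X.Gates) : Op (Qubit X.ξ m) :=
  ((((List.finRange X.L).filter (fun j => X.layer < j)).reverse).map (X.layerOp g)).prod *
    onQubits (blockQubit X.ξ m X.L X.layer X.block) (g none).1

/-- The matrix `S` of the target gate. -/
noncomputable def S (g : X.Gates) : Matrix (Fin X.p) (Fin X.p) ℝ :=
  quadMatrix (X.U₁ g * X.ρ * (X.U₁ g)ᴴ) ((X.U₂ g)ᴴ * X.H * X.U₂ g)
    (fun μ => onQubit (blockQubit X.ξ m X.L X.layer X.block X.pos) (X.opt.gen μ))

/-- The squared spectral radius of the centered matrix. -/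
noncomputable def radiusSq (g : X.Gates) : ℝ :=
  (spectralRadius ℝ (centered (X.S g))).toReal ^ 2

/-- The second moment `𝔼[r(S_c)²]`. -/
noncomputable def secondMoment : ℝ := ∫ g, X.radiusSq g ∂X.gatesLaw

/-- The target block `W` in the unrolled circuit. -/
def target : LineBlock X.L := (X.layer, (X.block : ℤ))

open Classical in
/-- The `i` such that `h_i` acts on qubits in the forward light-cone of `W`. -/
noncomputable def forwardTerms : Finset (Fin X.N) :=
  Finset.univ.filter fun i => ∃ z : ℤ, (z : Qubit X.ξ m) = X.start i ∧
    ∀ a : Fin m, X.h i a ≠ 0 → z + (a : ℕ) ∈ coneSites m (forwardCone m X.target)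

/-- The pairs `(k, k')`, `k ≤ k'`, of subsystems in the backward light-cone of `W`. -/
noncomputable def pairs : Finset (ℤ × ℤ) := (finite_backwardPairs X.ξ m X.target).toFinset

/-- `ρ_{k,k'}`, the reduced density matrix of the input state on `S_k S_{k+1} ⋯ S_{k'}`. -/
noncomputable def ρred (k k' : ℤ) :
    Op ((subsysSites m k k').image (fun z : ℤ => (z : Qubit X.ξ m))) :=
  reduced ((subsysSites m k k').image (fun z : ℤ => (z : Qubit X.ξ m))) X.ρ

/-- The term `c_i² ε(ρ_{k,k'}) ε(h_i)`. -/
noncomputable def term (i : Fin X.N) (kk : ℤ × ℤ) : ℝ :=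
  X.c i ^ 2 * epsilon (X.ρred kk.1 kk.2) * epsilon (pauliString (X.h i))

end Setting

end ALA

set_option linter.unusedSectionVars false

/-! The proof reduces everything to a Markov chain on Pauli strings. In the Pauli basis a unitary
acts by its transfer matrix. For a unitary 2-design the second moments of the entries are the Haar
ones: different entries are uncorrelated, the identity string stays fixed, and a non-trivial string
goes to each non-trivial string with the same weight `1/(4^m - 1)`
(`IsTwoDesign.integral_transfer`). Hence, after at least one random layer, distinct Pauli
coefficients of an evolved operator are uncorrelated, and their mean squares evolve by a symmetric
kernel that factors over the blocks (`integral_coeff_succ`, `moment_succ`).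

At the target gate, `r(S_c)²` is at least `1/p` times the squared Frobenius norm of `S_c`. The
entries of `S_c` are bilinear in the Pauli coefficients of the state and of the Hamiltonian, with
letters off the target qubit matched. Since `U₁` and `U₂` are independent and the coefficients are
uncorrelated, only squares survive. Keeping only strings on the target block, over which `W_A` and
`W_B` spread the weight evenly, leaves a product: the weight of the state on the block, the weight
of the Hamiltonian on the block, and a single-qubit constant `2(p+2)(p-1)`, the same formula for all
three gates (`sum_centered_pauliQuad`, `le_secondMoment`).

All factors `1/(2^m + 1)` are the probability `(4^(m/2) - 1)/(4^m - 1)` that a non-trivial string on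
a block is sent into a prescribed half of that block (`sum_twirl_ge`).

State side. Non-trivial strings on a block arise from strings on the left lower neighbour, on the
right one, or on both; forcing the support into the block costs one factor per lower neighbour, and
the three outcomes are disjoint (`suppWeight_step`). By induction over the layers the weight at `W`
dominates a sum over all windows of consecutive blocks in the backward cone (`coneSum_le`), at a
cost of two factors per layer. The windows carry powers of `2^m` that turn Pauli weights into
`ε(ρ_{k,k'})`. One more factor pays for the groups `S_k` not being aligned with the first layer
(`sum_pairs_le`).

Hamiltonian side. By duality a string on the target block is evolved forward and read off at the
`h_i`. It suffices to follow one path of blocks from `W` to `h_i`, at one factor per layer; a term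
that straddles two blocks of the last layer pays two factors there (`le_of_mem_forwardTerms`).
Altogether `(2l - 1) + (L - l + 1) = L + l` factors appear. For fixed `m` the loss is exponential in
`L` only, which gives both asymptotic statements. -/

namespace ALA

/-! ### Tensor products -/

/-- The tensor product of the matrices `A k`. -/
def ptens {κ β : Type} [Fintype κ] (A : κ → Matrix β β ℂ) : Matrix (κ → β) (κ → β) ℂ :=
  Matrix.of fun x y => ∏ k, A k (x k) (y k)

section Tensor

variable {κ β : Type} [Fintype κ]

theorem conjTranspose_ptens (A : κ → Matrix β β ℂ) : (ptens A)ᴴ = ptens fun k => (A k)ᴴ := by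
  ext x y
  simp [ptens, Matrix.conjTranspose_apply]

theorem ptens_one [DecidableEq β] : ptens (fun _ : κ => (1 : Matrix β β ℂ)) = 1 := by
  ext x y
  simp only [ptens, Matrix.of_apply, Matrix.one_apply, Finset.prod_ite_zero, Finset.prod_const_one,
    funext_iff, Finset.mem_univ, true_imp_iff]

theorem ptens_smul (c : κ → ℂ) (A : κ → Matrix β β ℂ) :
    ptens (fun k => c k • A k) = (∏ k, c k) • ptens A := by
  ext x y
  simp [ptens, Finset.prod_mul_distrib]

variable [DecidableEq κ] [Fintype β]

theorem ptens_mul (A B : κ → Matrix β β ℂ) :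
    ptens A * ptens B = ptens fun k => A k * B k := by
  ext x y
  simp only [ptens, Matrix.mul_apply, Matrix.of_apply, Finset.prod_univ_sum,
    Fintype.piFinset_univ, Finset.prod_mul_distrib]

theorem trace_ptens (A : κ → Matrix β β ℂ) : (ptens A).trace = ∏ k, (A k).trace := by
  simp only [ptens, Matrix.trace, Matrix.diag, Matrix.of_apply, Finset.prod_univ_sum,
    Fintype.piFinset_univ]

end Tensor

/-! ### Pauli strings -/

theorem pauliString_eq_ptens {κ : Type} [Fintype κ] (P : κ → Fin 4) :
    pauliString P = ptens fun i => pauli (P i) := rfl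

theorem conjTranspose_pauli (a : Fin 4) : (pauli a)ᴴ = pauli a := by
  fin_cases a <;> ext i j <;> fin_cases i <;> fin_cases j <;> simp [pauli]

theorem pauli_mul_self (a : Fin 4) : pauli a * pauli a = 1 := by
  fin_cases a <;> ext i j <;> fin_cases i <;> fin_cases j <;> simp [pauli, Matrix.mul_apply]

theorem pauli_completeness (x y z w : Fin 2) :
    ∑ a, pauli a x y * pauli a z w = if x = w ∧ y = z then 2 else 0 := by
  fin_cases x <;> fin_cases y <;> fin_cases z <;> fin_cases w <;>
    simp [pauli, Fin.sum_univ_four] <;> norm_num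

theorem trace_pauli_mul (a b : Fin 4) :
    (pauli a * pauli b).trace = if a = b then 2 else 0 := by
  fin_cases a <;> fin_cases b <;>
    simp [pauli, Matrix.trace, Fin.sum_univ_two] <;> norm_num

/-- The sign with which two Pauli matrices commute. -/
def pauliSign (a b : Fin 4) : ℤ := if a = 0 ∨ b = 0 ∨ a = b then 1 else -1

theorem pauli_mul_comm (a b : Fin 4) :
    pauli a * pauli b = (pauliSign a b : ℂ) • (pauli b * pauli a) := by
  fin_cases a <;> fin_cases b <;> ext i j <;> fin_cases i <;> fin_cases j <;>
    simp [pauli, pauliSign, Matrix.mul_apply, Fin.sum_univ_two]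

section Strings

variable {κ : Type} [Fintype κ] [DecidableEq κ]

theorem conjTranspose_pauliString (P : κ → Fin 4) : (pauliString P)ᴴ = pauliString P := by
  simp [pauliString_eq_ptens, conjTranspose_ptens, conjTranspose_pauli]

theorem pauliString_zero : pauliString (0 : κ → Fin 4) = 1 := by
  rw [pauliString_eq_ptens, ← ptens_one]
  simp [pauli]

theorem pauliString_mul_self (P : κ → Fin 4) : pauliString P * pauliString P = 1 := by
  simp [pauliString_eq_ptens, ptens_mul, pauli_mul_self, ptens_one]

theorem trace_pauliString_mul (P Q : κ → Fin 4) :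
    (pauliString P * pauliString Q).trace = if P = Q then 2 ^ Fintype.card κ else 0 := by
  simp only [pauliString_eq_ptens, ptens_mul, trace_ptens, trace_pauli_mul, Finset.prod_ite_zero,
    funext_iff, Finset.mem_univ, true_imp_iff, Finset.prod_const, Finset.card_univ]

theorem pauliString_completeness (x y z w : κ → Fin 2) :
    ∑ P : κ → Fin 4, pauliString P x y * pauliString P z w =
      if x = w ∧ y = z then 2 ^ Fintype.card κ else 0 := by
  have h : ∀ P : κ → Fin 4, pauliString P x y * pauliString P z w =
      ∏ i, pauli (P i) (x i) (y i) * pauli (P i) (z i) (w i) := fun P => by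
    simp [pauliString, Finset.prod_mul_distrib]
  have h2 := Finset.prod_univ_sum (fun _ : κ => (Finset.univ : Finset (Fin 4)))
    (fun i a => pauli a (x i) (y i) * pauli a (z i) (w i))
  rw [Fintype.piFinset_univ] at h2
  rw [Finset.sum_congr rfl fun P _ => h P, ← h2]
  simp only [pauli_completeness, Finset.prod_ite_zero, Finset.prod_const, Finset.card_univ,
    funext_iff, Finset.mem_univ, true_imp_iff, forall_and]

/-- The sign with which two Pauli strings commute. -/
def stringSign (P Q : κ → Fin 4) : ℤ := ∏ i, pauliSign (P i) (Q i)

theorem pauliString_mul_comm (P Q : κ → Fin 4) :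
    pauliString P * pauliString Q = (stringSign P Q : ℂ) • (pauliString Q * pauliString P) := by
  simp only [pauliString_eq_ptens, ptens_mul, stringSign, Int.cast_prod, ← ptens_smul,
    ← pauli_mul_comm]

/-- Parseval identity for the Pauli basis: completeness contracts the two traces into one. It serves
throughout to insert the Pauli basis between two operators. -/
theorem sum_trace_pauliString_mul (A B : Op κ) :
    ∑ P : κ → Fin 4, (pauliString P * A).trace * (pauliString P * B).trace =
      2 ^ Fintype.card κ * (A * B).trace := by
  have e : ∀ (P : κ → Fin 4) (A : Op κ),
      (pauliString P * A).trace = ∑ t : (κ → Fin 2) × (κ → Fin 2), pauliString P t.1 t.2 * A t.2 t.1 :=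
    fun P A => by simp [Matrix.trace, Matrix.mul_apply, Fintype.sum_prod_type]
  calc _ = ∑ P : κ → Fin 4, ∑ t : (κ → Fin 2) × (κ → Fin 2), ∑ s : (κ → Fin 2) × (κ → Fin 2),
        (pauliString P t.1 t.2 * pauliString P s.1 s.2) * (A t.2 t.1 * B s.2 s.1) := by
        refine Finset.sum_congr rfl fun P _ => ?_
        rw [e, e, Finset.sum_mul_sum]
        refine Finset.sum_congr rfl fun t _ => Finset.sum_congr rfl fun s _ => by ring
    _ = ∑ t : (κ → Fin 2) × (κ → Fin 2), ∑ s : (κ → Fin 2) × (κ → Fin 2),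
        (∑ P : κ → Fin 4, pauliString P t.1 t.2 * pauliString P s.1 s.2) *
          (A t.2 t.1 * B s.2 s.1) := by
        rw [Finset.sum_comm]
        refine Finset.sum_congr rfl fun t _ => ?_
        rw [Finset.sum_comm]
        refine Finset.sum_congr rfl fun s _ => by rw [Finset.sum_mul]
    _ = ∑ t : (κ → Fin 2) × (κ → Fin 2), 2 ^ Fintype.card κ * (A t.2 t.1 * B t.1 t.2) := by
        refine Finset.sum_congr rfl fun t _ => ?_
        -- Completeness leaves only the index pair that is swapped relative to `t`.
        rw [Finset.sum_eq_single (t.2, t.1)]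
        · simp [pauliString_completeness]
        · intro s _ hs
          rw [pauliString_completeness, if_neg, zero_mul]
          rintro ⟨h1, h2⟩
          exact hs (Prod.ext h2.symm h1.symm)
        · simp
    _ = _ := by
        rw [← Finset.mul_sum, Matrix.trace_mul_comm]
        simp [Matrix.trace, Matrix.mul_apply, Fintype.sum_prod_type, mul_comm]

end Strings

/-! ### The Hilbert–Schmidt inner product -/

/-- The real part of the Hilbert–Schmidt inner product of Hermitian matrices. -/
noncomputable def hs {n : Type} [Fintype n] (A B : Matrix n n ℂ) : ℝ := (A * B).trace.re

section HS

variable {n : Type} [Fintype n]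

theorem hs_comm (A B : Matrix n n ℂ) : hs A B = hs B A := by
  rw [hs, hs, Matrix.trace_mul_comm]

/-- The trace of a product of two Hermitian matrices equals its own conjugate by cyclicity, so
passing to real parts loses nothing. -/
theorem ofReal_hs {A B : Matrix n n ℂ} (hA : A.IsHermitian) (hB : B.IsHermitian) :
    ((hs A B : ℝ) : ℂ) = (A * B).trace := by
  have h : star (A * B).trace = (A * B).trace := by
    rw [← Matrix.trace_conjTranspose, Matrix.conjTranspose_mul, hA.eq, hB.eq, Matrix.trace_mul_comm]
  exact Complex.conj_eq_iff_re.mp h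

theorem isHermitian_pauliString {κ : Type} [Fintype κ] [DecidableEq κ] (P : κ → Fin 4) :
    (pauliString P).IsHermitian := conjTranspose_pauliString P

theorem hs_conj (U A B : Matrix n n ℂ) : hs A (Uᴴ * B * U) = hs (U * A * Uᴴ) B := by
  rw [hs, hs, ← Matrix.mul_assoc, ← Matrix.mul_assoc, Matrix.trace_mul_comm]
  simp only [Matrix.mul_assoc]

theorem hs_parseval {κ : Type} [Fintype κ] [DecidableEq κ] {A B : Op κ}
    (hA : A.IsHermitian) (hB : B.IsHermitian) :
    ∑ P : κ → Fin 4, hs (pauliString P) A * hs (pauliString P) B =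
      2 ^ Fintype.card κ * hs A B := by
  have h := sum_trace_pauliString_mul A B
  simp only [← ofReal_hs (isHermitian_pauliString _) hA, ← ofReal_hs (isHermitian_pauliString _) hB,
    ← ofReal_hs hA hB] at h
  exact_mod_cast h

theorem hs_pauliString {κ : Type} [Fintype κ] [DecidableEq κ] (P Q : κ → Fin 4) :
    hs (pauliString P) (pauliString Q) = if P = Q then 2 ^ Fintype.card κ else 0 := by
  rw [hs, trace_pauliString_mul]
  split_ifs
  · norm_cast
  · simp

end HS

/-! ### Twirling with a unitary 2-design -/

/-- The Pauli transfer matrix of the Heisenberg evolution `P ↦ U† P U`. -/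
noncomputable def transfer {κ : Type} [Fintype κ] [DecidableEq κ] (U : Op κ) (Q P : κ → Fin 4) : ℝ :=
  hs (pauliString Q) (Uᴴ * pauliString P * U) / 2 ^ Fintype.card κ

section Transfer

variable {κ : Type} [Fintype κ] [DecidableEq κ]

theorem isHermitian_conj {n : Type} [Fintype n] {A : Matrix n n ℂ} (hA : A.IsHermitian)
    (U : Matrix n n ℂ) : (Uᴴ * A * U).IsHermitian :=
  Matrix.isHermitian_conjTranspose_mul_mul U hA

theorem isHermitian_conj' {n : Type} [Fintype n] {A : Matrix n n ℂ} (hA : A.IsHermitian)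
    (U : Matrix n n ℂ) : (U * A * Uᴴ).IsHermitian :=
  Matrix.isHermitian_mul_mul_conjTranspose U hA

theorem transfer_one (Q P : κ → Fin 4) : transfer 1 Q P = if Q = P then 1 else 0 := by
  simp only [transfer, conjTranspose_one, one_mul, mul_one, hs_pauliString]
  split_ifs <;> simp

theorem transfer_zero_right {U : Op κ} (hU : Uᴴ * U = 1) (Q : κ → Fin 4) :
    transfer U Q 0 = if Q = 0 then 1 else 0 := by
  rw [← transfer_one, transfer, transfer, pauliString_zero]
  simp [hU]

/-- Conjugation by a unitary preserves the Hilbert–Schmidt product, so the rows of the transfer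
matrix are orthonormal. -/
theorem sum_transfer_mul {U : Op κ} (hU : Uᴴ * U = 1) (R R' : κ → Fin 4) :
    ∑ P, transfer U R P * transfer U R' P = if R = R' then 1 else 0 := by
  have h0 : (2 : ℝ) ^ Fintype.card κ ≠ 0 := by positivity
  have e : ∀ R P, transfer U R P =
      hs (pauliString P) (U * pauliString R * Uᴴ) / 2 ^ Fintype.card κ := fun R P => by
    rw [transfer, hs_conj, hs_comm]
  have h := hs_parseval (isHermitian_conj' (isHermitian_pauliString R) U)
    (isHermitian_conj' (isHermitian_pauliString R') U)
  have h3 : hs (U * pauliString R * Uᴴ) (U * pauliString R' * Uᴴ) =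
      hs (pauliString R) (pauliString R') := by
    rw [← hs_conj]
    congr 1
    simp only [← Matrix.mul_assoc, hU, one_mul]
    rw [Matrix.mul_assoc, hU, mul_one]
  rw [h3, hs_pauliString] at h
  simp only [e, div_mul_div_comm, ← Finset.sum_div, h]
  split_ifs
  · field_simp
  · simp

/-- In the Heisenberg picture the left factor acts first on `P`. A left factor that maps one string
to a multiple of another therefore only relabels `P`, which makes left invariance of the Haar
measure usable. -/
theorem transfer_mul_left (V U : Op κ) {P P' : κ → Fin 4} {c : ℝ}
    (h : Vᴴ * pauliString P * V = (c : ℂ) • pauliString P') (R : κ → Fin 4) :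
    transfer (V * U) R P = c * transfer U R P' := by
  have : (V * U)ᴴ * pauliString P * (V * U) = (c : ℂ) • (Uᴴ * pauliString P' * U) := by
    rw [conjTranspose_mul, ← Matrix.smul_mul, ← Matrix.mul_smul, ← h]
    simp only [Matrix.mul_assoc]
  rw [transfer, this, transfer, hs, hs, Matrix.mul_smul, Matrix.trace_smul, smul_eq_mul,
    Complex.re_ofReal_mul, mul_div_assoc]

theorem pauliString_mem_unitaryGroup (P : κ → Fin 4) :
    pauliString P ∈ Matrix.unitaryGroup (κ → Fin 2) ℂ := by
  rw [Matrix.mem_unitaryGroup_iff, Matrix.star_eq_conjTranspose, conjTranspose_pauliString,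
    pauliString_mul_self]

theorem stringSign_single (i : κ) (a : Fin 4) (P : κ → Fin 4) :
    stringSign (Pi.single i a) P = pauliSign a (P i) := by
  rw [stringSign, Finset.prod_eq_single i]
  · simp
  · intro j _ hj
    simp [Pi.single_eq_of_ne hj, pauliSign]
  · simp

theorem stringSign_eq (P Q : κ → Fin 4) : stringSign P Q = 1 ∨ stringSign P Q = -1 := by
  refine Finset.prod_induction _ (fun x : ℤ => x = 1 ∨ x = -1) ?_ (Or.inl rfl) ?_
  · rintro a b (rfl | rfl) (rfl | rfl) <;> simp
  · intro i _
    unfold pauliSign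
    split_ifs <;> simp

theorem exists_stringSign_ne {P P' : κ → Fin 4} (h : P ≠ P') :
    ∃ V, stringSign V P ≠ stringSign V P' := by
  obtain ⟨i, hi⟩ := Function.ne_iff.mp h
  have key : ∀ a b : Fin 4, a ≠ b → ∃ c, pauliSign c a ≠ pauliSign c b := by decide
  obtain ⟨c, hc⟩ := key _ _ hi
  exact ⟨Pi.single i c, by simpa [stringSign_single] using hc⟩

/-- Any two non-trivial strings are joined by two anticommuting steps. If the supports meet, one
letter at a common site suffices; otherwise one letter is placed on each support, and only one of
them is seen by each string. -/
theorem exists_anticommuting {P P' : κ → Fin 4} (h : P ≠ 0) (h' : P' ≠ 0) :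
    ∃ V, stringSign P V = -1 ∧ stringSign V P' = -1 := by
  have key : ∀ a b : Fin 4, a ≠ 0 → b ≠ 0 → ∃ c, pauliSign a c = -1 ∧ pauliSign c b = -1 := by
    decide
  have key1 : ∀ a : Fin 4, a ≠ 0 → ∃ c, pauliSign a c = -1 ∧ pauliSign c a = -1 := by decide
  have comm : ∀ P Q : κ → Fin 4, stringSign P Q = stringSign Q P := fun P Q => by
    refine Finset.prod_congr rfl fun i _ => ?_
    unfold pauliSign
    grind
  obtain ⟨i, hi⟩ := Function.ne_iff.mp h
  obtain ⟨j, hj⟩ := Function.ne_iff.mp h'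
  by_cases hb : ∃ k, P k ≠ 0 ∧ P' k ≠ 0
  · obtain ⟨k, h1, h2⟩ := hb
    obtain ⟨c, hc, hc'⟩ := key _ _ h1 h2
    refine ⟨Pi.single k c, ?_, ?_⟩
    · rw [comm, stringSign_single]
      unfold pauliSign at *
      grind
    · rwa [stringSign_single]
  · push Not at hb
    have hi' : P' i = 0 := hb i hi
    have hj' : P j = 0 := by
      by_contra hc
      exact hj (hb j hc)
    have hij : i ≠ j := by
      rintro rfl
      exact hi hj'
    -- Disjoint supports: `c` sits where only `P` acts, `d` where only `P'` acts.
    obtain ⟨c, hc, hc'⟩ := key1 _ hi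
    obtain ⟨d, hd, hd'⟩ := key1 _ hj
    have hV : ∀ Q : κ → Fin 4, stringSign (Function.update (Pi.single i c) j d) Q =
        pauliSign c (Q i) * pauliSign d (Q j) := by
      intro Q
      have : ∀ k, pauliSign (Function.update (Pi.single i c : κ → Fin 4) j d k) (Q k) =
          (if k = i then pauliSign c (Q i) else 1) * (if k = j then pauliSign d (Q j) else 1) := by
        intro k
        by_cases hk : k = j
        · subst hk
          simp [hij.symm]
        · by_cases hk' : k = i
          · subst hk'
            simp [hij]
          · simp [hk, hk', pauliSign]
      rw [stringSign, Finset.prod_congr rfl fun k _ => this k, Finset.prod_mul_distrib]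
      simp
    refine ⟨Function.update (Pi.single i c) j d, ?_, ?_⟩
    · rw [comm, hV, hj', hc']
      simp [pauliSign]
    · rw [hV, hi', hd']
      simp [pauliSign]

theorem conj_pauliString (V P : κ → Fin 4) :
    (pauliString V)ᴴ * pauliString P * pauliString V =
      ((stringSign V P : ℝ) : ℂ) • pauliString P := by
  rw [conjTranspose_pauliString, pauliString_mul_comm, Matrix.smul_mul, Matrix.mul_assoc,
    pauliString_mul_self, mul_one]
  simp

/-- Two anticommuting Pauli strings are conjugate by a unitary. -/
theorem exists_unitary_conj {P Q : κ → Fin 4} (h : stringSign P Q = -1) :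
    ∃ V ∈ Matrix.unitaryGroup (κ → Fin 2) ℂ,
      Vᴴ * pauliString P * V = ((1 : ℝ) : ℂ) • pauliString Q := by
  set A := pauliString P
  set B := pauliString Q
  have hAB : A * B = -(B * A) := by
    simpa [h] using pauliString_mul_comm P Q
  have hA : A * A = 1 := pauliString_mul_self P
  have hB : B * B = 1 := pauliString_mul_self Q
  -- The conjugating unitary is `(A + B)/√2`. It squares to `1` because the mixed products cancel,
  -- and it exchanges `A` and `B` as the Hadamard gate exchanges `X` and `Z`.
  set s : ℂ := (((Real.sqrt 2)⁻¹ : ℝ) : ℂ) with hs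
  have hs2 : s * s = 1 / 2 := by
    rw [hs, ← Complex.ofReal_mul, ← mul_inv, Real.mul_self_sqrt (by norm_num)]
    norm_num
  have hstar : star s = s := by rw [hs]; exact Complex.conj_ofReal _
  have hV : (s • (A + B))ᴴ = s • (A + B) := by
    rw [conjTranspose_smul, hstar, conjTranspose_add, conjTranspose_pauliString,
      conjTranspose_pauliString]
  refine ⟨s • (A + B), ?_, ?_⟩
  · rw [Matrix.mem_unitaryGroup_iff, Matrix.star_eq_conjTranspose, hV, Matrix.smul_mul,
      Matrix.mul_smul, smul_smul, hs2, add_mul, mul_add, mul_add, hA, hB, hAB]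
    have : (1 : Op κ) + -(B * A) + (B * A + 1) = (2 : ℂ) • 1 := by
      rw [two_smul]
      abel
    rw [this, smul_smul]
    norm_num
  · rw [hV, Matrix.smul_mul, Matrix.smul_mul, Matrix.mul_smul, smul_smul, hs2]
    have e1 : (A + B) * A * (A + B) = (2 : ℂ) • B := by
      have h1 : A * A * A = A := by rw [hA, one_mul]
      have h2 : A * A * B = B := by rw [hA, one_mul]
      have h3 : B * A * A = B := by rw [Matrix.mul_assoc, hA, mul_one]
      have h4 : B * A * B = -A := by
        rw [Matrix.mul_assoc, hAB, mul_neg, ← Matrix.mul_assoc, hB, one_mul]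
      rw [add_mul, add_mul, mul_add, mul_add, h1, h2, h3, h4, two_smul]
      abel
    rw [e1, smul_smul]
    norm_num

end Transfer

/-! ### Second moments of transfer matrices under the Haar measure and under 2-designs -/

section Design

variable {m : ℕ}

instance : SecondCountableTopology (BlockUnitary m) :=
  haveI : SecondCountableTopology (Op (Fin m)) :=
    inferInstanceAs (SecondCountableTopology ((Fin m → Fin 2) → (Fin m → Fin 2) → ℂ))
  TopologicalSpace.Subtype.secondCountableTopology _

instance : IsProbabilityMeasure (haarU m) :=
  ⟨by simpa [haarU] using Measure.haarMeasure_self (K₀ := (⊤ : TopologicalSpace.PositiveCompacts (BlockUnitary m)))⟩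

instance : (haarU m).IsMulLeftInvariant := by
  unfold haarU
  infer_instance

theorem continuous_transfer {m : ℕ} (Q P : Fin m → Fin 4) :
    Continuous fun U : BlockUnitary m => transfer U.1 Q P := by
  unfold transfer hs
  have hc : Continuous fun U : BlockUnitary m => (U.1 : Op (Fin m)) := continuous_subtype_val
  refine (Complex.continuous_re.comp ?_).div_const _
  exact (continuous_const.matrix_mul
    ((hc.matrix_conjTranspose.matrix_mul continuous_const).matrix_mul hc)).matrix_trace

theorem integrable_of_continuous {α : Type*} [TopologicalSpace α] [CompactSpace α]
    [MeasurableSpace α] [OpensMeasurableSpace α] {E : Type*} [NormedAddCommGroup E]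
    [SecondCountableTopologyEither α E]
    {μ : Measure α} [IsFiniteMeasure μ] {f : α → E} (hf : Continuous f) : Integrable f μ :=
  hf.integrable_of_hasCompactSupport (HasCompactSupport.of_compactSpace f)

/-- The second moments of the Pauli transfer matrix of a unitary 2-design. -/
noncomputable def twirl {κ : Type} [Fintype κ] (Q P : κ → Fin 4) : ℝ :=
  if Q = 0 then (if P = 0 then 1 else 0)
  else if P = 0 then 0 else ((4 : ℝ) ^ Fintype.card κ - 1)⁻¹

/-- Left invariance of the Haar measure allows replacing `U` by `V U`, and `V` is then absorbed into
the strings. -/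
theorem integral_transfer_mul_conj {P P' P₁ P₁' : Fin m → Fin 4} {c c' : ℝ}
    {V : Op (Fin m)} (hV : V ∈ Matrix.unitaryGroup (Fin m → Fin 2) ℂ)
    (h : Vᴴ * pauliString P * V = (c : ℂ) • pauliString P₁)
    (h' : Vᴴ * pauliString P' * V = (c' : ℂ) • pauliString P₁') (R R' : Fin m → Fin 4) :
    ∫ U : BlockUnitary m, transfer U.1 R P * transfer U.1 R' P' ∂(haarU m) =
      c * c' * ∫ U : BlockUnitary m, transfer U.1 R P₁ * transfer U.1 R' P₁' ∂(haarU m) := by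
  rw [← integral_mul_left_eq_self (μ := haarU m)
    (fun U : BlockUnitary m => transfer U.1 R P * transfer U.1 R' P') ⟨V, hV⟩,
    ← integral_const_mul]
  refine integral_congr_ae (Filter.Eventually.of_forall fun U => ?_)
  simp only [Submonoid.coe_mul]
  rw [transfer_mul_left V U.1 h, transfer_mul_left V U.1 h']
  ring

theorem BlockUnitary.conjTranspose_mul_self (U : BlockUnitary m) : U.1ᴴ * U.1 = 1 :=
  Matrix.mem_unitaryGroup_iff'.mp U.2

theorem integrable_transfer_mul (μ : Measure (BlockUnitary m)) [IsFiniteMeasure μ]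
    (R R' P P' : Fin m → Fin 4) :
    Integrable (fun U : BlockUnitary m => transfer U.1 R P * transfer U.1 R' P') μ :=
  integrable_of_continuous ((continuous_transfer R P).mul (continuous_transfer R' P'))

/-- Pauli unitaries flip the sign of the integral if `P ≠ P'`. For `P = P'` the integral is constant
over non-trivial `P`, since such strings are linked by unitary conjugations. Orthonormality of the
rows gives the sum over all `P`, hence the constant. -/
theorem integral_transfer_haar (R R' P P' : Fin m → Fin 4) :
    ∫ U : BlockUnitary m, transfer U.1 R P * transfer U.1 R' P' ∂(haarU m) =
      if P = P' ∧ R = R' then twirl R P else 0 := by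
  by_cases hP : P = P'
  swap
  · rw [if_neg fun h => hP h.1]
    obtain ⟨V, hV⟩ := exists_stringSign_ne hP
    have h := integral_transfer_mul_conj (pauliString_mem_unitaryGroup V)
      (conj_pauliString V P) (conj_pauliString V P') R R'
    -- `V` commutes with exactly one of the two strings, so the integral equals its own negative.
    have hs : (stringSign V P : ℝ) * stringSign V P' = -1 := by
      rcases stringSign_eq V P with h1 | h1 <;> rcases stringSign_eq V P' with h2 | h2 <;>
        simp [h1, h2] at hV ⊢
    rw [hs] at h
    linarith
  subst hP
  have hzero : ∀ S S' : Fin m → Fin 4,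
      ∫ U : BlockUnitary m, transfer U.1 S 0 * transfer U.1 S' 0 ∂(haarU m) =
        if S = 0 ∧ S' = 0 then 1 else 0 := by
    intro S S'
    simp only [transfer_zero_right (BlockUnitary.conjTranspose_mul_self _)]
    by_cases h1 : S = 0 <;> by_cases h2 : S' = 0 <;> simp [h1, h2]
  by_cases h0 : P = 0
  · subst h0
    rw [hzero]
    by_cases h1 : R = 0
    · subst h1
      by_cases h2 : R' = 0 <;> simp [h2, twirl, eq_comm]
    · by_cases h2 : R = R' <;> simp [h1, h2, twirl]
  set f : (Fin m → Fin 4) → ℝ := fun Q =>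
    ∫ U : BlockUnitary m, transfer U.1 R Q * transfer U.1 R' Q ∂(haarU m) with hf
  have hanti : ∀ Q Q', stringSign Q Q' = -1 → f Q = f Q' := fun Q Q' h => by
    obtain ⟨V, hV, hc⟩ := exists_unitary_conj h
    simpa using integral_transfer_mul_conj hV hc hc R R'
  have hconst : ∀ Q, Q ≠ 0 → f Q = f P := fun Q hQ => by
    obtain ⟨V, h1, h2⟩ := exists_anticommuting hQ h0
    rw [hanti _ _ h1, hanti _ _ h2]
  have hsum : ∑ Q, f Q = if R = R' then 1 else 0 := by
    rw [hf, ← integral_finsetSum _ fun Q _ => integrable_transfer_mul _ _ _ _ _]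
    simp [sum_transfer_mul (BlockUnitary.conjTranspose_mul_self _)]
  -- The sum over `P` splits into the identity term, which is known, and `4^m - 1` equal terms.
  rw [← Finset.add_sum_erase _ _ (Finset.mem_univ (0 : Fin m → Fin 4)),
    Finset.sum_congr rfl fun Q hQ => hconst Q (Finset.ne_of_mem_erase hQ), Finset.sum_const,
    Finset.card_erase_of_mem (Finset.mem_univ _), Finset.card_univ, nsmul_eq_mul] at hsum
  have hf0 : f 0 = if R = 0 ∧ R' = 0 then 1 else 0 := hzero R R'
  have hcard : ((Fintype.card (Fin m → Fin 4) - 1 : ℕ) : ℝ) = (4 : ℝ) ^ m - 1 := by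
    rw [Nat.cast_sub Fintype.card_pos]
    simp
  have hpos : (4 : ℝ) ^ m - 1 ≠ 0 := by
    have hm : m ≠ 0 := by
      rintro rfl
      exact h0 (Subsingleton.elim _ _)
    have : (1 : ℝ) < 4 ^ m := one_lt_pow₀ (by norm_num) hm
    linarith
  rw [hf0, hcard] at hsum
  change f P = _
  by_cases h1 : R = R'
  · subst h1
    by_cases h2 : R = 0
    · simp only [h2, and_self, if_true, twirl, h0, if_false] at hsum ⊢
      have : (4 ^ m - 1) * f P = 0 := by linarith
      exact (mul_eq_zero.mp this).resolve_left hpos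
    · simp only [h2, and_self, if_true, twirl, h0, if_false, Fintype.card_fin] at hsum ⊢
      refine eq_inv_of_mul_eq_one_left ?_
      linarith
  · have h2 : ¬ (R = 0 ∧ R' = 0) := fun h => h1 (h.1.trans h.2.symm)
    simp only [h1, h2, and_false, if_false, zero_add] at hsum ⊢
    exact (mul_eq_zero.mp hsum).resolve_left hpos

theorem ofReal_transfer (U : Op (Fin m)) (R P : Fin m → Fin 4) :
    ((transfer U R P : ℝ) : ℂ) =
      ∑ s : ((Fin m → Fin 2) × (Fin m → Fin 2)) × ((Fin m → Fin 2) × (Fin m → Fin 2)),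
        pauliString R s.1.1 s.1.2 * pauliString P s.2.1 s.2.2 / 2 ^ m *
          (star (U s.2.1 s.1.2) * U s.2.2 s.1.1) := by
  rw [transfer, Complex.ofReal_div,
    ofReal_hs (isHermitian_pauliString R) (isHermitian_conj (isHermitian_pauliString P) U)]
  simp only [Matrix.trace, Matrix.diag, Matrix.mul_apply, Matrix.conjTranspose_apply,
    Fintype.sum_prod_type, Finset.mul_sum, Finset.sum_mul, Finset.sum_div, Fintype.card_fin]
  refine Finset.sum_congr rfl fun a _ => Finset.sum_congr rfl fun b _ => ?_
  rw [Finset.sum_comm]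
  refine Finset.sum_congr rfl fun c _ => Finset.sum_congr rfl fun d _ => ?_
  push_cast
  ring

/-- A product of two transfer entries is a linear combination of monomials with two entries of `U`
and two conjugate entries, exactly the moments that a 2-design shares with the Haar measure. -/
theorem IsTwoDesign.integral_transfer {μ : Measure (BlockUnitary m)} (hμ : IsTwoDesign μ)
    (R R' P P' : Fin m → Fin 4) :
    ∫ U : BlockUnitary m, transfer U.1 R P * transfer U.1 R' P' ∂μ =
      if P = P' ∧ R = R' then twirl R P else 0 := by
  rw [← integral_transfer_haar R R' P P']
  have := hμ.1
  have key : ∀ ν : Measure (BlockUnitary m), IsProbabilityMeasure ν →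
      ((∫ U : BlockUnitary m, transfer U.1 R P * transfer U.1 R' P' ∂ν : ℝ) : ℂ) =
      ∑ s : ((Fin m → Fin 2) × (Fin m → Fin 2)) × ((Fin m → Fin 2) × (Fin m → Fin 2)),
      ∑ t : ((Fin m → Fin 2) × (Fin m → Fin 2)) × ((Fin m → Fin 2) × (Fin m → Fin 2)),
        (pauliString R s.1.1 s.1.2 * pauliString P s.2.1 s.2.2 / 2 ^ m) *
        (pauliString R' t.1.1 t.1.2 * pauliString P' t.2.1 t.2.2 / 2 ^ m) *
        ∫ U : BlockUnitary m, U.1 s.2.2 s.1.1 * U.1 t.2.2 t.1.1 * star (U.1 s.2.1 s.1.2) *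
          star (U.1 t.2.1 t.1.2) ∂ν := by
    intro ν hν
    rw [← integral_complex_ofReal]
    simp only [Complex.ofReal_mul, ofReal_transfer, Finset.sum_mul_sum]
    have hc : ∀ a b, Continuous fun U : BlockUnitary m => U.1 a b := fun a b =>
      continuous_subtype_val.matrix_elem a b
    have hcs : ∀ a b, Continuous fun U : BlockUnitary m => star (U.1 a b) := fun a b =>
      (hc a b).star
    rw [integral_finsetSum]
    swap
    · refine fun s _ => integrable_of_continuous (continuous_finsetSum _ fun t _ => ?_)
      exact (continuous_const.mul ((hcs _ _).mul (hc _ _))).mul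
        (continuous_const.mul ((hcs _ _).mul (hc _ _)))
    refine Finset.sum_congr rfl fun s _ => ?_
    rw [integral_finsetSum]
    swap
    · refine fun t _ => integrable_of_continuous ?_
      exact (continuous_const.mul ((hcs _ _).mul (hc _ _))).mul
        (continuous_const.mul ((hcs _ _).mul (hc _ _)))
    refine Finset.sum_congr rfl fun t _ => ?_
    rw [← integral_const_mul]
    refine integral_congr_ae (Filter.Eventually.of_forall fun U => ?_)
    simp only
    ring
  have h1 := key μ inferInstance
  have h2 := key (haarU m) inferInstance
  simp only [hμ.2] at h1
  exact_mod_cast h1.trans h2.symm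

end Design

/-! ### Tensor products over the blocks of a partition of the qubits -/

/-- Labellings of all sites correspond to families of labellings of the blocks `e k`. -/
noncomputable def blockEquiv {ι κ β : Type} {e : κ → β → ι}
    (he : Function.Bijective fun t : κ × β => e t.1 t.2) (α : Type) :
    (ι → α) ≃ (κ → β → α) :=
  ((Equiv.ofBijective _ he).arrowCongr (Equiv.refl α)).symm.trans (Equiv.curry κ β α)

theorem blockEquiv_apply {ι κ β : Type} {e : κ → β → ι}
    (he : Function.Bijective fun t : κ × β => e t.1 t.2) {α : Type} (x : ι → α) (k : κ) :
    blockEquiv he α x k = fun i => x (e k i) := rfl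

/-- The tensor product of the operators `A k` on the blocks `e k`. -/
def tensorOn {ι κ β : Type} [Fintype κ] (e : κ → β → ι) (A : κ → Op β) : Op ι :=
  Matrix.of fun x y => ∏ k, A k (fun i => x (e k i)) (fun i => y (e k i))

section Frame

variable {ι κ β : Type} [Fintype ι] [Fintype κ] [Fintype β]
  [DecidableEq ι] [DecidableEq κ] [DecidableEq β] {e : κ → β → ι}

theorem tensorOn_eq_submatrix (he : Function.Bijective fun t : κ × β => e t.1 t.2)
    (A : κ → Op β) :
    tensorOn e A = (ptens A).submatrix (blockEquiv he (Fin 2)) (blockEquiv he (Fin 2)) := rfl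

theorem tensorOn_mul (he : Function.Bijective fun t : κ × β => e t.1 t.2) (A B : κ → Op β) :
    tensorOn e A * tensorOn e B = tensorOn e fun k => A k * B k := by
  rw [tensorOn_eq_submatrix he, tensorOn_eq_submatrix he, Matrix.submatrix_mul_equiv, ptens_mul,
    tensorOn_eq_submatrix he]

theorem conjTranspose_tensorOn (A : κ → Op β) :
    (tensorOn e A)ᴴ = tensorOn e fun k => (A k)ᴴ := by
  ext x y
  simp [tensorOn, Matrix.conjTranspose_apply]

theorem trace_tensorOn (he : Function.Bijective fun t : κ × β => e t.1 t.2) (A : κ → Op β) :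
    (tensorOn e A).trace = ∏ k, (A k).trace := by
  rw [← trace_ptens, tensorOn_eq_submatrix he]
  simp only [Matrix.trace, Matrix.diag, Matrix.submatrix_apply]
  exact (blockEquiv he (Fin 2)).sum_comp fun x => ptens A x x

theorem pauliString_eq_tensorOn (he : Function.Bijective fun t : κ × β => e t.1 t.2)
    (P : ι → Fin 4) : pauliString P = tensorOn e fun k => pauliString fun i => P (e k i) := by
  ext x y
  simp only [pauliString, tensorOn, Matrix.of_apply]
  rw [← (Equiv.ofBijective _ he).prod_comp, Fintype.prod_prod_type]
  rfl

theorem card_eq_of_frame (he : Function.Bijective fun t : κ × β => e t.1 t.2) :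
    Fintype.card ι = Fintype.card κ * Fintype.card β := by
  rw [← Fintype.card_prod, Fintype.card_of_bijective he]

/-- Pauli strings are products over the blocks as well, and traces of tensor products multiply; the
powers of two match since the blocks partition the sites. -/
theorem transfer_tensorOn (he : Function.Bijective fun t : κ × β => e t.1 t.2)
    (U : κ → Op β) (Q P : ι → Fin 4) :
    transfer (tensorOn e U) Q P =
      ∏ k, transfer (U k) (fun i => Q (e k i)) (fun i => P (e k i)) := by
  simp only [transfer]
  rw [Finset.prod_div_distrib, card_eq_of_frame he]
  congr 1
  · have : ((hs (pauliString Q) ((tensorOn e U)ᴴ * pauliString P * tensorOn e U) : ℝ) : ℂ) =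
        ∏ k, ((hs (pauliString fun i => Q (e k i))
          ((U k)ᴴ * (pauliString fun i => P (e k i)) * U k) : ℝ) : ℂ) := by
      rw [ofReal_hs (isHermitian_pauliString Q) (isHermitian_conj (isHermitian_pauliString P) _),
        pauliString_eq_tensorOn he Q, pauliString_eq_tensorOn he P, conjTranspose_tensorOn,
        tensorOn_mul he, tensorOn_mul he, tensorOn_mul he, trace_tensorOn he]
      refine Finset.prod_congr rfl fun k _ => ?_
      rw [ofReal_hs (isHermitian_pauliString _) (isHermitian_conj (isHermitian_pauliString _) _)]
    exact_mod_cast this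
  · rw [Finset.prod_const, Finset.card_univ, ← pow_mul, mul_comm]

theorem onQubits_eq_tensorOn (he : Function.Bijective fun t : κ × β => e t.1 t.2) (k₀ : κ)
    (A : Op β) : onQubits (e k₀) A = tensorOn e (Function.update 1 k₀ A) := by
  ext x y
  simp only [onQubits, tensorOn, Matrix.of_apply]
  rw [← Finset.mul_prod_erase _ _ (Finset.mem_univ k₀), Function.update_self]
  have h1 : ∀ k ∈ Finset.univ.erase k₀, Function.update (1 : κ → Op β) k₀ A k
      (fun i => x (e k i)) (fun i => y (e k i)) =
      if (fun i => x (e k i)) = (fun i => y (e k i)) then 1 else 0 := fun k hk => by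
    rw [Function.update_of_ne (Finset.ne_of_mem_erase hk), Pi.one_apply, Matrix.one_apply]
  rw [Finset.prod_congr rfl h1, Finset.prod_ite_zero, Finset.prod_const_one]
  have h2 : (∀ q, (∀ i, e k₀ i ≠ q) → x q = y q) ↔
      ∀ k ∈ Finset.univ.erase k₀, (fun i => x (e k i)) = (fun i => y (e k i)) := by
    constructor
    · intro h k hk
      funext i
      refine h _ fun j hj => Finset.ne_of_mem_erase hk ?_
      have := he.1 (a₁ := (k₀, j)) (a₂ := (k, i)) hj
      exact (congrArg Prod.fst this).symm
    · intro h q hq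
      obtain ⟨⟨k, i⟩, rfl⟩ := he.2 q
      have hk : k ≠ k₀ := fun hk => hq i (by rw [hk])
      exact congrFun (h k (Finset.mem_erase.mpr ⟨hk, Finset.mem_univ _⟩)) i
  by_cases h : ∀ q, (∀ i, e k₀ i ≠ q) → x q = y q
  · rw [if_pos h, if_pos (h2.mp h), mul_one]
  · rw [if_neg h, if_neg (mt h2.mpr h), mul_zero]

theorem onQubit_eq_ptens (q : ι) (R : Matrix (Fin 2) (Fin 2) ℂ) :
    onQubit q R = ptens (Function.update 1 q R) := by
  ext x y
  simp only [onQubit, onQubits, ptens, Matrix.of_apply]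
  rw [← Finset.mul_prod_erase _ _ (Finset.mem_univ q), Function.update_self]
  have h1 : ∀ k ∈ Finset.univ.erase q, Function.update
      (1 : ι → Matrix (Fin 2) (Fin 2) ℂ) q R k (x k) (y k) = if x k = y k then 1 else 0 :=
    fun k hk => by
      rw [Function.update_of_ne (Finset.ne_of_mem_erase hk), Pi.one_apply, Matrix.one_apply]
  rw [Finset.prod_congr rfl h1, Finset.prod_ite_zero, Finset.prod_const_one]
  simp [eq_comm]

end Frame

/-! ### Independence -/

/-- The product measure splits into the coordinates in `s` and those outside. No integrability
assumption is needed, because `integral_prod_mul` needs none. -/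
theorem integral_mul_of_dependsOn {I : Type} [Fintype I] {E : I → Type}
    [∀ i, MeasurableSpace (E i)] [∀ i, Nonempty (E i)] (μ : ∀ i, Measure (E i))
    [∀ i, IsProbabilityMeasure (μ i)] {s : Set I} {f k : (∀ i, E i) → ℝ}
    (hf : DependsOn f s) (hk : DependsOn k sᶜ) :
    ∫ g, f g * k g ∂(Measure.pi μ) = (∫ g, f g ∂(Measure.pi μ)) * ∫ g, k g ∂(Measure.pi μ) := by
  classical
  -- An arbitrary filling for the coordinates that each function ignores.
  have x₀ : ∀ i, E i := fun i => Classical.choice inferInstance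
  have hmp := measurePreserving_piEquivPiSubtypeProd μ (fun i => i ∈ s)
  set Φ := MeasurableEquiv.piEquivPiSubtypeProd E (fun i => i ∈ s) with hΦ
  let f' : (∀ i : {i // i ∈ s}, E i) → ℝ := fun y =>
    f fun i => if h : i ∈ s then y ⟨i, h⟩ else x₀ i
  let k' : (∀ i : {i // i ∉ s}, E i) → ℝ := fun y =>
    k fun i => if h : i ∈ s then x₀ i else y ⟨i, h⟩
  have hf' : ∀ g, f g = f' (Φ g).1 := fun g => hf fun i hi => by
    simp only [dif_pos hi]
    rfl
  have hk' : ∀ g, k g = k' (Φ g).2 := fun g => hk fun i hi => by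
    have : i ∉ s := hi
    simp only [dif_neg this]
    rfl
  have e1 : ∀ F : _ → ℝ, ∫ g, F (Φ g) ∂(Measure.pi μ) = ∫ y, F y ∂_ := fun F =>
    hmp.integral_comp' F
  simp only [hf', hk']
  rw [e1 (fun y => f' y.1 * k' y.2), e1 (fun y => f' y.1), e1 (fun y => k' y.2),
    integral_prod_mul]
  have e2 := integral_prod_mul (μ := Measure.pi fun i : {i // i ∈ s} => μ i)
    (ν := Measure.pi fun i : {i // i ∉ s} => μ i) f' (fun _ => 1)
  have e3 := integral_prod_mul (μ := Measure.pi fun i : {i // i ∈ s} => μ i)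
    (ν := Measure.pi fun i : {i // i ∉ s} => μ i) (fun _ => 1) k'
  simp only [mul_one, one_mul, integral_const, probReal_univ, smul_eq_mul] at e2 e3
  rw [e2, e3]

/-- Grouping the factors by the coordinate they read turns the integrand into a product over all
coordinates; by injectivity of `φ` each group has at most one factor. -/
theorem integral_prod_eval {I κ : Type} [Fintype I] [DecidableEq I] [Fintype κ] {E : Type}
    [MeasurableSpace E] (μ : I → Measure E) [∀ i, IsProbabilityMeasure (μ i)] {φ : κ → I}
    (hφ : Function.Injective φ) (f : κ → E → ℝ) :
    ∫ g : I → E, ∏ k, f k (g (φ k)) ∂(Measure.pi μ) = ∏ k, ∫ x, f k x ∂(μ (φ k)) := by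
  classical
  have h1 : ∀ g : I → E, ∏ k, f k (g (φ k)) =
      ∏ i, ∏ k ∈ Finset.univ.filter (fun k => φ k = i), f k (g i) := fun g => by
    rw [← Finset.prod_fiberwise (s := Finset.univ) (g := φ)]
    refine Finset.prod_congr rfl fun i _ => Finset.prod_congr rfl fun k hk => ?_
    rw [(Finset.mem_filter.mp hk).2]
  simp only [h1]
  rw [integral_fintype_prod_eq_prod (fun i x => ∏ k ∈ Finset.univ.filter (fun k => φ k = i), f k x),
    ← Finset.prod_fiberwise (s := Finset.univ) (g := φ)]
  refine Finset.prod_congr rfl fun i _ => ?_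
  by_cases h : ∃ k, φ k = i
  · obtain ⟨k, rfl⟩ := h
    have : Finset.univ.filter (fun k' => φ k' = φ k) = {k} := by
      ext k'
      simp [hφ.eq_iff]
    simp [this]
  · have : Finset.univ.filter (fun k' => φ k' = i) = ∅ := by
      ext k'
      simpa using fun hk => h ⟨k', hk⟩
    simp [this]

/-! ### Second moments of the evolved operators -/

theorem bijective_blockQubit (ξ m L : ℕ) [NeZero ξ] [NeZero m] (j : Fin L) :
    Function.Bijective fun t : Fin ξ × Fin m => blockQubit ξ m L j t.1 t.2 := by
  rw [Fintype.bijective_iff_surjective_and_card]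
  refine ⟨fun q => ?_, by simp [ZMod.card]⟩
  set z := (q - (layerShift m L j : ZMod (ξ * m))).val with hz
  have hlt : z < ξ * m := ZMod.val_lt _
  have hm : 0 < m := Nat.pos_of_ne_zero (NeZero.ne m)
  refine ⟨(⟨z / m, Nat.div_lt_of_lt_mul (by rwa [mul_comm] at hlt)⟩, ⟨z % m, Nat.mod_lt _ hm⟩), ?_⟩
  have h1 : ((z : ℕ) : ZMod (ξ * m)) = q - (layerShift m L j : ZMod (ξ * m)) := by
    rw [hz, ZMod.natCast_zmod_val]
  have h2 : z / m * m + layerShift m L j + z % m = z + layerShift m L j := by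
    have := Nat.div_add_mod' z m
    omega
  simp only [blockQubit, h2]
  rw [Nat.cast_add, h1, sub_add_cancel]

namespace Setting

variable {m : ℕ} [NeZero m] (X : Setting m)

instance (b : Option (Fin X.L × Fin X.ξ)) : IsProbabilityMeasure (X.law b) := (X.law_twoDesign b).1

instance : IsProbabilityMeasure X.gatesLaw := by
  unfold gatesLaw
  infer_instance

theorem layerOp_eq_tensorOn (g : X.Gates) (j : Fin X.L) :
    X.layerOp g j = tensorOn (blockQubit X.ξ m X.L j) fun k => (g (some (j, k))).1 := rfl

theorem bijective_blockQubit (j : Fin X.L) :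
    Function.Bijective fun t : Fin X.ξ × Fin m => blockQubit X.ξ m X.L j t.1 t.2 :=
  ALA.bijective_blockQubit X.ξ m X.L j

/-- The part of the circuit that consists of the layers `i, …, j - 1`. -/
noncomputable def run (g : X.Gates) (i j : ℕ) : Op (Qubit X.ξ m) :=
  ((((List.finRange X.L).filter fun t : Fin X.L => i ≤ (t : ℕ) ∧ (t : ℕ) < j).reverse).map (X.layerOp g)).prod

theorem run_self (g : X.Gates) (i : ℕ) : X.run g i i = 1 := by
  have : (List.finRange X.L).filter (fun t : Fin X.L => i ≤ (t : ℕ) ∧ (t : ℕ) < i) = [] := by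
    rw [List.filter_eq_nil_iff]
    intro t _
    simp
  rw [run, this]
  simp

theorem run_succ (g : X.Gates) (i : ℕ) (j : Fin X.L) (hij : i ≤ j) :
    X.run g i (j + 1) = X.layerOp g j * X.run g i j := by
  have : (List.finRange X.L).filter (fun t : Fin X.L => i ≤ (t : ℕ) ∧ (t : ℕ) < j + 1) =
      (List.finRange X.L).filter (fun t : Fin X.L => i ≤ (t : ℕ) ∧ (t : ℕ) < j) ++ [j] := by
    -- Both lists are strictly increasing, so it suffices that they have the same members.
    refine List.Perm.eq_of_pairwise (le := (· < ·)) (fun a b _ _ h1 h2 => absurd h1 h2.asymm)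
      ((List.pairwise_lt_finRange _).filter _) ?_ ?_
    · rw [List.pairwise_append]
      refine ⟨(List.pairwise_lt_finRange _).filter _, List.pairwise_singleton _ _, ?_⟩
      intro a ha b hb
      rw [List.mem_singleton] at hb
      subst hb
      have := (List.mem_filter.mp ha).2
      simp only [decide_eq_true_eq] at this
      exact this.2
    · rw [List.perm_ext_iff_of_nodup ((List.nodup_finRange _).filter _)]
      · intro a
        simp only [List.mem_filter, List.mem_finRange, true_and, decide_eq_true_eq,
          List.mem_append, List.mem_singleton, Fin.ext_iff]
        omega
      · rw [List.nodup_append]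
        refine ⟨(List.nodup_finRange _).filter _, List.nodup_singleton _, ?_⟩
        intro a ha b hb hab
        rw [List.mem_singleton] at hb
        subst hb hab
        have := (List.mem_filter.mp ha).2
        simp at this
  rw [run, this]
  simp [run]

theorem U₁_eq_run (g : X.Gates) : X.U₁ g = X.run g 0 (X.layer + 1) := by
  have : (fun j : Fin X.L => decide (j ≤ X.layer)) =
      fun t : Fin X.L => decide (0 ≤ (t : ℕ) ∧ (t : ℕ) < X.layer + 1) := by
    funext t
    rw [decide_eq_decide, Fin.le_def]
    omega
  rw [U₁, run, this]

theorem U₂_eq_run (g : X.Gates) : X.U₂ g = X.run g (X.layer + 1) X.L *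
    onQubits (blockQubit X.ξ m X.L X.layer X.block) (g none).1 := by
  have : (fun j : Fin X.L => decide (X.layer < j)) =
      fun t : Fin X.L => decide ((X.layer : ℕ) + 1 ≤ (t : ℕ) ∧ (t : ℕ) < X.L) := by
    funext t
    rw [decide_eq_decide, Fin.lt_def]
    omega
  rw [U₂, run, this]

theorem continuous_layerOp (j : Fin X.L) : Continuous fun g : X.Gates => X.layerOp g j := by
  refine continuous_matrix fun x y => ?_
  simp only [layerOp, Matrix.of_apply]
  exact continuous_finsetProd _ fun k _ =>
    (continuous_subtype_val.comp (continuous_apply _)).matrix_elem _ _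

theorem continuous_run (i j : ℕ) : Continuous fun g : X.Gates => X.run g i j := by
  simp only [run]
  generalize ((List.finRange X.L).filter fun t : Fin X.L => i ≤ (t : ℕ) ∧ (t : ℕ) < j).reverse = l
  induction l with
  | nil => simpa using continuous_const
  | cons a l ih =>
    simp only [List.map_cons, List.prod_cons]
    exact (X.continuous_layerOp a).matrix_mul ih

theorem run_congr {g g' : X.Gates} {i j : ℕ}
    (h : ∀ (t : Fin X.L) k, i ≤ (t : ℕ) → (t : ℕ) < j → g (some (t, k)) = g' (some (t, k))) :
    X.run g i j = X.run g' i j := by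
  rw [run, run]
  congr 1
  refine List.map_congr_left fun t ht => ?_
  rw [List.mem_reverse, List.mem_filter] at ht
  have ht2 := ht.2
  simp only [decide_eq_true_eq] at ht2
  ext x y
  simp only [layerOp, Matrix.of_apply, h t _ ht2.1 ht2.2]

/-- The Pauli coefficient of an operator evolved through the layers `i, …, j - 1`. -/
noncomputable def coeff (σ : Op (Qubit X.ξ m)) (i j : ℕ) (P : Qubit X.ξ m → Fin 4)
    (g : X.Gates) : ℝ :=
  hs (pauliString P) (X.run g i j * σ * (X.run g i j)ᴴ)

theorem continuous_hs {n α : Type} [Fintype n] [TopologicalSpace α] {A B : α → Matrix n n ℂ}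
    (hA : Continuous A) (hB : Continuous B) : Continuous fun g => hs (A g) (B g) :=
  Complex.continuous_re.comp (hA.matrix_mul hB).matrix_trace

theorem continuous_coeff (σ : Op (Qubit X.ξ m)) (i j : ℕ) (P : Qubit X.ξ m → Fin 4) :
    Continuous (X.coeff σ i j P) :=
  continuous_hs continuous_const (((X.continuous_run i j).matrix_mul continuous_const).matrix_mul
    (X.continuous_run i j).matrix_conjTranspose)

/-- The second moment of the Pauli transfer matrix of the layer `j`. -/
noncomputable def kernel (j : Fin X.L) (Q P : Qubit X.ξ m → Fin 4) : ℝ :=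
  ∏ k, twirl (fun i => Q (blockQubit X.ξ m X.L j k i)) (fun i => P (blockQubit X.ξ m X.L j k i))

theorem integral_transfer_layerOp (j : Fin X.L) (Q Q' P P' : Qubit X.ξ m → Fin 4) :
    ∫ g, transfer (X.layerOp g j) Q P * transfer (X.layerOp g j) Q' P' ∂X.gatesLaw =
      if P = P' ∧ Q = Q' then X.kernel j Q P else 0 := by
  have hb := X.bijective_blockQubit j
  have heq : ∀ R R' : Qubit X.ξ m → Fin 4, R = R' ↔ ∀ k,
      (fun i => R (blockQubit X.ξ m X.L j k i)) = fun i => R' (blockQubit X.ξ m X.L j k i) := by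
    intro R R'
    rw [← (blockEquiv hb (Fin 4)).apply_eq_iff_eq, funext_iff]
    rfl
  simp only [layerOp_eq_tensorOn, transfer_tensorOn hb, ← Finset.prod_mul_distrib]
  rw [gatesLaw, integral_prod_eval X.law (φ := fun k => some (j, k))
    (fun a b h => by simpa using h) (fun k U => transfer U.1 _ _ * transfer U.1 _ _)]
  simp only [(X.law_twoDesign _).integral_transfer, Finset.prod_ite_zero]
  simp only [heq P P', heq Q Q', ← forall_and, Finset.mem_univ, true_imp_iff]
  rfl

/-- Moving the layer onto `P` and inserting the Pauli basis expresses the new coefficients linearly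
in the old ones. -/
theorem coeff_succ {σ : Op (Qubit X.ξ m)} (hσ : σ.IsHermitian) (i : ℕ) (j : Fin X.L) (hij : i ≤ j)
    (P : Qubit X.ξ m → Fin 4) (g : X.Gates) :
    X.coeff σ i (j + 1) P g = ∑ Q, transfer (X.layerOp g j) Q P * X.coeff σ i j Q g := by
  have h := hs_parseval (isHermitian_conj (isHermitian_pauliString P) (X.layerOp g j))
    (isHermitian_conj' hσ (X.run g i j))
  have h0 : (2 : ℝ) ^ Fintype.card (Qubit X.ξ m) ≠ 0 := by positivity
  rw [coeff, X.run_succ g i j hij, conjTranspose_mul]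
  have e : X.layerOp g j * X.run g i j * σ * ((X.run g i j)ᴴ * (X.layerOp g j)ᴴ) =
      X.layerOp g j * (X.run g i j * σ * (X.run g i j)ᴴ) * (X.layerOp g j)ᴴ := by
    simp only [Matrix.mul_assoc]
  rw [e, hs_comm, ← hs_conj, hs_comm, ← mul_right_inj' h0, ← h, Finset.mul_sum]
  refine Finset.sum_congr rfl fun Q _ => ?_
  rw [transfer, coeff]
  field_simp

/-- The layer is independent of the earlier ones, and its second moments vanish unless both strings
agree on either side. So one random layer destroys all correlations between different coefficients,
and mean squares follow a linear recursion. -/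
theorem integral_coeff_succ {σ : Op (Qubit X.ξ m)} (hσ : σ.IsHermitian) (i : ℕ) (j : Fin X.L)
    (hij : i ≤ j) (P P' : Qubit X.ξ m → Fin 4) :
    ∫ g, X.coeff σ i (j + 1) P g * X.coeff σ i (j + 1) P' g ∂X.gatesLaw =
      if P = P' then ∑ Q, X.kernel j Q P * ∫ g, X.coeff σ i j Q g ^ 2 ∂X.gatesLaw else 0 := by
  have hct : ∀ Q P : Qubit X.ξ m → Fin 4,
      Continuous fun g : X.Gates => transfer (X.layerOp g j) Q P := fun Q P => by
    have hc := X.continuous_layerOp j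
    exact (continuous_hs continuous_const
      ((hc.matrix_conjTranspose.matrix_mul continuous_const).matrix_mul hc)).div_const _
  have h1 : ∀ g, X.coeff σ i (j + 1) P g * X.coeff σ i (j + 1) P' g =
      ∑ Q, ∑ Q', (transfer (X.layerOp g j) Q P * transfer (X.layerOp g j) Q' P') *
        (X.coeff σ i j Q g * X.coeff σ i j Q' g) := fun g => by
    rw [X.coeff_succ hσ i j hij, X.coeff_succ hσ i j hij, Finset.sum_mul_sum]
    refine Finset.sum_congr rfl fun Q _ => Finset.sum_congr rfl fun Q' _ => by ring
  have h2 : ∀ Q Q', ∫ g, (transfer (X.layerOp g j) Q P * transfer (X.layerOp g j) Q' P') *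
        (X.coeff σ i j Q g * X.coeff σ i j Q' g) ∂X.gatesLaw =
      (if P = P' ∧ Q = Q' then X.kernel j Q P else 0) *
        ∫ g, X.coeff σ i j Q g * X.coeff σ i j Q' g ∂X.gatesLaw := fun Q Q' => by
    rw [← X.integral_transfer_layerOp, gatesLaw]
    refine integral_mul_of_dependsOn X.law (s := {b | ∃ k, b = some (j, k)}) ?_ ?_
    · intro g g' h
      have : X.layerOp g j = X.layerOp g' j := by
        ext x y
        simp only [layerOp, Matrix.of_apply]
        refine Finset.prod_congr rfl fun k _ => ?_
        rw [h (some (j, k)) ⟨k, rfl⟩]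
      simp only [this]
    · intro g g' h
      have : X.run g i j = X.run g' i j := X.run_congr fun t k _ htj => h _ (by
        rintro ⟨k', hk⟩
        simp only [Option.some.injEq, Prod.mk.injEq] at hk
        exact absurd htj (by rw [hk.1]; exact lt_irrefl _))
      simp only [coeff, this]
  have hcc : ∀ Q Q', Continuous fun g =>
      (transfer (X.layerOp g j) Q P * transfer (X.layerOp g j) Q' P') *
        (X.coeff σ i j Q g * X.coeff σ i j Q' g) := fun Q Q' =>
    ((hct _ _).mul (hct _ _)).mul ((X.continuous_coeff σ i j Q).mul (X.continuous_coeff σ i j Q'))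
  simp only [h1]
  rw [integral_finsetSum _ fun Q _ =>
    integrable_of_continuous (continuous_finsetSum _ fun Q' _ => hcc Q Q')]
  simp only [integral_finsetSum _ fun Q' _ => integrable_of_continuous (hcc _ Q'), h2]
  by_cases hP : P = P'
  · simp [hP, sq]
  · simp [hP]

/-- The second moment of the Pauli coefficients of the evolved operator. -/
noncomputable def moment (σ : Op (Qubit X.ξ m)) (i j : ℕ) (P : Qubit X.ξ m → Fin 4) : ℝ :=
  ∫ g, X.coeff σ i j P g ^ 2 ∂X.gatesLaw

theorem moment_nonneg (σ : Op (Qubit X.ξ m)) (i j : ℕ) (P : Qubit X.ξ m → Fin 4) :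
    0 ≤ X.moment σ i j P := integral_nonneg fun _ => sq_nonneg _

theorem moment_self (σ : Op (Qubit X.ξ m)) (i : ℕ) (P : Qubit X.ξ m → Fin 4) :
    X.moment σ i i P = hs (pauliString P) σ ^ 2 := by
  simp [moment, coeff, run_self]

theorem moment_succ {σ : Op (Qubit X.ξ m)} (hσ : σ.IsHermitian) (i : ℕ) (j : Fin X.L)
    (hij : i ≤ j) (P : Qubit X.ξ m → Fin 4) :
    X.moment σ i (j + 1) P = ∑ Q, X.kernel j Q P * X.moment σ i j Q := by
  have := X.integral_coeff_succ hσ i j hij P P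
  simp only [if_true, ← sq] at this
  exact this

theorem integral_coeff_of_ne {σ : Op (Qubit X.ξ m)} (hσ : σ.IsHermitian) {i j : ℕ}
    (hij : i < j) (hj : j ≤ X.L) {P P' : Qubit X.ξ m → Fin 4} (hP : P ≠ P') :
    ∫ g, X.coeff σ i j P g * X.coeff σ i j P' g ∂X.gatesLaw = 0 := by
  obtain ⟨j, rfl⟩ : ∃ t, j = t + 1 := ⟨j - 1, by omega⟩
  simpa [hP] using X.integral_coeff_succ hσ i ⟨j, by omega⟩ (by simpa using Nat.lt_succ_iff.mp hij) P P'

end Setting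

/-! ### Propagation of Pauli strings through a layer -/

open Classical in
/-- The total weight of the elements with the property `C`. -/
noncomputable def mass {α : Type} [Fintype α] (C : α → Prop) (e : α → ℝ) : ℝ :=
  ∑ a, if C a then e a else 0

theorem mass_nonneg {α : Type} [Fintype α] {C : α → Prop} {e : α → ℝ} (he : ∀ a, 0 ≤ e a) :
    0 ≤ mass C e :=
  Finset.sum_nonneg fun a _ => by
    split_ifs
    · exact he a
    · exact le_rfl

theorem twirl_comm {κ : Type} [Fintype κ] (Q P : κ → Fin 4) : twirl Q P = twirl P Q := by
  unfold twirl
  split_ifs <;> rfl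

theorem twirl_nonneg {κ : Type} [Fintype κ] (Q P : κ → Fin 4) : 0 ≤ twirl Q P := by
  unfold twirl
  have : (1 : ℝ) ≤ 4 ^ Fintype.card κ := one_le_pow₀ (by norm_num)
  split_ifs
  · exact zero_le_one
  · exact le_rfl
  · exact le_rfl
  · exact inv_nonneg.mpr (by linarith)

theorem twirl_ne_zero {κ : Type} [Fintype κ] {Q P : κ → Fin 4} (h : twirl Q P ≠ 0) :
    Q = 0 ↔ P = 0 := by
  unfold twirl at h
  split_ifs at h <;> simp_all

theorem card_support_subset {κ : Type} [Fintype κ] [DecidableEq κ] (S : Finset κ) :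
    (Finset.univ.filter fun p : κ → Fin 4 => ∀ i, p i ≠ 0 → i ∈ S).card = 4 ^ S.card := by
  have : (Finset.univ.filter fun p : κ → Fin 4 => ∀ i, p i ≠ 0 → i ∈ S) =
      Fintype.piFinset fun i => if i ∈ S then (Finset.univ : Finset (Fin 4)) else {0} := by
    ext p
    simp only [Finset.mem_filter, Finset.mem_univ, true_and, Fintype.mem_piFinset]
    refine forall_congr' fun i => ?_
    by_cases hi : i ∈ S
    · simp [hi]
    · simp [hi]
  rw [this, Fintype.card_piFinset]
  have h2 : ∀ i, (if i ∈ S then (Finset.univ : Finset (Fin 4)) else {0}).card =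
      if i ∈ S then 4 else 1 := fun i => by
    split_ifs <;> simp
  simp [h2, Finset.prod_ite_mem]

open Classical in
-- The probability that a block sends `q` into a part of the block: a whole block is certain, half a
-- block has probability at least `1/(2^m + 1)`, and the identity stays the identity.
theorem sum_twirl_ge {m : ℕ} {h : ℕ} (hm : m = h + h) (q : Fin m → Fin 4) (H : Set (Fin m))
    {S : Finset (Fin m)} (hS : ∀ i ∈ S, i ∈ H) :
    (q ≠ 0 → S.card = m → 1 ≤ ∑ p : Fin m → Fin 4, if ∀ i, p i ≠ 0 → i ∈ H then twirl q p else 0) ∧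
    (q ≠ 0 → S.card = h → ((2 : ℝ) ^ m + 1)⁻¹ ≤
      ∑ p : Fin m → Fin 4, if ∀ i, p i ≠ 0 → i ∈ H then twirl q p else 0) ∧
    (q = 0 → 1 ≤ ∑ p : Fin m → Fin 4, if ∀ i, p i ≠ 0 → i ∈ H then twirl q p else 0) := by
  have hnn : ∀ p : Fin m → Fin 4, 0 ≤ if ∀ i, p i ≠ 0 → i ∈ H then twirl q p else 0 := fun p => by
    split_ifs
    · exact twirl_nonneg _ _
    · exact le_rfl
  -- There are `4^|S| - 1` non-trivial strings on `S`, each of weight `1/(4^m - 1)`.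
  have key : q ≠ 0 → ((4 : ℝ) ^ S.card - 1) * (4 ^ m - 1)⁻¹ ≤
      ∑ p : Fin m → Fin 4, if ∀ i, p i ≠ 0 → i ∈ H then twirl q p else 0 := by
    intro hq
    refine le_trans (le_of_eq ?_) (Finset.sum_le_univ_sum_of_nonneg hnn
      (s := (Finset.univ.filter fun p : Fin m → Fin 4 => ∀ i, p i ≠ 0 → i ∈ S).erase 0))
    have hc : (Finset.univ.filter fun p : Fin m → Fin 4 => ∀ i, p i ≠ 0 → i ∈ S).card =
        4 ^ S.card := by
      convert card_support_subset S
    rw [Finset.sum_congr rfl (g := fun _ => ((4 : ℝ) ^ m - 1)⁻¹), Finset.sum_const,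
      Finset.card_erase_of_mem (by simp), hc, nsmul_eq_mul, Nat.cast_sub (Nat.one_le_pow _ _ (by norm_num))]
    · simp
    · intro p hp
      rw [Finset.mem_erase, Finset.mem_filter] at hp
      rw [if_pos fun i hi => hS i (hp.2.2 i hi)]
      simp [twirl, hq, hp.1]
  have hpos : q ≠ 0 → (0 : ℝ) < 4 ^ m - 1 := by
    intro hq
    have hm : m ≠ 0 := by
      rintro rfl
      exact hq (Subsingleton.elim _ _)
    have : (1 : ℝ) < 4 ^ m := one_lt_pow₀ (by norm_num) hm
    linarith
  refine ⟨fun hq hc => ?_, fun hq hc => ?_, fun hq => ?_⟩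
  · refine le_trans (le_of_eq ?_) (key hq)
    rw [hc, mul_inv_cancel₀ (hpos hq).ne']
  · refine le_trans (le_of_eq ?_) (key hq)
    have e1 : (4 : ℝ) ^ S.card = 2 ^ m := by
      rw [hc, hm, ← two_mul, pow_mul]
      norm_num
    have e2 : (4 : ℝ) ^ m = 2 ^ m * 2 ^ m := by
      rw [← mul_pow]
      norm_num
    have hp := hpos hq
    rw [e2] at hp
    rw [e1, e2]
    have h2 : (0 : ℝ) < 2 ^ m := by positivity
    have h3 : (2 : ℝ) ^ m - 1 ≠ 0 := fun h3 => by
      rw [sub_eq_zero.mp h3] at hp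
      norm_num at hp
    -- For `|S| = m/2` the numerator is `2^m - 1`, which cancels against `4^m - 1`.
    rw [show (2 : ℝ) ^ m * 2 ^ m - 1 = (2 ^ m - 1) * (2 ^ m + 1) by ring, mul_inv,
      mul_inv_cancel_left₀ h3]
  · subst hq
    refine le_trans (le_of_eq ?_) (Finset.single_le_sum (fun p _ => hnn p) (Finset.mem_univ 0))
    simp [twirl]

/-! ### Supports of strings on the ring, described by sites of the line -/

/-- All qubits on which `P` acts non-trivially are among the sites `a, …, b - 1`. -/
def SuppIn {n : ℕ} (P : ZMod n → Fin 4) (a b : ℤ) : Prop :=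
  ∀ q, P q ≠ 0 → ∃ z : ℤ, a ≤ z ∧ z < b ∧ (z : ZMod n) = q

/-- `P` acts non-trivially on some of the sites `a, …, b - 1`. -/
def ActsOn {n : ℕ} (P : ZMod n → Fin 4) (a b : ℤ) : Prop :=
  ∃ z : ℤ, a ≤ z ∧ z < b ∧ P (z : ZMod n) ≠ 0

theorem SuppIn.mono {n : ℕ} {P : ZMod n → Fin 4} {a b a' b' : ℤ} (h : SuppIn P a b)
    (ha : a' ≤ a) (hb : b ≤ b') : SuppIn P a' b' := fun q hq => by
  obtain ⟨z, h1, h2, h3⟩ := h q hq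
  exact ⟨z, ha.trans h1, h2.trans_le hb, h3⟩

theorem ActsOn.ne_zero {n : ℕ} {P : ZMod n → Fin 4} {a b : ℤ} (h : ActsOn P a b) : P ≠ 0 := by
  rintro rfl
  obtain ⟨z, _, _, hz⟩ := h
  exact hz rfl

theorem SuppIn.actsOn {n : ℕ} {P : ZMod n → Fin 4} {a b : ℤ} (h : SuppIn P a b) (hP : P ≠ 0) :
    ActsOn P a b := by
  obtain ⟨q, hq⟩ := Function.ne_iff.mp hP
  obtain ⟨z, h1, h2, h3⟩ := h q hq
  exact ⟨z, h1, h2, by rw [h3]; exact hq⟩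

theorem eq_of_intCast_eq {n : ℕ} {z z' : ℤ} (h : (z : ZMod n) = z') (h1 : z - z' < n)
    (h2 : z' - z < n) : z = z' := by
  rw [ZMod.intCast_eq_intCast_iff_dvd_sub] at h
  have := Int.eq_zero_of_abs_lt_dvd h (by rw [abs_lt]; constructor <;> linarith)
  linarith

/-- An interval that does not wrap around the ring meets the support in sites of the line. -/
theorem SuppIn.actsOn_inter {n : ℕ} {P : ZMod n → Fin 4} {a b c d : ℤ} (h : SuppIn P a b)
    (h' : ActsOn P c d) (h1 : d - a ≤ n) (h2 : b - c ≤ n) :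
    ActsOn P (max a c) (min b d) := by
  obtain ⟨z, hc, hd, hz⟩ := h'
  obtain ⟨z', ha, hb, hzz⟩ := h _ hz
  have : z' = z := eq_of_intCast_eq hzz (by linarith) (by linarith)
  subst this
  exact ⟨z', max_le ha hc, lt_min hb hd, hz⟩

namespace Setting

variable {m : ℕ} [NeZero m] (X : Setting m)

/-- The first site of the block `k` of layer `j` in the unrolled circuit. -/
def blockStart (j : Fin X.L) (k : ℤ) : ℤ := k * m + layerShift m X.L j

theorem exists_blockQubit (j : Fin X.L) (k : ℤ) : ∃ k' : Fin X.ξ, ((k' : ℕ) : ZMod X.ξ) = k ∧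
    ∀ i : Fin m, blockQubit X.ξ m X.L j k' i = ((X.blockStart j k + (i : ℕ) : ℤ) : Qubit X.ξ m) := by
  have hξ : (0 : ℤ) < X.ξ := by exact_mod_cast Nat.pos_of_ne_zero (NeZero.ne X.ξ)
  have h0 := Int.emod_nonneg k hξ.ne'
  have h1 := Int.emod_lt_of_pos k hξ
  have h2 : ((k % X.ξ).toNat : ℤ) = k % X.ξ := Int.toNat_of_nonneg h0
  refine ⟨⟨(k % X.ξ).toNat, by omega⟩, ?_, fun i => ?_⟩
  · have : (((k % X.ξ).toNat : ℤ) : ZMod X.ξ) = k := by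
      rw [h2]
      simp
    exact_mod_cast this
  · have e : blockQubit X.ξ m X.L j ⟨(k % X.ξ).toNat, by omega⟩ i =
        (((k % X.ξ).toNat * m + layerShift m X.L j + (i : ℕ) : ℤ) : Qubit X.ξ m) := by
      simp [blockQubit, -Int.ofNat_toNat]
    rw [e, h2, ZMod.intCast_eq_intCast_iff_dvd_sub]
    refine ⟨k / X.ξ, ?_⟩
    have := Int.emod_add_mul_ediv k X.ξ
    simp only [blockStart]
    push_cast
    linear_combination (-(m : ℤ)) * this

theorem kernel_comm (j : Fin X.L) (Q P : Qubit X.ξ m → Fin 4) : X.kernel j Q P = X.kernel j P Q :=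
  Finset.prod_congr rfl fun _ _ => twirl_comm _ _

theorem kernel_nonneg (j : Fin X.L) (Q P : Qubit X.ξ m → Fin 4) : 0 ≤ X.kernel j Q P :=
  Finset.prod_nonneg fun _ _ => twirl_nonneg _ _

/-- No block turns a non-trivial restriction into the identity, so activity on a block survives its
layer. -/
theorem actsOn_of_kernel_ne_zero {j : Fin X.L} {Q P : Qubit X.ξ m → Fin 4}
    (h : X.kernel j Q P ≠ 0) {k : ℤ}
    (hQ : ActsOn Q (X.blockStart j k) (X.blockStart j k + m)) :
    ActsOn P (X.blockStart j k) (X.blockStart j k + m) := by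
  obtain ⟨k', -, hk'⟩ := X.exists_blockQubit j k
  obtain ⟨z, h1, h2, h3⟩ := hQ
  have ht := twirl_ne_zero (Finset.prod_ne_zero_iff.mp h k' (Finset.mem_univ _))
  have hne : ¬ (fun i => Q (blockQubit X.ξ m X.L j k' i)) = 0 := by
    intro h0
    have := congrFun h0 ⟨(z - X.blockStart j k).toNat, by omega⟩
    simp only [hk', Pi.zero_apply] at this
    rw [Int.toNat_of_nonneg (by omega), add_sub_cancel] at this
    exact h3 this
  rw [ht] at hne
  obtain ⟨i, hi⟩ := Function.ne_iff.mp hne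
  refine ⟨X.blockStart j k + (i : ℕ), by omega, by omega, ?_⟩
  rw [← hk']
  exact hi

open Classical in
/-- The probability that a Pauli string is mapped by a random layer into the set `H`, if `H`
contains all blocks on which the string acts, or at least half of them for those in `B`. -/
theorem sum_kernel_ge {h : ℕ} (hm : m = h + h) (j : Fin X.L) (Q : Qubit X.ξ m → Fin 4)
    (H : Set (Qubit X.ξ m)) (B : Finset (Fin X.ξ))
    (hfull : ∀ k ∉ B, (∃ i, Q (blockQubit X.ξ m X.L j k i) ≠ 0) →
      ∀ i, blockQubit X.ξ m X.L j k i ∈ H)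
    (hhalf : ∀ k ∈ B, ∃ S : Finset (Fin m), S.card = h ∧
      ∀ i ∈ S, blockQubit X.ξ m X.L j k i ∈ H) :
    (((2 : ℝ) ^ m + 1) ^ B.card)⁻¹ ≤
      mass (fun P => ∀ q, P q ≠ 0 → q ∈ H) (X.kernel j Q) := by
  have hb := X.bijective_blockQubit j
  set bq := blockQubit X.ξ m X.L j with hbq
  -- Both the support condition and the kernel factor over the blocks, so the sum over strings
  -- becomes a product of one sum per block.
  have e : ∀ P : Qubit X.ξ m → Fin 4, (if ∀ q, P q ≠ 0 → q ∈ H then X.kernel j Q P else 0) =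
      ∏ k, if ∀ i, blockEquiv hb (Fin 4) P k i ≠ 0 → i ∈ {i | bq k i ∈ H} then
        twirl (fun i => Q (bq k i)) (blockEquiv hb (Fin 4) P k) else 0 := by
    intro P
    rw [Finset.prod_ite_zero]
    have : (∀ q, P q ≠ 0 → q ∈ H) ↔ ∀ k ∈ Finset.univ, ∀ i,
        blockEquiv hb (Fin 4) P k i ≠ 0 → i ∈ {i | bq k i ∈ H} := by
      rw [hb.2.forall, Prod.forall]
      simp [blockEquiv_apply, hbq]
    split_ifs with h1 h2 h2
    · rfl
    · exact absurd (this.mp h1) h2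
    · exact absurd (this.mpr h2) h1
    · rfl
  have e0 : mass (fun P => ∀ q, P q ≠ 0 → q ∈ H) (X.kernel j Q) =
      ∑ P, if ∀ q, P q ≠ 0 → q ∈ H then X.kernel j Q P else 0 :=
    Finset.sum_congr rfl fun P _ => by split_ifs <;> rfl
  rw [e0, Finset.sum_congr rfl fun P _ => e P, (blockEquiv hb (Fin 4)).sum_comp (fun p =>
    ∏ k, if ∀ i, p k i ≠ 0 → i ∈ {i | bq k i ∈ H} then twirl (fun i => Q (bq k i)) (p k) else 0)]
  have h2 := Finset.prod_univ_sum (fun _ : Fin X.ξ => (Finset.univ : Finset (Fin m → Fin 4)))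
    (fun k p => if ∀ i, p i ≠ 0 → i ∈ {i | bq k i ∈ H} then twirl (fun i => Q (bq k i)) p else 0)
  rw [Fintype.piFinset_univ] at h2
  rw [← h2]
  have h3 : (((2 : ℝ) ^ m + 1) ^ B.card)⁻¹ = ∏ k, if k ∈ B then ((2 : ℝ) ^ m + 1)⁻¹ else 1 := by
    simp [Finset.prod_ite_mem]
  rw [h3]
  refine Finset.prod_le_prod (fun k _ => by split_ifs <;> positivity) fun k _ => ?_
  by_cases hk : k ∈ B
  · obtain ⟨S, hS, hSH⟩ := hhalf k hk
    have := sum_twirl_ge hm (fun i => Q (bq k i)) {i | bq k i ∈ H} hSH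
    rw [if_pos hk]
    by_cases hq : (fun i => Q (bq k i)) = 0
    · refine le_trans ?_ (this.2.2 hq)
      exact inv_le_one_of_one_le₀ (by linarith [show (0 : ℝ) < 2 ^ m by positivity])
    · exact this.2.1 hq hS
  · rw [if_neg hk]
    by_cases hq : (fun i => Q (bq k i)) = 0
    · exact (sum_twirl_ge hm (fun i => Q (bq k i)) {i | bq k i ∈ H} (S := ∅) (by simp)).2.2 hq
    · have := hfull k hk (Function.ne_iff.mp hq)
      exact (sum_twirl_ge hm (fun i => Q (bq k i)) {i | bq k i ∈ H} (S := Finset.univ)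
        fun i _ => this i).1 hq (by simp)

end Setting

/-! ### Transport of weight between windows of consecutive blocks -/

namespace Setting

variable {m : ℕ} [NeZero m] (X : Setting m)

theorem SuppIn.exists_block {j : Fin X.L} {k : ℤ} {w : ℕ} {Q : Qubit X.ξ m → Fin 4}
    (hQ : SuppIn Q (X.blockStart j k) (X.blockStart j k + w * m)) {k' : Fin X.ξ} {i : Fin m}
    (hi : Q (blockQubit X.ξ m X.L j k' i) ≠ 0) :
    ∃ t : ℤ, k ≤ t ∧ t < k + w ∧ ∀ i : Fin m,
      blockQubit X.ξ m X.L j k' i = ((X.blockStart j t + (i : ℕ) : ℤ) : Qubit X.ξ m) := by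
  have hm : (0 : ℤ) < m := by exact_mod_cast Nat.pos_of_ne_zero (NeZero.ne m)
  obtain ⟨z, h1, h2, h3⟩ := hQ _ hi
  set t := (z - layerShift m X.L j) / (m : ℤ) with ht
  have hd := Int.emod_add_mul_ediv (z - layerShift m X.L j) m
  have hr0 := Int.emod_nonneg (z - layerShift m X.L j) hm.ne'
  have hr1 := Int.emod_lt_of_pos (z - layerShift m X.L j) hm
  rw [← ht] at hd
  set r := (z - layerShift m X.L j) % (m : ℤ) with hr
  simp only [blockStart] at h1 h2
  refine ⟨t, ?_, ?_, ?_⟩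
  · by_contra hcon
    nlinarith
  · by_contra hcon
    nlinarith
  · obtain ⟨k'', -, hk''⟩ := X.exists_blockQubit j t
    have : blockQubit X.ξ m X.L j k'' ⟨r.toNat, by omega⟩ = blockQubit X.ξ m X.L j k' i := by
      rw [hk'', ← h3]
      congr 1
      simp only [blockStart]
      rw [Int.toNat_of_nonneg hr0]
      linear_combination hd
    have hkk := (X.bijective_blockQubit j).1 (a₁ := (k'', _)) (a₂ := (k', i)) this
    have hk : k'' = k' := congrArg Prod.fst hkk
    exact hk ▸ hk''

/-- A random layer maps a string supported on `w` consecutive blocks into `a, …, b - 1`. -/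
theorem sum_kernel_ge_of_suppIn {h : ℕ} (hm : m = h + h) (j : Fin X.L) {k : ℤ} {w : ℕ}
    {Q : Qubit X.ξ m → Fin 4} (hQ : SuppIn Q (X.blockStart j k) (X.blockStart j k + w * m))
    {a b : ℤ} (T : Finset ℤ)
    (hT : ∀ t ∈ T, (a ≤ X.blockStart j t ∧ X.blockStart j t + h ≤ b) ∨
      (a ≤ X.blockStart j t + h ∧ X.blockStart j t + m ≤ b))
    (hfull : ∀ t : ℤ, k ≤ t → t < k + w → t ∉ T →
      a ≤ X.blockStart j t ∧ X.blockStart j t + m ≤ b) :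
    (((2 : ℝ) ^ m + 1) ^ T.card)⁻¹ ≤
      mass (fun P => SuppIn P a b) (X.kernel j Q) := by
  choose κ hκ' hκ using X.exists_blockQubit j
  have h1 := X.sum_kernel_ge hm j Q {q | ∃ z : ℤ, a ≤ z ∧ z < b ∧ (z : Qubit X.ξ m) = q}
    (T.image κ) ?_ ?_
  -- Positions in `T` may coincide on the ring; the image is then smaller and the bound only
  -- improves.
  · refine le_trans ?_ h1
    gcongr
    · linarith [show (0 : ℝ) < 2 ^ m by positivity]
    · exact Finset.card_image_le
  · rintro k' hk' ⟨i, hi⟩ i'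
    obtain ⟨t, ht1, ht2, ht⟩ := SuppIn.exists_block X hQ hi
    have htT : t ∉ T := by
      intro htT
      refine hk' (Finset.mem_image.mpr ⟨t, htT, ?_⟩)
      have := (X.bijective_blockQubit j).1 (a₁ := (κ t, i)) (a₂ := (k', i))
        ((hκ t i).trans (ht i).symm)
      exact congrArg Prod.fst this
    obtain ⟨h2, h3⟩ := hfull t ht1 ht2 htT
    exact ⟨X.blockStart j t + (i' : ℕ), by omega, by omega, (ht i').symm⟩
  · intro k' hk'
    obtain ⟨t, ht, rfl⟩ := Finset.mem_image.mp hk'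
    rcases hT t ht with ⟨h2, h3⟩ | ⟨h2, h3⟩
    · refine ⟨Finset.univ.map (Fin.castLEEmb (n := h) (m := m) (by omega)), by simp, ?_⟩
      intro i hi
      obtain ⟨i', -, rfl⟩ := Finset.mem_map.mp hi
      refine ⟨X.blockStart j t + (i' : ℕ), by omega, by omega, ?_⟩
      rw [hκ]
      rfl
    · refine ⟨Finset.univ.map ((Fin.natAddEmb h).trans
        (Fin.castLEEmb (n := h + h) (m := m) (by omega))), by simp, ?_⟩
      intro i hi
      obtain ⟨i', -, rfl⟩ := Finset.mem_map.mp hi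
      refine ⟨X.blockStart j t + ((h + i' : ℕ) : ℤ), by omega, by omega, ?_⟩
      rw [hκ]
      rfl

/-- Transport of the weight of a class of strings through a random layer. -/
theorem sum_class_ge (j : Fin X.L) {e e' : (Qubit X.ξ m → Fin 4) → ℝ} (he : ∀ Q, 0 ≤ e Q)
    (he' : ∀ P, e' P = ∑ Q, X.kernel j Q P * e Q) {C C' : (Qubit X.ξ m → Fin 4) → Prop}
    {a b : ℤ} {c : ℝ}
    (hc : ∀ Q, C' Q → c ≤ mass (fun P => SuppIn P a b) (X.kernel j Q))
    (hC : ∀ Q P, C' Q → SuppIn P a b → X.kernel j Q P ≠ 0 → C P) :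
    c * mass C' e ≤ mass C e' := by
  -- Exchanging the sums: each old string contributes its weight times its probability of landing in
  -- `C`.
  have h1 : mass C e' = ∑ Q, e Q * mass C (X.kernel j Q) := by
    simp only [mass, he', Finset.mul_sum]
    rw [Finset.sum_comm]
    refine Finset.sum_congr rfl fun P _ => ?_
    split_ifs
    · exact Finset.sum_congr rfl fun Q _ => mul_comm _ _
    · simp
  rw [h1, mass, Finset.mul_sum]
  refine Finset.sum_le_sum fun Q _ => ?_
  split_ifs with hQ
  · rw [mul_comm]
    refine mul_le_mul_of_nonneg_left ((hc Q hQ).trans (Finset.sum_le_sum fun P _ => ?_)) (he Q)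
    by_cases hP : SuppIn P a b
    · rw [if_pos hP]
      by_cases hk : X.kernel j Q P = 0
      · rw [hk]
        split_ifs <;> exact le_rfl
      · rw [if_pos (hC Q P hQ hP hk)]
    · rw [if_neg hP]
      split_ifs
      · exact X.kernel_nonneg _ _ _
      · exact le_rfl
  · rw [mul_zero]
    exact mul_nonneg (he Q) (mass_nonneg (X.kernel_nonneg _ _))

/-- Strings on the `w` consecutive blocks from `u` on that act on the first and the last one. -/
def Spans (u : ℤ) (w : ℕ) (P : Qubit X.ξ m → Fin 4) : Prop :=
  SuppIn P u (u + w * m) ∧ ActsOn P u (u + m) ∧ ActsOn P (u + w * m - m) (u + w * m)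

/-- The weight of the strings that span the `w` consecutive blocks from `u` on. -/
noncomputable def spanWeight (e : (Qubit X.ξ m → Fin 4) → ℝ) (u : ℤ) (w : ℕ) : ℝ :=
  mass (X.Spans u w) e

/-- The weight of the non-trivial strings on the `w` consecutive blocks from `u` on. -/
noncomputable def suppWeight (e : (Qubit X.ξ m → Fin 4) → ℝ) (u : ℤ) (w : ℕ) : ℝ :=
  mass (fun P => SuppIn P u (u + w * m) ∧ P ≠ 0) e

theorem suppWeight_nonneg {e : (Qubit X.ξ m → Fin 4) → ℝ} (he : ∀ Q, 0 ≤ e Q) (u : ℤ) (w : ℕ) :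
    0 ≤ X.suppWeight e u w := mass_nonneg he

theorem SuppIn.right_of_not_actsOn {n : ℕ} {P : ZMod n → Fin 4} {a b c : ℤ}
    (h : SuppIn P a b) (hn : ¬ ActsOn P a c) : SuppIn P c b := fun q hq => by
  obtain ⟨z, h1, h2, h3⟩ := h q hq
  refine ⟨z, ?_, h2, h3⟩
  by_contra hcon
  exact hn ⟨z, h1, not_le.mp hcon, by rwa [h3]⟩

theorem SuppIn.left_of_not_actsOn {n : ℕ} {P : ZMod n → Fin 4} {a b c : ℤ}
    (h : SuppIn P a b) (hn : ¬ ActsOn P c b) : SuppIn P a c := fun q hq => by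
  obtain ⟨z, h1, h2, h3⟩ := h q hq
  refine ⟨z, h1, ?_, h3⟩
  by_contra hcon
  exact hn ⟨z, not_lt.mp hcon, h2, by rwa [h3]⟩

/-- A string in the window either acts on both end blocks, or misses one of them and fits into a
window shorter by one block. -/
theorem suppWeight_succ_le {e : (Qubit X.ξ m → Fin 4) → ℝ} (he : ∀ Q, 0 ≤ e Q) (u : ℤ) (w : ℕ) :
    X.suppWeight e u (w + 1) ≤
      X.spanWeight e u (w + 1) + (X.suppWeight e u w + X.suppWeight e (u + m) w) := by
  unfold suppWeight spanWeight mass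
  rw [← Finset.sum_add_distrib, ← Finset.sum_add_distrib]
  refine Finset.sum_le_sum fun P _ => ?_
  have h0 := he P
  have e1 : u + ((w + 1 : ℕ) : ℤ) * m - m = u + w * m := by
    push_cast
    ring
  have e2 : u + (m : ℤ) + w * m = u + ((w + 1 : ℕ) : ℤ) * m := by
    push_cast
    ring
  by_cases hP : SuppIn P u (u + ((w + 1 : ℕ) : ℤ) * m) ∧ P ≠ 0
  · by_cases h1 : ActsOn P u (u + m)
    · by_cases h2 : ActsOn P (u + ((w + 1 : ℕ) : ℤ) * m - m) (u + ((w + 1 : ℕ) : ℤ) * m)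
      · rw [if_pos hP, if_pos (show X.Spans u (w + 1) P from ⟨hP.1, h1, h2⟩)]
        split_ifs <;> linarith
      · have h3 := SuppIn.left_of_not_actsOn hP.1 h2
        rw [e1] at h3
        rw [if_pos hP, if_pos (show SuppIn P u (u + w * m) ∧ P ≠ 0 from ⟨h3, hP.2⟩)]
        split_ifs <;> linarith
    · have h3 := SuppIn.right_of_not_actsOn hP.1 h1
      rw [← e2] at h3
      rw [if_pos hP, if_pos (show SuppIn P (u + m) (u + m + w * m) ∧ P ≠ 0 from ⟨h3, hP.2⟩)]
      split_ifs <;> linarith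
  · rw [if_neg hP]
    split_ifs <;> linarith

section Steps

variable {h : ℕ} (hm : m = h + h) (j : Fin X.L) {e e' : (Qubit X.ξ m → Fin 4) → ℝ}
  (he : ∀ Q, 0 ≤ e Q) (he' : ∀ P, e' P = ∑ Q, X.kernel j Q P * e Q)

include hm he he'

/-- The lower window overhangs by half a block on each side. Sending each end block into its inner
half costs two factors; inner blocks cost nothing. An end block stays non-trivial and is confined to
its inner half, so the string still acts on the end block of the shorter window. The bound on `w`
keeps the lower window from wrapping around the ring. -/
theorem spanWeight_step {u k : ℤ} (hu : u - h = X.blockStart j k) {w : ℕ} (hw : 1 ≤ w)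
    (hξ : w + 1 ≤ X.ξ) :
    (((2 : ℝ) ^ m + 1) ^ 2)⁻¹ * X.spanWeight e (u - h) (w + 1) ≤ X.spanWeight e' u w := by
  have hm0 : 0 < m := Nat.pos_of_ne_zero (NeZero.ne m)
  have hmz : (m : ℤ) = h + h := by exact_mod_cast hm
  have hn : (((w + 1) * m : ℕ) : ℤ) ≤ ((X.ξ * m : ℕ) : ℤ) := by
    exact_mod_cast Nat.mul_le_mul_right m hξ
  have hwm : (1 : ℤ) * m ≤ w * m := by
    have : (1 : ℤ) ≤ w := by exact_mod_cast hw
    gcongr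
  push_cast at hn
  unfold spanWeight
  refine X.sum_class_ge j he he' (a := u) (b := u + w * m) ?_ ?_
  · intro Q hQ
    -- The two end blocks; they are different because `1 ≤ w`.
    have hcard : ({k, k + w} : Finset ℤ).card = 2 := by
      rw [Finset.card_pair]
      omega
    rw [← hcard]
    refine X.sum_kernel_ge_of_suppIn hm j (hu ▸ hQ.1) _ ?_ ?_
    · intro t ht
      rw [Finset.mem_insert, Finset.mem_singleton] at ht
      rcases ht with rfl | rfl
      · right
        rw [← hu]
        constructor <;> linarith
      · left
        have : X.blockStart j (k + w) = X.blockStart j k + w * m := by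
          simp only [blockStart]
          ring
        rw [this, ← hu]
        constructor <;> linarith
    · intro t h1 h2 h3
      simp only [Finset.mem_insert, Finset.mem_singleton, not_or] at h3
      have : X.blockStart j t = X.blockStart j k + (t - k) * m := by
        simp only [blockStart]
        ring
      push_cast at h2
      have h4 : 1 ≤ t - k := by omega
      have h5 : t - k + 1 ≤ w := by omega
      rw [this, ← hu]
      constructor <;> nlinarith
  · intro Q P hQ hP hk
    obtain ⟨-, hQ1, hQ2⟩ := hQ
    have h1 : ActsOn P (u - h) (u - h + m) := by
      rw [hu] at hQ1 ⊢
      exact X.actsOn_of_kernel_ne_zero hk hQ1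
    have e2 : u - h + ((w + 1 : ℕ) : ℤ) * m - m = X.blockStart j (k + w) := by
      simp only [blockStart] at hu ⊢
      push_cast
      linear_combination hu
    have h2 : ActsOn P (u - h + w * m) (u - h + w * m + m) := by
      have e3 : u - h + ((w + 1 : ℕ) : ℤ) * m = X.blockStart j (k + w) + m := by
        rw [← e2]
        ring
      rw [e2, e3] at hQ2
      have e4 : u - h + w * m = X.blockStart j (k + w) := by
        rw [← e2]
        push_cast
        ring
      rw [e4]
      exact X.actsOn_of_kernel_ne_zero hk hQ2
    refine ⟨hP, ?_, ?_⟩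
    -- The support lies in the window and meets the first lower block, hence meets their overlap, a
    -- half block of the window.
    · have := hP.actsOn_inter h1 (by push_cast; linarith) (by push_cast; linarith)
      obtain ⟨z, hz1, hz2, hz3⟩ := this
      exact ⟨z, (le_max_left _ _).trans hz1, by linarith [min_le_right (u + w * m) (u - h + m)], hz3⟩
    · have := hP.actsOn_inter h2 (by push_cast; linarith) (by push_cast; linarith)
      obtain ⟨z, hz1, hz2, hz3⟩ := this
      exact ⟨z, by linarith [le_max_right u (u - h + w * m)], hz2.trans_le (min_le_left _ _), hz3⟩

theorem half_step {v k : ℤ} (hv : v = X.blockStart j k) {a : ℤ}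
    (ha : a = v ∨ a = v + h) :
    ((2 : ℝ) ^ m + 1)⁻¹ * X.suppWeight e v 1 ≤
      mass (fun P => SuppIn P a (a + h) ∧ P ≠ 0) e' := by
  have hmz : (m : ℤ) = h + h := by exact_mod_cast hm
  unfold suppWeight
  refine X.sum_class_ge j he he' (a := a) (b := a + h) ?_ ?_
  · intro Q hQ
    have := X.sum_kernel_ge_of_suppIn hm j (hv ▸ hQ.1) {k} (a := a) (b := a + h) ?_ ?_
    · simpa using this
    · intro t ht
      rw [Finset.mem_singleton] at ht
      subst ht
      rw [← hv]
      rcases ha with rfl | rfl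
      · left
        simp
      · right
        constructor <;> linarith
    · intro t h1 h2 h3
      rw [Finset.mem_singleton] at h3
      push_cast at h2
      omega
  · intro Q P hQ hP hk
    refine ⟨hP, ?_⟩
    have h1 := hQ.1.actsOn hQ.2
    rw [Nat.cast_one, one_mul, hv] at h1
    exact (X.actsOn_of_kernel_ne_zero hk h1).ne_zero

/-- A refinement of the one-block case of `spanWeight_step`: activity is recorded on both halves, so
that these strings are disjoint from those confined to one half. -/
theorem pair_step {u k : ℤ} (hu : u - h = X.blockStart j k) (hξ : 2 ≤ X.ξ) :
    (((2 : ℝ) ^ m + 1) ^ 2)⁻¹ * X.spanWeight e (u - h) 2 ≤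
      mass (fun P => SuppIn P u (u + m) ∧ ActsOn P u (u + h) ∧ ActsOn P (u + h) (u + m)) e' := by
  have hmz : (m : ℤ) = h + h := by exact_mod_cast hm
  have hn : ((2 * m : ℕ) : ℤ) ≤ ((X.ξ * m : ℕ) : ℤ) := by
    exact_mod_cast Nat.mul_le_mul_right m hξ
  push_cast at hn
  have e1 : X.blockStart j (k + 1) = u + h := by
    simp only [blockStart] at hu ⊢
    linear_combination -hu + hmz
  unfold spanWeight
  refine X.sum_class_ge j he he' (a := u) (b := u + m) ?_ ?_
  · intro Q hQ
    have hcard : ({k, k + 1} : Finset ℤ).card = 2 := by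
      rw [Finset.card_pair]
      omega
    rw [← hcard]
    refine X.sum_kernel_ge_of_suppIn hm j (hu ▸ hQ.1) _ ?_ ?_
    · intro t ht
      rw [Finset.mem_insert, Finset.mem_singleton] at ht
      rcases ht with rfl | rfl
      · right
        rw [← hu]
        constructor <;> linarith
      · left
        rw [e1]
        constructor <;> linarith
    · intro t h1 h2 h3
      simp only [Finset.mem_insert, Finset.mem_singleton, not_or] at h3
      push_cast at h2
      omega
  · intro Q P hQ hP hk
    obtain ⟨-, hQ1, hQ2⟩ := hQ
    have h1 : ActsOn P (u - h) (u - h + m) := by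
      rw [hu] at hQ1 ⊢
      exact X.actsOn_of_kernel_ne_zero hk hQ1
    have h2 : ActsOn P (u + h) (u + h + m) := by
      have e2 : u - h + ((2 : ℕ) : ℤ) * m - m = X.blockStart j (k + 1) := by
        rw [e1]
        push_cast
        linarith
      have e3 : u - h + ((2 : ℕ) : ℤ) * m = X.blockStart j (k + 1) + m := by
        rw [← e2]
        ring
      rw [e2, e3] at hQ2
      rw [← e1]
      exact X.actsOn_of_kernel_ne_zero hk hQ2
    refine ⟨hP, ?_, ?_⟩
    · have := hP.actsOn_inter h1 (by push_cast; linarith) (by push_cast; linarith)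
      obtain ⟨z, hz1, hz2, hz3⟩ := this
      exact ⟨z, (le_max_left _ _).trans hz1, by linarith [min_le_right (u + m) (u - h + m)], hz3⟩
    · have := hP.actsOn_inter h2 (by push_cast; linarith) (by push_cast; linarith)
      obtain ⟨z, hz1, hz2, hz3⟩ := this
      exact ⟨z, by linarith [le_max_right u (u + h)], hz2.trans_le (min_le_left _ _), hz3⟩

/-- Strings on the left lower block can land in the left half, those on the right one in the right
half, and those spanning both can act on both halves. The three outcomes exclude each other, so the
bounds add. For `ξ = 1` the two lower blocks coincide on the ring and the third source is dropped.
-/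
theorem suppWeight_step {u k k' : ℤ} (hu : u - h = X.blockStart j k)
    (hu' : u + h = X.blockStart j k') :
    ((2 : ℝ) ^ m + 1)⁻¹ * (X.suppWeight e (u - h) 1 + X.suppWeight e (u + h) 1) +
      (if 2 ≤ X.ξ then (((2 : ℝ) ^ m + 1) ^ 2)⁻¹ * X.spanWeight e (u - h) 2 else 0) ≤
      X.suppWeight e' u 1 := by
  have hmz : (m : ℤ) = h + h := by exact_mod_cast hm
  have hn : ((1 * m : ℕ) : ℤ) ≤ ((X.ξ * m : ℕ) : ℤ) := by
    exact_mod_cast Nat.mul_le_mul_right m (Nat.pos_of_ne_zero (NeZero.ne X.ξ))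
  have hm0 : (0 : ℤ) < m := by exact_mod_cast Nat.pos_of_ne_zero (NeZero.ne m)
  push_cast at hn
  have he0' : ∀ P, 0 ≤ e' P := fun P => by
    rw [he']
    exact Finset.sum_nonneg fun Q _ => mul_nonneg (X.kernel_nonneg _ _ _) (he Q)
  have h1 := X.half_step hm j he he' hu (a := u) (Or.inr (by ring))
  have h2 := X.half_step hm j he he' hu' (a := u + h) (Or.inl rfl)
  have h3 : (if 2 ≤ X.ξ then (((2 : ℝ) ^ m + 1) ^ 2)⁻¹ * X.spanWeight e (u - h) 2 else 0) ≤
      mass (fun P => SuppIn P u (u + m) ∧ ActsOn P u (u + h) ∧ ActsOn P (u + h) (u + m)) e' := by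
    split_ifs with hξ
    · exact X.pair_step hm j he he' hu hξ
    · exact mass_nonneg he0'
  rw [mul_add]
  refine (add_le_add (add_le_add h1 h2) h3).trans ?_
  unfold suppWeight mass
  rw [← Finset.sum_add_distrib, ← Finset.sum_add_distrib]
  refine Finset.sum_le_sum fun P _ => ?_
  -- The two half blocks are disjoint also on the ring, since its length is at least `m`.
  have hdisj : ∀ P : Qubit X.ξ m → Fin 4, SuppIn P u (u + h) → ¬ ActsOn P (u + h) (u + m) := by
    intro P hP hA
    obtain ⟨z, hz1, hz2, -⟩ := hP.actsOn_inter hA (by push_cast; linarith) (by push_cast; linarith)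
    have h4 := le_max_right u (u + h)
    have h5 := min_le_left (u + (h : ℤ)) (u + m)
    linarith
  have e1 : u + h + (h : ℤ) = u + m := by linarith
  have e2 : u + ((1 : ℕ) : ℤ) * m = u + m := by simp
  rw [e1, e2]
  by_cases hL : SuppIn P u (u + h) ∧ P ≠ 0
  · have hR : ¬ (SuppIn P (u + h) (u + m) ∧ P ≠ 0) := fun hR => hdisj P hL.1 (hR.1.actsOn hR.2)
    have hB : ¬ (SuppIn P u (u + m) ∧ ActsOn P u (u + h) ∧ ActsOn P (u + h) (u + m)) :=
      fun hB => hdisj P hL.1 hB.2.2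
    rw [if_pos hL, if_neg hR, if_neg hB, if_pos ⟨hL.1.mono le_rfl (by linarith), hL.2⟩]
    simp
  · by_cases hR : SuppIn P (u + h) (u + m) ∧ P ≠ 0
    · have hB : ¬ (SuppIn P u (u + m) ∧ ActsOn P u (u + h) ∧ ActsOn P (u + h) (u + m)) := by
        intro hB
        obtain ⟨z, hz1, hz2, -⟩ := hR.1.actsOn_inter hB.2.1 (by push_cast; linarith)
          (by push_cast; linarith)
        have h4 := le_max_left (u + (h : ℤ)) u
        have h5 := min_le_right (u + (m : ℤ)) (u + h)
        linarith
      rw [if_neg hL, if_pos hR, if_neg hB, if_pos ⟨hR.1.mono (by linarith) le_rfl, hR.2⟩]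
      simp
    · rw [if_neg hL, if_neg hR, zero_add, zero_add]
      by_cases hB : SuppIn P u (u + m) ∧ ActsOn P u (u + h) ∧ ActsOn P (u + h) (u + m)
      · rw [if_pos hB, if_pos ⟨hB.1, hB.2.1.ne_zero⟩]
      · rw [if_neg hB]
        split_ifs
        · exact he0' P
        · exact le_rfl

end Steps

end Setting

namespace Setting

variable {m : ℕ} [NeZero m] (X : Setting m)

/-- Adjacent layers differ by half a block, so every block sits symmetrically over two neighbours of
the layer before. If the upper layer is unshifted, the left neighbour has index `k - 1`; otherwise
it has index `k`. -/
theorem exists_blockStart_pred {h : ℕ} (hm : m = h + h) {j : ℕ} (hj : j + 1 < X.L) (k : ℤ) :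
    ∃ k' : ℤ, X.blockStart ⟨j + 1, hj⟩ k - h = X.blockStart ⟨j, by omega⟩ k' ∧
      X.blockStart ⟨j + 1, hj⟩ k + h = X.blockStart ⟨j, by omega⟩ (k' + 1) := by
  have hmz : (m : ℤ) = h + h := by exact_mod_cast hm
  have h2 : m / 2 = h := by omega
  have h3 : X.L - 1 - j = X.L - 1 - (j + 1) + 1 := by omega
  by_cases hE : Even (X.L - 1 - (j + 1))
  · have hO : ¬ Even (X.L - 1 - j) := by
      rw [h3, Nat.even_add_one]
      exact not_not.mpr hE
    refine ⟨k - 1, ?_, ?_⟩ <;> simp only [blockStart, layerShift, hE, hO, if_true, if_false, h2]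
    · push_cast
      linear_combination hmz
    · push_cast
      ring
  · have hO : Even (X.L - 1 - j) := by
      rw [h3, Nat.even_add_one]
      exact hE
    refine ⟨k, ?_, ?_⟩ <;> simp only [blockStart, layerShift, hE, hO, if_true, if_false, h2]
    · push_cast
      ring
    · push_cast
      linear_combination -hmz

/-! ### Backward propagation -/

/-- The contribution of the subsystems of the first layer to the weight of a block of layer `j`;
`v` is the first site of its backward light-cone. -/
noncomputable def coneSum (e : (Qubit X.ξ m → Fin 4) → ℝ) (j : ℕ) (v : ℤ) : ℝ :=
  ∑ w ∈ Finset.range (j + 1), ∑ a ∈ Finset.range (j + 1 - w),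
    if w < X.ξ then ((2 : ℝ) ^ m) ^ (j - w) * X.suppWeight e (v + a * m) (w + 1) else 0

section ConeSum

variable {e : (Qubit X.ξ m → Fin 4) → ℝ} (he : ∀ Q, 0 ≤ e Q)

include he

theorem coneTerm_nonneg (j w : ℕ) (v : ℤ) :
    0 ≤ if w < X.ξ then ((2 : ℝ) ^ m) ^ (j - w) * X.suppWeight e v (w + 1) else 0 := by
  split_ifs
  · exact mul_nonneg (by positivity) (X.suppWeight_nonneg he _ _)
  · exact le_rfl

theorem coneSum_nonneg (j : ℕ) (v : ℤ) : 0 ≤ X.coneSum e j v :=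
  Finset.sum_nonneg fun _ _ => Finset.sum_nonneg fun _ _ => X.coneTerm_nonneg he _ _ _

theorem le_coneSum {j w a : ℕ} (haw : a + w ≤ j) (hw : w < X.ξ) (v : ℤ) :
    ((2 : ℝ) ^ m) ^ (j - w) * X.suppWeight e (v + a * m) (w + 1) ≤ X.coneSum e j v := by
  refine le_trans ?_ (Finset.single_le_sum
    (f := fun w => ∑ a ∈ Finset.range (j + 1 - w),
      if w < X.ξ then ((2 : ℝ) ^ m) ^ (j - w) * X.suppWeight e (v + a * m) (w + 1) else 0)
    (fun w _ => Finset.sum_nonneg fun _ _ => X.coneTerm_nonneg he _ _ _)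
    (Finset.mem_range.mpr (show w < j + 1 by omega)))
  refine le_trans ?_ (Finset.single_le_sum
    (f := fun a : ℕ =>
      if w < X.ξ then ((2 : ℝ) ^ m) ^ (j - w) * X.suppWeight e (v + a * m) (w + 1) else 0)
    (fun a _ => X.coneTerm_nonneg he _ _ _) (Finset.mem_range.mpr (show a < j + 1 - w by omega)))
  rw [if_pos hw]

/-- The larger cone is the union of two overlapping smaller ones. Windows that fit into a smaller
cone gain a factor `2^m` from the exponent. The window of full width is new: it is bounded by its
spanning strings and by the two windows one block shorter, which adds the `1` in `2^m + 1`. -/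
theorem coneSum_succ_le (j : ℕ) (v : ℤ) :
    X.coneSum e (j + 1) v ≤ ((2 : ℝ) ^ m + 1) * (X.coneSum e j v + X.coneSum e j (v + m)) +
      if j + 2 ≤ X.ξ then X.spanWeight e v (j + 2) else 0 := by
  have hD : (0 : ℝ) < 2 ^ m := by positivity
  set t : ℕ → ℤ → ℝ := fun w v =>
    if w < X.ξ then ((2 : ℝ) ^ m) ^ (j - w) * X.suppWeight e v (w + 1) else 0 with ht
  have hcone : ∀ v, X.coneSum e j v =
      ∑ w ∈ Finset.range (j + 1), ∑ a ∈ Finset.range (j + 1 - w), t w (v + a * m) := fun v => rfl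
  have ht0 : ∀ w v, 0 ≤ t w v := fun w v => X.coneTerm_nonneg he j w v
  -- The window of full width, with coefficient `1`.
  have hlast : (if j + 1 < X.ξ then ((2 : ℝ) ^ m) ^ (j + 1 - (j + 1)) *
      X.suppWeight e v (j + 1 + 1) else 0) ≤ (X.coneSum e j v + X.coneSum e j (v + m)) +
      if j + 2 ≤ X.ξ then X.spanWeight e v (j + 2) else 0 := by
    by_cases hξ : j + 1 < X.ξ
    · have h1 := X.suppWeight_succ_le he v (j + 1)
      have h2 := X.le_coneSum he (j := j) (w := j) (a := 0) (by omega) (by omega) v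
      have h3 := X.le_coneSum he (j := j) (w := j) (a := 0) (by omega) (by omega) (v + m)
      simp only [Nat.sub_self, pow_zero, one_mul, Nat.cast_zero, zero_mul, add_zero] at h2 h3
      rw [if_pos hξ, if_pos (show j + 2 ≤ X.ξ by omega), Nat.sub_self, pow_zero, one_mul]
      linarith
    · rw [if_neg hξ, if_neg (show ¬ j + 2 ≤ X.ξ by omega)]
      linarith [X.coneSum_nonneg he j v, X.coneSum_nonneg he j (v + m)]
  have hrest : (∑ w ∈ Finset.range (j + 1), ∑ a ∈ Finset.range (j + 1 + 1 - w),
      if w < X.ξ then ((2 : ℝ) ^ m) ^ (j + 1 - w) * X.suppWeight e (v + a * m) (w + 1) else 0) ≤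
      (2 : ℝ) ^ m * (X.coneSum e j v + X.coneSum e j (v + m)) := by
    rw [hcone, hcone, ← Finset.sum_add_distrib, Finset.mul_sum]
    refine Finset.sum_le_sum fun w hw => ?_
    have hwj : w ≤ j := by
      rw [Finset.mem_range] at hw
      omega
    have e1 : ∀ a : ℕ, (if w < X.ξ then ((2 : ℝ) ^ m) ^ (j + 1 - w) *
        X.suppWeight e (v + a * m) (w + 1) else 0) = (2 : ℝ) ^ m * t w (v + a * m) := fun a => by
      simp only [ht]
      split_ifs
      · rw [show j + 1 - w = j - w + 1 by omega, pow_succ]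
        ring
      · simp
    rw [Finset.sum_congr rfl fun a _ => e1 a, ← Finset.mul_sum]
    refine mul_le_mul_of_nonneg_left ?_ hD.le
    -- All starting positions but the last belong to the left cone; the last one is the final
    -- position of the right cone.
    obtain ⟨d, hd⟩ : ∃ d, j + 1 - w = d + 1 := ⟨j - w, by omega⟩
    rw [show j + 1 + 1 - w = d + 1 + 1 by omega, hd, Finset.sum_range_succ _ (d + 1)]
    refine add_le_add le_rfl ?_
    refine le_trans (le_of_eq ?_) (Finset.single_le_sum (f := fun a : ℕ => t w (v + m + a * m))
      (fun a _ => ht0 _ _) (Finset.mem_range.mpr (show d < d + 1 by omega)))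
    congr 1
    push_cast
    ring
  have htot : X.coneSum e (j + 1) v = (∑ w ∈ Finset.range (j + 1),
      ∑ a ∈ Finset.range (j + 1 + 1 - w),
      if w < X.ξ then ((2 : ℝ) ^ m) ^ (j + 1 - w) * X.suppWeight e (v + a * m) (w + 1) else 0) +
      if j + 1 < X.ξ then ((2 : ℝ) ^ m) ^ (j + 1 - (j + 1)) * X.suppWeight e v (j + 1 + 1)
      else 0 := by
    rw [coneSum, Finset.sum_range_succ]
    simp
  rw [htot]
  linarith

end ConeSum

section Backward

variable {h : ℕ} (hm : m = h + h) {e : ℕ → (Qubit X.ξ m → Fin 4) → ℝ} (he : ∀ j Q, 0 ≤ e j Q)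
  (hrec : ∀ (j : ℕ) (hj : j < X.L) P, e (j + 1) P = ∑ Q, X.kernel ⟨j, hj⟩ Q P * e j Q)

include hm he hrec

/-- Iterating `spanWeight_step` down to the first layer; the window widens by one block per layer,
and `hξ` keeps it within the ring. -/
theorem spanWeight_le (j : ℕ) (hj : j < X.L) (k : ℤ) (w : ℕ) (hw : 1 ≤ w) (hξ : w + j ≤ X.ξ) :
    X.spanWeight (e 0) (X.blockStart ⟨j, hj⟩ k - j * h) (w + j) ≤
      (((2 : ℝ) ^ m + 1) ^ 2) ^ j * X.spanWeight (e j) (X.blockStart ⟨j, hj⟩ k) w := by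
  induction j generalizing k w with
  | zero => simp
  | succ j ih =>
    have hD : (0 : ℝ) < ((2 : ℝ) ^ m + 1) ^ 2 := by positivity
    obtain ⟨k', hk, -⟩ := X.exists_blockStart_pred hm hj k
    have h1 := X.spanWeight_step hm ⟨j, by omega⟩ (he j) (hrec j (by omega)) hk hw (by omega)
    have h2 := ih (by omega) k' (w + 1) (by omega) (by omega)
    rw [inv_mul_le_iff₀ hD] at h1
    rw [← hk] at h2
    have e1 : X.blockStart ⟨j + 1, hj⟩ k - ((j + 1 : ℕ) : ℤ) * h =
        X.blockStart ⟨j + 1, hj⟩ k - h - j * h := by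
      push_cast
      ring
    rw [e1, show w + (j + 1) = w + 1 + j by ring, pow_succ, mul_assoc]
    exact h2.trans (mul_le_mul_of_nonneg_left h1 (by positivity))

/-- Two factors of `2^m + 1` per layer suffice: one for merging the two lower cones and one for
sending a lower block into a half. The new window of full width does not take part in the merging
and spends both factors on its two end blocks. -/
theorem coneSum_le (j : ℕ) (hj : j < X.L) (k : ℤ) :
    X.coneSum (e 0) j (X.blockStart ⟨j, hj⟩ k - j * h) ≤
      (((2 : ℝ) ^ m + 1) ^ 2) ^ j * X.suppWeight (e j) (X.blockStart ⟨j, hj⟩ k) 1 := by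
  induction j generalizing k with
  | zero => simp [coneSum, Nat.pos_of_ne_zero (NeZero.ne X.ξ)]
  | succ j ih =>
    have hmz : (m : ℤ) = h + h := by exact_mod_cast hm
    set u := X.blockStart ⟨j + 1, hj⟩ k with hu
    set D : ℝ := (2 : ℝ) ^ m + 1 with hD
    have hD0 : 0 < D := by positivity
    obtain ⟨k', hk, hk'⟩ := X.exists_blockStart_pred hm hj k
    rw [← hu] at hk hk'
    have h1 := X.suppWeight_step hm ⟨j, by omega⟩ (he j) (hrec j (by omega)) hk hk'
    have h2 := ih (by omega) k'
    have h3 := ih (by omega) (k' + 1)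
    rw [← hk] at h2
    rw [← hk'] at h3
    have h4 := X.coneSum_succ_le (he 0) j (u - ((j + 1 : ℕ) : ℤ) * h)
    have e1 : u - ((j + 1 : ℕ) : ℤ) * h = u - h - j * h := by
      push_cast
      ring
    have e2 : u - ((j + 1 : ℕ) : ℤ) * h + m = u + h - j * h := by
      push_cast
      linear_combination hmz
    rw [e2, e1] at h4
    rw [e1]
    -- Spanning strings of the whole lower window are followed up to layer `j`, where they span the
    -- two lower neighbours.
    have h5 : (if j + 2 ≤ X.ξ then X.spanWeight (e 0) (u - h - j * h) (j + 2) else 0) ≤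
        (D ^ 2) ^ j * (D ^ 2 * if 2 ≤ X.ξ then (D ^ 2)⁻¹ * X.spanWeight (e j) (u - h) 2 else 0) := by
      by_cases hξ : j + 2 ≤ X.ξ
      · have := X.spanWeight_le hm he hrec j (by omega) k' 2 (by omega) (by omega)
        rw [← hk, add_comm 2 j] at this
        rw [if_pos hξ, if_pos (by omega), mul_inv_cancel_left₀ (by positivity)]
        exact this
      · rw [if_neg hξ]
        refine mul_nonneg (by positivity) (mul_nonneg (by positivity) ?_)
        split_ifs
        · exact mul_nonneg (by positivity) (mass_nonneg (he j))
        · exact le_rfl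
    have h6 : (D ^ 2) ^ j * (D ^ 2 * (D⁻¹ * (X.suppWeight (e j) (u - h) 1 +
        X.suppWeight (e j) (u + h) 1) +
        if 2 ≤ X.ξ then (D ^ 2)⁻¹ * X.spanWeight (e j) (u - h) 2 else 0)) ≤
        (D ^ 2) ^ (j + 1) * X.suppWeight (e (j + 1)) u 1 := by
      rw [pow_succ (D ^ 2) j, mul_assoc]
      exact mul_le_mul_of_nonneg_left (mul_le_mul_of_nonneg_left h1 (by positivity))
        (by positivity)
    refine le_trans ?_ h6
    have h7 : (D ^ 2) ^ j * (D ^ 2 * (D⁻¹ * (X.suppWeight (e j) (u - h) 1 +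
        X.suppWeight (e j) (u + h) 1) +
        if 2 ≤ X.ξ then (D ^ 2)⁻¹ * X.spanWeight (e j) (u - h) 2 else 0)) =
        D * ((D ^ 2) ^ j * X.suppWeight (e j) (u - h) 1 +
          (D ^ 2) ^ j * X.suppWeight (e j) (u + h) 1) +
        (D ^ 2) ^ j * (D ^ 2 *
          if 2 ≤ X.ξ then (D ^ 2)⁻¹ * X.spanWeight (e j) (u - h) 2 else 0) := by
      generalize (if 2 ≤ X.ξ then (D ^ 2)⁻¹ * X.spanWeight (e j) (u - h) 2 else 0) = y
      field_simp
    rw [h7]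
    exact h4.trans (add_le_add (mul_le_mul_of_nonneg_left (add_le_add h2 h3) hD0.le) h5)

end Backward

/-! ### Forward propagation -/

section Forward

variable {h : ℕ} (hm : m = h + h) {e : ℕ → (Qubit X.ξ m → Fin 4) → ℝ} (he : ∀ j Q, 0 ≤ e j Q)
  {l : ℕ} (hrec : ∀ (J : ℕ) (hJ : l + J + 1 < X.L) P,
    e (J + 1) P = ∑ Q, X.kernel ⟨l + J + 1, hJ⟩ Q P * e J Q)

include hm he hrec

/-- A lower bound that holds for the non-trivial strings on a window propagates through a layer. -/
theorem le_of_suppIn {J : ℕ} (hJ : l + J + 1 < X.L) {P : Qubit X.ξ m → Fin 4} (hP : P ≠ 0)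
    {k : ℤ} {w : ℕ}
    (hs : SuppIn P (X.blockStart ⟨l + J + 1, hJ⟩ k) (X.blockStart ⟨l + J + 1, hJ⟩ k + w * m))
    {v : ℤ} {c : ℝ} (hc0 : 0 ≤ c)
    (hc : ∀ Q : Qubit X.ξ m → Fin 4, Q ≠ 0 → SuppIn Q v (v + m) → c ≤ e J Q) (T : Finset ℤ)
    (hkT : ∀ t, k ≤ t → t < k + w → t ∈ T)
    (hT : ∀ t ∈ T, v = X.blockStart ⟨l + J + 1, hJ⟩ t - h ∨ v = X.blockStart ⟨l + J + 1, hJ⟩ t + h) :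
    (((2 : ℝ) ^ m + 1) ^ T.card)⁻¹ * c ≤ e (J + 1) P := by
  have hmz : (m : ℤ) = h + h := by exact_mod_cast hm
  have h1 := X.sum_kernel_ge_of_suppIn hm ⟨l + J + 1, hJ⟩ hs (a := v) (b := v + m) T
    (fun t ht => by
      rcases hT t ht with h | h
      · left
        constructor <;> linarith
      · right
        constructor <;> linarith)
    (fun t h1 h2 h3 => absurd (hkT t h1 h2) h3)
  refine (mul_le_mul_of_nonneg_right h1 hc0).trans ?_
  rw [hrec J hJ, mass, Finset.sum_mul]
  refine Finset.sum_le_sum fun Q _ => ?_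
  -- By symmetry of the kernel, the probability of leaving `P` for the window is the weight arriving
  -- at `P` from the window.
  rw [X.kernel_comm _ P Q]
  have hk0 := X.kernel_nonneg ⟨l + J + 1, hJ⟩ Q P
  split_ifs with hQ
  · by_cases hk : X.kernel ⟨l + J + 1, hJ⟩ Q P = 0
    · simp [hk]
    · refine mul_le_mul_of_nonneg_left (hc Q ?_ hQ) hk0
      -- The identity leads only to the identity, whereas `P` is non-trivial.
      rintro rfl
      refine hP (funext fun q => ?_)
      obtain ⟨⟨k', i⟩, rfl⟩ := (X.bijective_blockQubit ⟨l + J + 1, hJ⟩).2 q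
      have := (twirl_ne_zero (Finset.prod_ne_zero_iff.mp hk k' (Finset.mem_univ _))).mp rfl
      exact congrFun this i
  · rw [zero_mul]
    exact mul_nonneg hk0 (he J Q)

/-- Every block of the forward cone is reached from the apex by a path of neighbouring blocks. Along
one such path each layer costs a single factor, and all other contributions are dropped. -/
theorem le_forward {u : ℤ} {c : ℝ} (hc0 : 0 ≤ c)
    (hc : ∀ Q : Qubit X.ξ m → Fin 4, Q ≠ 0 → SuppIn Q u (u + m) → c ≤ e 0 Q)
    (hl : l < X.L) (hu : ∃ k, u = X.blockStart ⟨l, hl⟩ k)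
    (J : ℕ) (hJ : l + J < X.L) {k : ℤ} (h1 : X.blockStart ⟨l + J, hJ⟩ k - u ≤ J * h)
    (h2 : u - X.blockStart ⟨l + J, hJ⟩ k ≤ J * h) {P : Qubit X.ξ m → Fin 4} (hP : P ≠ 0)
    (hs : SuppIn P (X.blockStart ⟨l + J, hJ⟩ k) (X.blockStart ⟨l + J, hJ⟩ k + m)) :
    (((2 : ℝ) ^ m + 1) ^ J)⁻¹ * c ≤ e J P := by
  have hmz : (m : ℤ) = h + h := by exact_mod_cast hm
  have hh : (0 : ℤ) < h := by
    have := NeZero.ne m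
    omega
  -- Block starts of layer `l + J` differ from `u` by multiples of `h` of the same parity as `J`.
  have hpar : ∀ (J : ℕ) (hJ : l + J < X.L) (k : ℤ), ∃ t : ℤ,
      X.blockStart ⟨l + J, hJ⟩ k - u = (J + 2 * t) * h := by
    intro J
    induction J with
    | zero =>
      intro hJ k
      obtain ⟨k₀, rfl⟩ := hu
      refine ⟨k - k₀, ?_⟩
      simp only [blockStart, Nat.add_zero]
      push_cast
      linear_combination (k - k₀) * hmz
    | succ J ih =>
      intro hJ k
      obtain ⟨k', hk, -⟩ := X.exists_blockStart_pred hm (j := l + J) (by omega) k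
      obtain ⟨t, ht⟩ := ih (by omega) k'
      refine ⟨t, ?_⟩
      have : X.blockStart ⟨l + (J + 1), hJ⟩ k = X.blockStart ⟨l + J + 1, hJ⟩ k := rfl
      rw [this]
      push_cast
      linear_combination hk + ht
  induction J generalizing k P with
  | zero =>
    have : X.blockStart ⟨l + 0, hJ⟩ k = u := by
      push_cast at h1 h2
      linarith
    rw [this] at hs
    simpa using hc P hP hs
  | succ J ih =>
    obtain ⟨t, ht⟩ := hpar (J + 1) hJ k
    obtain ⟨k', hk, hk'⟩ := X.exists_blockStart_pred hm (j := l + J) (by omega) k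
    have hb : X.blockStart ⟨l + (J + 1), hJ⟩ k = X.blockStart ⟨l + J + 1, hJ⟩ k := rfl
    rw [hb] at h1 h2 hs ht
    rw [ht] at h1
    have h2' : -((J + 1 : ℕ) : ℤ) * h ≤ (((J + 1 : ℕ) : ℤ) + 2 * t) * h := by linarith
    have h3 := le_of_mul_le_mul_right h1 hh
    have h4 := le_of_mul_le_mul_right h2' hh
    have key : ∀ v : ℤ, ∀ kv : ℤ, v = X.blockStart ⟨l + J, by omega⟩ kv → v - u ≤ J * h →
        u - v ≤ J * h → (v = X.blockStart ⟨l + J + 1, hJ⟩ k - h ∨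
          v = X.blockStart ⟨l + J + 1, hJ⟩ k + h) →
        (((2 : ℝ) ^ m + 1) ^ (J + 1))⁻¹ * c ≤ e (J + 1) P := by
      intro v kv hv hv1 hv2 hv3
      have := X.le_of_suppIn hm he hrec (J := J) hJ hP (w := 1) (by simpa using hs) (v := v)
        (c := (((2 : ℝ) ^ m + 1) ^ J)⁻¹ * c) (by positivity)
        (fun Q hQ hQs => ih (by omega) (by rwa [← hv]) (by rwa [← hv]) hQ (by rwa [← hv])) {k}
        (fun t h1 h2 => by
          rw [Finset.mem_singleton]
          push_cast at h2
          omega)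
        (fun t ht => by
          rw [Finset.mem_singleton] at ht
          subst ht
          exact hv3)
      refine le_trans (le_of_eq ?_) this
      rw [Finset.card_singleton, pow_one, pow_succ, mul_inv]
      ring
    -- Here `t ≤ 0`. At the right edge of the cone (`t = 0`) only the left predecessor lies in the
    -- previous cone; everywhere else the right predecessor does.
    by_cases ht0 : t = 0
    · refine key _ k' hk ?_ ?_ (Or.inl rfl)
      · rw [ht0] at ht
        push_cast at ht
        linarith
      · rw [ht0] at ht
        push_cast at ht
        have : (0 : ℤ) ≤ J * h := by positivity
        linarith
    · have ht1 : t ≤ -1 := by omega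
      refine key _ (k' + 1) hk' ?_ ?_ (Or.inr rfl)
      · have e1 : X.blockStart ⟨l + J + 1, hJ⟩ k + h - u = (J + 2 + 2 * t) * h := by
          push_cast at ht
          linear_combination ht
        rw [e1]
        exact mul_le_mul_of_nonneg_right (by linarith) hh.le
      · have e1 : u - (X.blockStart ⟨l + J + 1, hJ⟩ k + h) = -(J + 2 + 2 * t) * h := by
          push_cast at ht
          linear_combination -ht
        rw [e1]
        push_cast at h4
        exact mul_le_mul_of_nonneg_right (by linarith) hh.le

end Forward

end Setting

/-! ### Reduced operators -/

theorem mass_eq_sum_filter {α : Type} [Fintype α] (C : α → Prop) [DecidablePred C] (e : α → ℝ) :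
    mass C e = ∑ a ∈ Finset.univ.filter C, e a := by
  rw [Finset.sum_filter]
  exact Finset.sum_congr rfl fun a _ => by split_ifs <;> rfl

section Reduced

variable {ι κ : Type} [Fintype ι] [Fintype κ] [DecidableEq ι] [DecidableEq κ]

theorem onQubits_pauliString {e : κ → ι} (he : Function.Injective e) (p : κ → Fin 4) :
    onQubits e (pauliString p) = pauliString (Function.extend e p 0) := by
  ext x y
  simp only [onQubits, pauliString, Matrix.of_apply]
  rw [← Finset.prod_mul_prod_compl (Finset.univ.image e), Finset.prod_image he.injOn]
  have h1 : ∀ i, Function.extend e p 0 (e i) = p i := fun i => he.extend_apply _ _ _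
  have h2 : ∀ q ∈ (Finset.univ.image e)ᶜ, pauli (Function.extend e p 0 q) (x q) (y q) =
      if x q = y q then 1 else 0 := fun q hq => by
    have hq' : ¬ ∃ i, e i = q := by simpa using hq
    rw [Function.extend_apply' _ _ _ hq']
    exact Matrix.one_apply
  simp only [h1]
  rw [Finset.prod_congr rfl h2, Finset.prod_ite_zero, Finset.prod_const_one]
  have h3 : (∀ q, (∀ i, e i ≠ q) → x q = y q) ↔ ∀ q ∈ (Finset.univ.image e)ᶜ, x q = y q := by
    simp
  by_cases h : ∀ q, (∀ i, e i ≠ q) → x q = y q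
  · rw [if_pos h, if_pos (h3.mp h), mul_one]
  · rw [if_neg h, if_neg (mt h3.mpr h), mul_zero]

theorem sum_extend {e : κ → ι} (he : Function.Injective e) (f : (ι → Fin 4) → ℝ) :
    ∑ p : κ → Fin 4, f (Function.extend e p 0) =
      mass (fun P : ι → Fin 4 => ∀ q, P q ≠ 0 → q ∈ Set.range e) f := by
  classical
  rw [mass_eq_sum_filter]
  refine Finset.sum_nbij' (fun p => Function.extend e p 0) (fun P i => P (e i)) ?_ ?_ ?_ ?_ ?_
  · intro p _
    rw [Finset.mem_filter]
    refine ⟨Finset.mem_univ _, fun q hq => ?_⟩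
    by_contra hcon
    exact hq (Function.extend_apply' _ _ _ hcon)
  · exact fun _ _ => Finset.mem_univ _
  · intro p _
    funext i
    exact he.extend_apply _ _ _
  · intro P hP
    rw [Finset.mem_filter] at hP
    funext q
    by_cases hq : ∃ i, e i = q
    · obtain ⟨i, rfl⟩ := hq
      exact he.extend_apply _ _ _
    · rw [Function.extend_apply' _ _ _ hq]
      by_contra hcon
      exact hq (hP.2 q (Ne.symm hcon))
  · exact fun _ _ => rfl

theorem extend_eq_zero_iff {e : κ → ι} (he : Function.Injective e) (p : κ → Fin 4) :
    Function.extend e p 0 = 0 ↔ p = 0 := by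
  constructor
  · intro h
    funext i
    rw [← he.extend_apply p 0 i, h]
    rfl
  · rintro rfl
    funext q
    by_cases hq : ∃ i, e i = q
    · obtain ⟨i, rfl⟩ := hq
      exact he.extend_apply _ _ _
    · exact Function.extend_apply' _ _ _ hq

/-- The partial trace is adjoint to tensoring with the identity. Hence the Pauli coefficients of a
reduced state are coefficients of the full state. -/
theorem trace_onQubits_mul (A : Finset ι) (B : Op A) (ρ : Op ι) :
    (onQubits (Subtype.val : A → ι) B * ρ).trace = (B * reduced A ρ).trace := by
  let E : (ι → Fin 2) ≃ (A → Fin 2) × ({q // q ∉ A} → Fin 2) :=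
    Equiv.piEquivPiSubtypeProd (fun q => q ∈ A) fun _ => Fin 2
  have hE : ∀ a z, E.symm (a, z) = glue A a z := fun a z => by
    funext q
    simp only [E, Equiv.piEquivPiSubtypeProd_symm_apply, glue]
  have h1 : ∀ a z b z', onQubits (Subtype.val : A → ι) B (glue A a z) (glue A b z') =
      if z = z' then B a b else 0 := by
    intro a z b z'
    have h2 : ∀ a z, (fun i : A => glue A a z i) = a := fun a z => by
      funext i
      simp [glue]
    simp only [onQubits, Matrix.of_apply, h2]
    have h3 : (∀ q, (∀ i : A, (i : ι) ≠ q) → glue A a z q = glue A b z' q) ↔ z = z' := by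
      constructor
      · intro h
        funext q
        simpa [glue, q.2] using h q fun i hi => q.2 (hi ▸ i.2)
      · rintro rfl q hq
        have : q ∉ A := fun hqA => hq ⟨q, hqA⟩ rfl
        simp [glue, this]
    by_cases h : z = z'
    · rw [if_pos (h3.mpr h), if_pos h]
    · rw [if_neg (mt h3.mp h), if_neg h]
  simp only [Matrix.trace, Matrix.diag, Matrix.mul_apply]
  rw [← E.symm.sum_comp]
  simp only [← E.symm.sum_comp (fun y => onQubits (Subtype.val : A → ι) B _ y * ρ y _),
    Fintype.sum_prod_type, hE, h1, reduced, Matrix.of_apply, Finset.mul_sum]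
  refine Finset.sum_congr rfl fun a _ => ?_
  rw [Finset.sum_comm]
  refine Finset.sum_congr rfl fun b _ => Finset.sum_congr rfl fun z _ => ?_
  simp

theorem hs_reduced (A : Finset ι) (p : A → Fin 4) (ρ : Op ι) :
    hs (pauliString p) (reduced A ρ) =
      hs (pauliString (Function.extend (Subtype.val : A → ι) p 0)) ρ := by
  rw [hs, hs, ← trace_onQubits_mul, onQubits_pauliString Subtype.val_injective]

theorem isHermitian_reduced (A : Finset ι) {ρ : Op ι} (hρ : ρ.IsHermitian) :
    (reduced A ρ).IsHermitian := by
  ext a b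
  simp only [reduced, Matrix.conjTranspose_apply, Matrix.of_apply, star_sum]
  exact Finset.sum_congr rfl fun z _ => hρ.apply _ _

/-- `ε(M)` is the weight of the non-trivial Pauli strings in `M`. -/
theorem epsilon_eq {M : Op κ} (hM : M.IsHermitian) :
    epsilon M = (2 ^ Fintype.card κ)⁻¹ *
      mass (fun p : κ → Fin 4 => p ≠ 0) fun p => hs (pauliString p) M ^ 2 := by
  have h2 : (2 : ℝ) ^ Fintype.card κ ≠ 0 := by positivity
  have htr : M.trace = ((hs (1 : Op κ) M : ℝ) : ℂ) := by
    rw [ofReal_hs Matrix.isHermitian_one hM, one_mul]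
  set r : ℝ := hs (1 : Op κ) M / 2 ^ Fintype.card κ with hr
  have hc : M.trace / (Fintype.card (κ → Fin 2) : ℂ) = (r : ℂ) := by
    rw [htr, hr]
    simp
  set N := M - (r : ℂ) • (1 : Op κ) with hN
  have hNH : N.IsHermitian := by
    refine hM.sub ?_
    rw [Matrix.IsHermitian, Matrix.conjTranspose_smul, Matrix.conjTranspose_one]
    simp
  -- Subtracting the multiple of the identity removes exactly the identity coefficient.
  have hpN : ∀ p, hs (pauliString p) N = if p ≠ 0 then hs (pauliString p) M else 0 := by
    intro p
    have h1 : hs (pauliString p) N = hs (pauliString p) M - r * hs (pauliString p) 1 := by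
      simp only [hN, hs, Matrix.mul_sub, Matrix.trace_sub, Matrix.mul_smul, Matrix.trace_smul,
        Complex.sub_re, smul_eq_mul, Complex.re_ofReal_mul]
    rw [h1, ← pauliString_zero, hs_pauliString]
    by_cases hp : p = 0
    · subst hp
      rw [if_pos rfl, if_neg (by simp), hr, pauliString_zero]
      field_simp
      ring
    · simp [hp]
  have h3 := hs_parseval hNH hNH
  have h4 : epsilon M = hs N N := by
    rw [epsilon, hsDist, hc, ← hN, hNH.eq, hs]
  rw [h4, eq_inv_mul_iff_mul_eq₀ h2, ← h3, mass]
  refine Finset.sum_congr rfl fun p _ => ?_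
  rw [hpN]
  split_ifs
  · ring
  · ring

theorem epsilon_pauliString (p : κ → Fin 4) :
    epsilon (pauliString p) = if p = 0 then 0 else 2 ^ Fintype.card κ := by
  rw [epsilon_eq (isHermitian_pauliString p), mass]
  simp only [hs_pauliString]
  split_ifs with hp
  · subst hp
    rw [Finset.sum_eq_zero, mul_zero]
    intro q _
    by_cases hq : q = 0 <;> simp [hq]
  · rw [Finset.sum_eq_single p]
    · simp only [ne_eq, hp, not_false_eq_true, if_true]
      field_simp
    · intro q _ hq
      simp [hq]
    · simp

end Reduced

namespace Setting

variable {m : ℕ} [NeZero m] (X : Setting m)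

theorem isHermitian_ρ : X.ρ.IsHermitian := X.ρ_posSemidef.isHermitian

/-- The non-trivial Pauli weight of the state on the window, divided by the dimension. The condition
`k' - k < ξ` makes the sites of the window distinct on the ring, so that the dimension is as stated.
-/
theorem epsilon_ρred {k k' : ℤ} (hk : k ≤ k') (hk' : k' - k < X.ξ) :
    epsilon (X.ρred k k') = (((2 : ℝ) ^ m) ^ ((k' - k).toNat + 1))⁻¹ *
      X.suppWeight (fun P => hs (pauliString P) X.ρ ^ 2) (k * m) ((k' - k).toNat + 1) := by
  have hm : (0 : ℤ) < m := by exact_mod_cast Nat.pos_of_ne_zero (NeZero.ne m)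
  set w := (k' - k).toNat with hw
  have hwz : (w : ℤ) = k' - k := Int.toNat_of_nonneg (by omega)
  set A := (subsysSites m k k').image (fun z : ℤ => (z : Qubit X.ξ m)) with hA
  have hlen : (k' + 1) * m - k * m = ((w + 1 : ℕ) : ℤ) * m := by
    push_cast
    rw [hwz]
    ring
  have hle : ((w + 1 : ℕ) : ℤ) * m ≤ ((X.ξ * m : ℕ) : ℤ) := by
    have : w + 1 ≤ X.ξ := by omega
    exact_mod_cast Nat.mul_le_mul_right m this
  have hcard : Fintype.card A = m * (w + 1) := by
    rw [Fintype.card_coe, hA, Finset.card_image_of_injOn, subsysSites, Int.card_Ico, hlen]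
    · rw [mul_comm m]
      exact_mod_cast Int.toNat_natCast _
    · intro z hz z' hz' h
      simp only [subsysSites, Finset.coe_Ico, Set.mem_Ico] at hz hz'
      exact eq_of_intCast_eq h (by linarith) (by linarith)
  rw [ρred, epsilon_eq (isHermitian_reduced _ X.isHermitian_ρ), hcard, pow_mul]
  congr 1
  simp only [hs_reduced]
  have h1 := sum_extend (Subtype.val_injective (p := fun q => q ∈ A))
    (fun P => if P ≠ 0 then hs (pauliString P) X.ρ ^ 2 else 0)
  have h2 : mass (fun p : A → Fin 4 => p ≠ 0)
      (fun p => hs (pauliString (Function.extend (Subtype.val : A → _) p 0)) X.ρ ^ 2) =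
      ∑ p : A → Fin 4, if Function.extend (Subtype.val : A → _) p 0 ≠ 0 then
        hs (pauliString (Function.extend (Subtype.val : A → _) p 0)) X.ρ ^ 2 else 0 := by
    refine Finset.sum_congr rfl fun p _ => ?_
    have := extend_eq_zero_iff (Subtype.val_injective (p := fun q => q ∈ A)) p
    by_cases hp : p = 0
    · rw [if_neg (not_not.mpr hp), if_neg (not_not.mpr (this.mpr hp))]
    · rw [if_pos hp, if_pos (mt this.mp hp)]
  rw [h2, h1]
  unfold suppWeight mass
  refine Finset.sum_congr rfl fun P _ => ?_
  have h3 : (∀ q, P q ≠ 0 → q ∈ Set.range (Subtype.val : A → _)) ↔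
      SuppIn P (k * m) (k * m + ((w + 1 : ℕ) : ℤ) * m) := by
    refine forall_congr' fun q => imp_congr_right fun _ => ?_
    rw [Subtype.range_coe_subtype, Set.mem_ofPred_eq, hA, Finset.mem_image]
    simp only [subsysSites, Finset.mem_Ico, ← hlen, add_sub_cancel, and_assoc]
  beta_reduce
  by_cases h4 : SuppIn P (k * m) (k * m + ((w + 1 : ℕ) : ℤ) * m)
  · rw [if_pos (h3.mpr h4)]
    by_cases h5 : P = 0
    · rw [if_neg (not_not.mpr h5), if_neg fun h => h.2 h5]
    · rw [if_pos h5, if_pos ⟨h4, h5⟩]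
  · rw [if_neg (mt h3.mp h4), if_neg fun h => h4 h.1]

/-! ### The geometry of the light-cones -/

/-- One step in the light-cone shifts the start of a block by `h` to the left or to the right, since
overlapping blocks of adjacent layers are neighbours. -/
theorem blockStart_sub_le {h : ℕ} (hm : m = h + h) {b b' : LineBlock X.L}
    (hbb : Relation.ReflTransGen (Feeds m) b b') :
    (b.1 : ℕ) ≤ b'.1 ∧
    X.blockStart b'.1 b'.2 - X.blockStart b.1 b.2 ≤ (((b'.1 : ℕ) : ℤ) - (b.1 : ℕ)) * h ∧
    X.blockStart b.1 b.2 - X.blockStart b'.1 b'.2 ≤ (((b'.1 : ℕ) : ℤ) - (b.1 : ℕ)) * h := by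
  have hmz : (m : ℤ) = h + h := by exact_mod_cast hm
  have hm0 : (0 : ℤ) < m := by exact_mod_cast Nat.pos_of_ne_zero (NeZero.ne m)
  induction hbb with
  | refl => simp
  | @tail c d _ hcd ih =>
    obtain ⟨h1, z, hz1, hz2⟩ := hcd
    obtain ⟨⟨jc, hjc⟩, kc⟩ := c
    obtain ⟨⟨jd, hjd⟩, kd⟩ := d
    dsimp only at h1 ih ⊢
    subst h1
    obtain ⟨k', hk, -⟩ := X.exists_blockStart_pred hm hjd kd
    simp only [blockSites, Set.mem_Ico] at hz1 hz2
    change X.blockStart ⟨jc, hjc⟩ kc ≤ z ∧ z < X.blockStart ⟨jc, hjc⟩ kc + m at hz1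
    change X.blockStart ⟨jc + 1, hjd⟩ kd ≤ z ∧ z < X.blockStart ⟨jc + 1, hjd⟩ kd + m at hz2
    have h2 : X.blockStart ⟨jc, hjc⟩ kc = X.blockStart ⟨jc, hjc⟩ k' + (kc - k') * m := by
      simp only [blockStart]
      ring
    have h3 : kc - k' < 2 := by
      by_contra hcon
      nlinarith
    have h4 : -1 < kc - k' := by
      by_contra hcon
      nlinarith
    have h5 : kc - k' = 0 ∨ kc - k' = 1 := by omega
    have h6 : X.blockStart ⟨jc + 1, hjd⟩ kd - X.blockStart ⟨jc, hjc⟩ kc ≤ h ∧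
        X.blockStart ⟨jc, hjc⟩ kc - X.blockStart ⟨jc + 1, hjd⟩ kd ≤ h := by
      rcases h5 with h5 | h5 <;> rw [h5] at h2 <;> constructor <;> linarith
    refine ⟨by omega, ?_, ?_⟩
    · push_cast
      nlinarith [ih.2.1, h6.1]
    · push_cast
      nlinarith [ih.2.2, h6.2]

theorem backwardIndices_bound {h : ℕ} (hm : m = h + h) {b : LineBlock X.L} {k : ℤ}
    (hk : k ∈ backwardIndices m b) :
    X.blockStart b.1 b.2 - (b.1 : ℕ) * h ≤ k * m ∧
      k * m + m ≤ X.blockStart b.1 b.2 + m + (b.1 : ℕ) * h := by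
  have hm0 : (0 : ℤ) < m := by exact_mod_cast Nat.pos_of_ne_zero (NeZero.ne m)
  have key : ∀ z ∈ subsysSites m k k, X.blockStart b.1 b.2 - (b.1 : ℕ) * h ≤ z ∧
      z < X.blockStart b.1 b.2 + m + (b.1 : ℕ) * h := by
    intro z hz
    have h1 := hk hz
    simp only [coneSites, Set.mem_iUnion] at h1
    obtain ⟨b', hb', hs⟩ := h1
    obtain ⟨h2, h3, h4⟩ := X.blockStart_sub_le hm hb'
    change X.blockStart b'.1 b'.2 ≤ z ∧ z < X.blockStart b'.1 b'.2 + m at hs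
    have h5 : (0 : ℤ) ≤ ((b'.1 : ℕ) : ℤ) * h := by positivity
    constructor <;> nlinarith
  have h1 := key (k * m) (by simp only [subsysSites, Finset.mem_Ico]; constructor <;> nlinarith)
  -- The last site of the group, turned into a bound for its right end.
  have h2 := key (k * m + m - 1)
    (by simp only [subsysSites, Finset.mem_Ico]; constructor <;> nlinarith)
  exact ⟨h1.1, by linarith [h2.2]⟩

theorem exists_blockStart_zero {h : ℕ} (hm : m = h + h) (j : ℕ) (hj : j < X.L) (k : ℤ) :
    ∃ k₀ : ℤ, X.blockStart ⟨j, hj⟩ k - j * h = X.blockStart ⟨0, by omega⟩ k₀ := by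
  induction j generalizing k with
  | zero => exact ⟨k, by simp⟩
  | succ j ih =>
    obtain ⟨k', hk, -⟩ := X.exists_blockStart_pred hm hj k
    obtain ⟨k₀, h0⟩ := ih (by omega) k'
    refine ⟨k₀, ?_⟩
    rw [← h0, ← hk]
    push_cast
    ring

theorem suppIn_ring (P : Qubit X.ξ m → Fin 4) (a : ℤ) : SuppIn P a (a + X.ξ * m) := by
  intro q _
  have hn : (0 : ℤ) < X.ξ * m := by
    exact_mod_cast Nat.pos_of_ne_zero (mul_ne_zero (NeZero.ne X.ξ) (NeZero.ne m))
  set r := ((q.val : ℤ) - a) % (X.ξ * m) with hr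
  have h0 := Int.emod_nonneg ((q.val : ℤ) - a) hn.ne'
  have h1 := Int.emod_lt_of_pos ((q.val : ℤ) - a) hn
  have h2 := Int.emod_add_mul_ediv ((q.val : ℤ) - a) (X.ξ * m)
  refine ⟨a + r, by omega, by omega, ?_⟩
  have h3 : ((q.val : ℤ) : Qubit X.ξ m) = q := by
    rw [Int.cast_natCast, ZMod.natCast_zmod_val]
  rw [← h3, ZMod.intCast_eq_intCast_iff_dvd_sub]
  refine ⟨((q.val : ℤ) - a) / (X.ξ * m), ?_⟩
  push_cast
  linear_combination -h2

theorem mass_mono {α : Type} [Fintype α] {C C' : α → Prop} {e : α → ℝ} (he : ∀ a, 0 ≤ e a)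
    (hC : ∀ a, C a → C' a) : mass C e ≤ mass C' e := by
  refine Finset.sum_le_sum fun a _ => ?_
  split_ifs with h1 h2
  · exact le_rfl
  · exact absurd (hC a h1) h2
  · exact he a
  · exact le_rfl

/-- The pairs are injected into the terms of the cone sum; the dimension of a group of `w + 1`
blocks turns the power `j + 1` into `j - w`. If the first layer is aligned with the `S_k`, one cone
sum suffices. If it is displaced, the groups are covered by one block more, which costs a factor
`2^m`, and groups filling the ring are collected in a second copy. -/
theorem sum_pairs_le {h : ℕ} (hm : m = h + h) {e : (Qubit X.ξ m → Fin 4) → ℝ}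
    (he : ∀ Q, 0 ≤ e Q) :
    ∑ kk ∈ X.pairs, ((2 : ℝ) ^ m) ^ ((X.layer : ℕ) + 1) *
      ((((2 : ℝ) ^ m) ^ ((kk.2 - kk.1).toNat + 1))⁻¹ *
        X.suppWeight e (kk.1 * m) ((kk.2 - kk.1).toNat + 1)) ≤
      ((2 : ℝ) ^ m + 1) *
        X.coneSum e X.layer (X.blockStart X.layer X.block - (X.layer : ℕ) * h) := by
  classical
  have hm0 : (0 : ℤ) < m := by exact_mod_cast Nat.pos_of_ne_zero (NeZero.ne m)
  have hmz : (m : ℤ) = h + h := by exact_mod_cast hm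
  have hD : (0 : ℝ) < 2 ^ m := by positivity
  set j : ℕ := X.layer.val with hj
  set u := X.blockStart X.layer X.block with hu
  set v := u - j * h with hv
  set t : (_ : ℕ) × ℕ → ℝ := fun s =>
    if s.1 < X.ξ then ((2 : ℝ) ^ m) ^ (j - s.1) * X.suppWeight e (v + s.2 * m) (s.1 + 1) else 0
    with ht
  have ht0 : ∀ s, 0 ≤ t s := fun s => X.coneTerm_nonneg he _ _ _
  set I : Finset ((_ : ℕ) × ℕ) :=
    (Finset.range (j + 1)).sigma fun w => Finset.range (j + 1 - w) with hI
  have hcone : X.coneSum e j v = ∑ s ∈ I, t s := by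
    rw [coneSum, hI, Finset.sum_sigma]
  have hinj : ∀ φ : ℤ × ℤ → (_ : ℕ) × ℕ, Set.InjOn φ X.pairs → (∀ kk ∈ X.pairs, φ kk ∈ I) →
      ∑ kk ∈ X.pairs, t (φ kk) ≤ X.coneSum e j v := by
    intro φ h1 h2
    rw [hcone, ← Finset.sum_image h1]
    refine Finset.sum_le_sum_of_subset_of_nonneg ?_ fun s _ _ => ht0 s
    intro s hs
    obtain ⟨kk, hkk, rfl⟩ := Finset.mem_image.mp hs
    exact h2 kk hkk
  have hmem : ∀ kk ∈ X.pairs, kk.1 ≤ kk.2 ∧ kk.2 - kk.1 < X.ξ ∧ v ≤ kk.1 * m ∧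
      kk.2 * m + m ≤ v + (j + 1) * m := by
    intro kk hkk
    rw [pairs, Set.Finite.mem_toFinset] at hkk
    obtain ⟨h1, h2, h3, h4⟩ := hkk
    have h5 := X.backwardIndices_bound hm h1
    have h6 := X.backwardIndices_bound hm h2
    refine ⟨h3, h4, h5.1, ?_⟩
    have h7 := h6.2
    change kk.2 * m + m ≤ u + m + j * h at h7
    rw [hv]
    nlinarith
  have hcoef : ∀ w : ℕ, w ≤ j → ∀ y : ℝ, ((2 : ℝ) ^ m) ^ (j + 1) *
      ((((2 : ℝ) ^ m) ^ (w + 1))⁻¹ * y) = ((2 : ℝ) ^ m) ^ (j - w) * y := by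
    intro w hw y
    rw [← mul_assoc]
    congr 1
    rw [show j + 1 = (j - w) + (w + 1) by omega, pow_add]
    field_simp
  have hc0 := X.coneSum_nonneg he j v
  obtain ⟨k₀, hk₀⟩ := X.exists_blockStart_zero hm j X.layer.2 X.block
  change v = _ at hk₀
  simp only [blockStart, layerShift] at hk₀
  -- According to whether the first layer is displaced against the groups `S_k`.
  split_ifs at hk₀ with hE
  · rw [Nat.cast_zero, add_zero] at hk₀
    refine le_trans ?_ (show X.coneSum e j v ≤ _ by nlinarith)
    refine le_trans (Finset.sum_le_sum fun kk hkk => ?_)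
      (hinj (fun kk => ⟨(kk.2 - kk.1).toNat, (kk.1 - k₀).toNat⟩) ?_ ?_)
    · obtain ⟨h1, h2, h3, h4⟩ := hmem kk hkk
      have h5 : k₀ ≤ kk.1 := by
        by_contra hcon
        nlinarith
      have h6 : kk.2 - k₀ ≤ j := by
        by_contra hcon
        nlinarith
      rw [hcoef _ (by omega)]
      simp only [ht]
      rw [if_pos (by omega), Int.toNat_of_nonneg (show 0 ≤ kk.1 - k₀ by omega), hk₀,
        show k₀ * (m : ℤ) + (kk.1 - k₀) * m = kk.1 * m by ring]
    · intro kk hkk kk' hkk' heq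
      obtain ⟨h1, h2, h3, h4⟩ := hmem kk hkk
      obtain ⟨h1', h2', h3', h4'⟩ := hmem kk' hkk'
      have h5 : k₀ ≤ kk.1 := by
        by_contra hcon
        nlinarith
      have h5' : k₀ ≤ kk'.1 := by
        by_contra hcon
        nlinarith
      simp only [Sigma.mk.injEq, heq_eq_eq] at heq
      ext <;> omega
    · intro kk hkk
      obtain ⟨h1, h2, h3, h4⟩ := hmem kk hkk
      have h5 : k₀ ≤ kk.1 := by
        by_contra hcon
        nlinarith
      have h6 : kk.2 - k₀ ≤ j := by
        by_contra hcon
        nlinarith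
      simp only [hI, Finset.mem_sigma, Finset.mem_range]
      omega
  · have h2h : m / 2 = h := by omega
    have hh : (0 : ℤ) < h := by linarith
    rw [h2h] at hk₀
    have hmem' : ∀ kk ∈ X.pairs, kk.1 ≤ kk.2 ∧ kk.2 - kk.1 < X.ξ ∧ k₀ + 1 ≤ kk.1 ∧
        kk.2 - k₀ ≤ j := by
      intro kk hkk
      obtain ⟨h1, h2, h3, h4⟩ := hmem kk hkk
      refine ⟨h1, h2, ?_, ?_⟩
      · by_contra hcon
        have : kk.1 ≤ k₀ := by omega
        nlinarith
      · by_contra hcon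
        have : j + 1 + k₀ ≤ kk.2 := by omega
        nlinarith
    -- Displaced case: the groups lie in a window wider by one block that starts half a block
    -- earlier.
    have hA := hinj (fun kk => ⟨(kk.2 - kk.1).toNat + 1, (kk.1 - k₀ - 1).toNat⟩) ?_ ?_
    have hB := hinj (fun kk => ⟨(kk.2 - kk.1).toNat, (kk.1 - k₀ - 1).toNat⟩) ?_ ?_
    · refine le_trans ?_ (show (2 : ℝ) ^ m * X.coneSum e j v + X.coneSum e j v ≤ _ by linarith)
      refine le_trans ?_ (add_le_add (mul_le_mul_of_nonneg_left hA hD.le) hB)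
      rw [Finset.mul_sum, ← Finset.sum_add_distrib]
      refine Finset.sum_le_sum fun kk hkk => ?_
      obtain ⟨h1, h2, h3, h4⟩ := hmem' kk hkk
      rw [hcoef _ (by omega)]
      set w := (kk.2 - kk.1).toNat with hw
      set a := (kk.1 - k₀ - 1).toNat with ha
      have haz : (a : ℤ) = kk.1 - k₀ - 1 := Int.toNat_of_nonneg (by omega)
      have hst : kk.1 * m = v + a * m + h := by
        rw [hk₀, haz]
        linear_combination hmz
      by_cases hwξ : w + 1 < X.ξ
      · refine le_trans ?_ (le_add_of_nonneg_right (ht0 _))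
        simp only [ht]
        rw [if_pos hwξ, ← mul_assoc, ← pow_succ', show j - (w + 1) + 1 = j - w by omega]
        refine mul_le_mul_of_nonneg_left (mass_mono he fun P hP => ⟨hP.1.mono ?_ ?_, hP.2⟩)
          (by positivity)
        · rw [hst]
          linarith
        · rw [hst]
          push_cast
          linarith
      -- Here the groups fill the ring. No wider window is available, but a window of `ξ` displaced
      -- blocks already contains every string.
      · refine le_trans ?_ (le_add_of_nonneg_left (mul_nonneg hD.le (ht0 _)))
        have hw1 : w + 1 = X.ξ := by omega
        simp only [ht]
        rw [if_pos (by omega), hw1]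
        refine mul_le_mul_of_nonneg_left (mass_mono he fun P hP =>
          ⟨X.suppIn_ring P _, hP.2⟩) (by positivity)
    · intro kk hkk kk' hkk' heq
      obtain ⟨h1, h2, h3, h4⟩ := hmem' kk hkk
      obtain ⟨h1', h2', h3', h4'⟩ := hmem' kk' hkk'
      simp only [Sigma.mk.injEq, heq_eq_eq] at heq
      ext <;> omega
    · intro kk hkk
      obtain ⟨h1, h2, h3, h4⟩ := hmem' kk hkk
      simp only [hI, Finset.mem_sigma, Finset.mem_range]
      omega
    · intro kk hkk kk' hkk' heq
      obtain ⟨h1, h2, h3, h4⟩ := hmem' kk hkk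
      obtain ⟨h1', h2', h3', h4'⟩ := hmem' kk' hkk'
      simp only [Sigma.mk.injEq, heq_eq_eq] at heq
      ext <;> omega
    · intro kk hkk
      obtain ⟨h1, h2, h3, h4⟩ := hmem' kk hkk
      simp only [hI, Finset.mem_sigma, Finset.mem_range]
      omega

end Setting

/-! ### The matrices of a single qubit -/

/-- The Pauli matrices over the Gaussian integers. -/
def gaussPauli : Fin 4 → Matrix (Fin 2) (Fin 2) GaussianInt :=
  ![1, !![0, 1; 1, 0], !![0, ⟨0, -1⟩; ⟨0, 1⟩, 0], !![1, 0; 0, -1]]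

/-- The matrices `1, -iX, -iY, -iZ` over the Gaussian integers. -/
def gaussGen (μ : Fin 4) : Matrix (Fin 2) (Fin 2) GaussianInt :=
  if μ = 0 then gaussPauli 0 else (⟨0, -1⟩ : GaussianInt) • gaussPauli μ

/-- Four times the entries of the matrix `S` of a general gate on a single qubit, for a pair of
Pauli matrices. -/
def pauliTable (a b μ ν : Fin 4) : ℤ :=
  (gaussPauli a * ((gaussGen μ)ᴴ * gaussPauli b * gaussGen ν +
    (gaussGen ν)ᴴ * gaussPauli b * gaussGen μ)).trace.re

theorem pauli_eq_map (a : Fin 4) : pauli a = (gaussPauli a).map GaussianInt.toComplex := by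
  fin_cases a <;> ext i j <;> fin_cases i <;> fin_cases j <;>
    simp [pauli, gaussPauli, GaussianInt.toComplex_def]

theorem fqs_gen_eq_map (μ : Fin 4) :
    Optimizer.fqs.gen μ = (gaussGen μ).map GaussianInt.toComplex := by
  fin_cases μ <;> ext i j <;> fin_cases i <;> fin_cases j <;>
    simp [Optimizer.gen, pauli, gaussPauli, gaussGen, GaussianInt.toComplex_def]

/-- All entries are Gaussian integers, so the traces are integers that kernel computation can
evaluate. -/
theorem trace_fqs_gen (a b μ ν : Fin 4) :
    (pauli a * ((Optimizer.fqs.gen μ)ᴴ * pauli b * Optimizer.fqs.gen ν +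
      (Optimizer.fqs.gen ν)ᴴ * pauli b * Optimizer.fqs.gen μ)).trace.re = pauliTable a b μ ν := by
  have hstar : ∀ A : Matrix (Fin 2) (Fin 2) GaussianInt,
      (A.map GaussianInt.toComplex)ᴴ = Aᴴ.map GaussianInt.toComplex := fun A => by
    ext i j
    simp [Matrix.conjTranspose_apply, GaussianInt.toComplex_star]
  rw [pauli_eq_map, pauli_eq_map, fqs_gen_eq_map, fqs_gen_eq_map, hstar, hstar,
    ← Matrix.map_mul, ← Matrix.map_mul, ← Matrix.map_mul, ← Matrix.map_mul,
    ← Matrix.map_add _ (map_add _), ← Matrix.map_mul, ← AddMonoidHom.map_trace]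
  simp [pauliTable]

/-- The integers are `16` times the centered entries: `4` from the table and `4` from `p`. The value
`36` is `2(p+2)(p-1)` at `p = 4`. -/
theorem sum_fqs : ∑ a, ∑ b, ∑ μ, ∑ ν, (4 * pauliTable a b μ ν -
    if μ = ν then ∑ κ, pauliTable a b κ κ else 0) ^ 2 = 36 * 16 * 16 := by
  decide +kernel

/-- The same with scale `12`, whose square is `16 * 9`; the value `20` is `2(p+2)(p-1)` at `p = 3`.
-/
theorem sum_fraxis : ∑ a, ∑ b, ∑ μ : Fin 3, ∑ ν : Fin 3, (3 * pauliTable a b μ.succ ν.succ -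
    if μ = ν then ∑ κ : Fin 3, pauliTable a b κ.succ κ.succ else 0) ^ 2 = 20 * 16 * 9 := by
  decide +kernel

/-- A closed form for the case of a real rotation axis, where the sum is a polynomial in the axis
and not a finite check. -/
theorem pauliTable_eq (a b μ ν : Fin 4) : pauliTable a b μ ν =
    4 * (if (a = b ∧ μ = ν) then (if a = 0 then 1 else if μ = 0 ∨ μ = a then 1 else -1)
    else if a = 0 ∨ b = 0 ∨ a = b ∨ μ = ν then 0
    else if (μ = a ∧ ν = b) ∨ (μ = b ∧ ν = a) then 1
    else if μ = 0 ∨ ν = 0 then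
      (if μ ≠ a ∧ μ ≠ b ∧ ν ≠ a ∧ ν ≠ b then
        (if (a = 1 ∧ b = 2) ∨ (a = 2 ∧ b = 3) ∨ (a = 3 ∧ b = 1) then 1 else -1) else 0)
    else 0) := by
  revert a b μ ν
  decide +kernel

namespace Optimizer

/-- The matrix `S` of a single qubit, for a pair of Pauli matrices. -/
noncomputable def pauliQuad (o : Optimizer) (a b : Fin 4) : Matrix (Fin o.p) (Fin o.p) ℝ :=
  Matrix.of fun μ ν => (pauli a * ((o.gen μ)ᴴ * pauli b * o.gen ν +
    (o.gen ν)ᴴ * pauli b * o.gen μ)).trace.re / 4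

theorem pauliQuad_fqs (a b μ ν : Fin 4) :
    pauliQuad .fqs a b μ ν = (pauliTable a b μ ν : ℝ) / 4 := by
  rw [← trace_fqs_gen]
  rfl

theorem pauliQuad_fraxis (a b : Fin 4) (μ ν : Fin 3) :
    pauliQuad .fraxis a b μ ν = (pauliTable a b μ.succ ν.succ : ℝ) / 4 := by
  have hg : ∀ κ : Fin 3, Optimizer.fraxis.gen κ = Optimizer.fqs.gen κ.succ := by
    intro κ
    fin_cases κ <;> rfl
  rw [← trace_fqs_gen, ← hg, ← hg]
  rfl

theorem nft_gen_zero (n : EuclideanSpace ℝ (Fin 3)) (hn : ‖n‖ = 1) :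
    (Optimizer.nft n hn).gen (0 : Fin 2) = Optimizer.fqs.gen (0 : Fin 4) := rfl

theorem nft_gen_one (n : EuclideanSpace ℝ (Fin 3)) (hn : ‖n‖ = 1) :
    (Optimizer.nft n hn).gen (1 : Fin 2) = ∑ c : Fin 3, (n c : ℂ) • Optimizer.fqs.gen c.succ := by
  rw [Fin.sum_univ_three]
  change -Complex.I • ((n 0 : ℂ) • pauli 1 + (n 1 : ℂ) • pauli 2 + (n 2 : ℂ) • pauli 3) =
    (n 0 : ℂ) • (-Complex.I • pauli 1) + (n 1 : ℂ) • (-Complex.I • pauli 2) +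
      (n 2 : ℂ) • (-Complex.I • pauli 3)
  simp only [smul_add, smul_smul, mul_comm]

theorem pauliQuad_nft_zero_zero (n : EuclideanSpace ℝ (Fin 3)) (hn : ‖n‖ = 1) (a b : Fin 4) :
    pauliQuad (.nft n hn) a b (0 : Fin 2) (0 : Fin 2) = (pauliTable a b 0 0 : ℝ) / 4 := by
  rw [← trace_fqs_gen]
  rfl

theorem pauliQuad_comm (o : Optimizer) (a b : Fin 4) (μ ν : Fin o.p) :
    pauliQuad o a b μ ν = pauliQuad o a b ν μ := by
  simp only [pauliQuad, Matrix.of_apply, add_comm]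

theorem pauliQuad_nft_zero_one (n : EuclideanSpace ℝ (Fin 3)) (hn : ‖n‖ = 1) (a b : Fin 4) :
    pauliQuad (.nft n hn) a b (0 : Fin 2) (1 : Fin 2) =
      (∑ c : Fin 3, n c * pauliTable a b 0 c.succ) / 4 := by
  change (pauli a * (((Optimizer.nft n hn).gen (0 : Fin 2))ᴴ * pauli b *
    (Optimizer.nft n hn).gen (1 : Fin 2) + ((Optimizer.nft n hn).gen (1 : Fin 2))ᴴ * pauli b *
    (Optimizer.nft n hn).gen (0 : Fin 2))).trace.re / 4 = _
  rw [nft_gen_zero, nft_gen_one]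
  simp only [← trace_fqs_gen,
    Fin.sum_univ_three, Matrix.conjTranspose_add, Matrix.conjTranspose_smul, Matrix.mul_add,
    Matrix.add_mul, Matrix.smul_mul, Matrix.mul_smul, Matrix.trace_add, Matrix.trace_smul,
    Complex.star_def, Complex.conj_ofReal, smul_eq_mul, Complex.add_re, Complex.re_ofReal_mul]
  ring

theorem pauliQuad_nft_one_one (n : EuclideanSpace ℝ (Fin 3)) (hn : ‖n‖ = 1) (a b : Fin 4) :
    pauliQuad (.nft n hn) a b (1 : Fin 2) (1 : Fin 2) =
      (∑ c : Fin 3, ∑ d : Fin 3, n c * n d * pauliTable a b c.succ d.succ) / 4 := by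
  change (pauli a * (((Optimizer.nft n hn).gen (1 : Fin 2))ᴴ * pauli b *
    (Optimizer.nft n hn).gen (1 : Fin 2) + ((Optimizer.nft n hn).gen (1 : Fin 2))ᴴ * pauli b *
    (Optimizer.nft n hn).gen (1 : Fin 2))).trace.re / 4 = _
  rw [nft_gen_one]
  simp only [← trace_fqs_gen,
    Fin.sum_univ_three, Matrix.conjTranspose_add, Matrix.conjTranspose_smul, Matrix.mul_add,
    Matrix.add_mul, Matrix.smul_mul, Matrix.mul_smul, Matrix.trace_add, Matrix.trace_smul,
    Complex.star_def, Complex.conj_ofReal, smul_eq_mul, Complex.add_re, Complex.re_ofReal_mul]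
  ring

theorem centered_eq_zero {p : ℕ} {S : Matrix (Fin p) (Fin p) ℝ} {s : ℝ}
    (h : ∀ μ ν, S μ ν = if μ = ν then s else 0) : centered S = 0 := by
  ext μ ν
  have hp : (p : ℝ) ≠ 0 := by
    have := μ.2
    exact_mod_cast (by omega : p ≠ 0)
  simp only [centered, Matrix.sub_apply, Matrix.smul_apply, Matrix.one_apply, Matrix.trace,
    Matrix.diag, h, if_true, Finset.sum_const, Finset.card_univ, Fintype.card_fin, nsmul_eq_mul,
    smul_eq_mul, Matrix.zero_apply]
  rw [mul_div_cancel_left₀ _ hp]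
  split_ifs <;> ring

/-- A pair of Pauli matrices one of which is the identity does not contribute to the centered
matrix. -/
theorem centered_pauliQuad_eq_zero (o : Optimizer) {a b : Fin 4} (h : a = 0 ∨ b = 0) :
    centered (pauliQuad o a b) = 0 := by
  -- With an identity letter the matrix is scalar, and centering removes it.
  have h0 : ∀ a b : Fin 4, a = 0 ∨ b = 0 → ∀ μ ν : Fin 4, pauliTable a b μ ν =
      if μ = ν then pauliTable a b 0 0 else 0 := by
    decide +kernel
  refine centered_eq_zero (s := (pauliTable a b 0 0 : ℝ) / 4) ?_
  match o with
  | .fqs =>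
    intro (μ : Fin 4) (ν : Fin 4)
    rw [pauliQuad_fqs, h0 a b h μ ν]
    change _ = @ite ℝ (μ = ν) (instDecidableEqFin 4 μ ν) _ _
    by_cases hμ : μ = ν
    · rw [if_pos hμ, if_pos hμ]
    · rw [if_neg hμ, if_neg hμ]
      simp
  | .fraxis =>
    intro (μ : Fin 3) (ν : Fin 3)
    rw [pauliQuad_fraxis, h0 a b h μ.succ ν.succ]
    change _ = @ite ℝ (μ = ν) (instDecidableEqFin 3 μ ν) _ _
    by_cases hμ : μ = ν
    · rw [if_pos (by rw [hμ]), if_pos hμ]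
    · rw [if_neg (by simpa using hμ), if_neg hμ]
      simp
  | .nft n hn =>
    have hsq : n 0 ^ 2 + n 1 ^ 2 + n 2 ^ 2 = 1 := by
      have := EuclideanSpace.norm_sq_eq n
      rw [hn, Fin.sum_univ_three] at this
      simpa using this.symm
    have h01 : pauliQuad (.nft n hn) a b (0 : Fin 2) (1 : Fin 2) = 0 := by
      rw [pauliQuad_nft_zero_one, Fin.sum_univ_three, h0 a b h 0 (Fin.succ 0),
        h0 a b h 0 (Fin.succ 1), h0 a b h 0 (Fin.succ 2)]
      simp
    have h11 : pauliQuad (.nft n hn) a b (1 : Fin 2) (1 : Fin 2) = (pauliTable a b 0 0 : ℝ) / 4 := by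
      have hd : ∀ c d : Fin 3, (pauliTable a b c.succ d.succ : ℝ) =
          if c = d then (pauliTable a b 0 0 : ℝ) else 0 := fun c d => by
        rw [h0 a b h]
        by_cases hc : c = d
        · simp [hc]
        · rw [if_neg hc, if_neg (by simpa using hc)]
          simp
      rw [pauliQuad_nft_one_one]
      simp only [hd, Fin.sum_univ_three]
      simp
      linear_combination (pauliTable a b 0 0 : ℝ) * hsq
    intro (μ : Fin 2) (ν : Fin 2)
    have h10 := pauliQuad_comm (.nft n hn) a b (1 : Fin 2) (0 : Fin 2)
    fin_cases μ <;> fin_cases ν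
    · exact pauliQuad_nft_zero_zero n hn a b
    · exact h01
    · exact h10.trans h01
    · exact h11

theorem centered_apply {p : ℕ} (S : Matrix (Fin p) (Fin p) ℝ) (μ ν : Fin p) :
    centered S μ ν = S μ ν - if μ = ν then (∑ κ, S κ κ) / p else 0 := by
  simp only [centered, Matrix.sub_apply, Matrix.smul_apply, Matrix.one_apply, Matrix.trace,
    Matrix.diag, smul_eq_mul]
  split_ifs <;> simp

/-- This constant accounts for the dependence on the gate type; for a rotation it does not depend on
the axis. -/
theorem sum_centered_pauliQuad (o : Optimizer) :
    ∑ a, ∑ b, ∑ μ, ∑ ν, centered (pauliQuad o a b) μ ν ^ 2 = 2 * ((o.p : ℝ) + 2) * (o.p - 1) := by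
  match o with
  | .fqs =>
    have h2 : ∀ a b (μ ν : Fin 4), centered (pauliQuad .fqs a b) μ ν =
        ((4 * pauliTable a b μ ν - if μ = ν then ∑ κ, pauliTable a b κ κ else 0 : ℤ) : ℝ) / 16 := by
      intro a b μ ν
      refine (centered_apply (p := 4) _ μ ν).trans ?_
      simp only [pauliQuad_fqs, ← Finset.sum_div]
      split_ifs <;> push_cast <;> ring
    have h3 := congrArg (Int.cast (R := ℝ)) sum_fqs
    change ∑ a, ∑ b, ∑ μ : Fin 4, ∑ ν : Fin 4, centered (pauliQuad .fqs a b) μ ν ^ 2 =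
      2 * (((4 : ℕ) : ℝ) + 2) * ((4 : ℕ) - 1)
    simp only [h2, div_pow, ← Finset.sum_div]
    rw [div_eq_iff (by norm_num)]
    push_cast at h3 ⊢
    rw [h3]
    norm_num
  | .fraxis =>
    have h2 : ∀ a b (μ ν : Fin 3), centered (pauliQuad .fraxis a b) μ ν =
        ((3 * pauliTable a b μ.succ ν.succ -
          if μ = ν then ∑ κ : Fin 3, pauliTable a b κ.succ κ.succ else 0 : ℤ) : ℝ) / 12 := by
      intro a b μ ν
      refine (centered_apply (p := 3) _ μ ν).trans ?_
      simp only [pauliQuad_fraxis, ← Finset.sum_div]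
      split_ifs <;> push_cast <;> ring
    have h3 := congrArg (Int.cast (R := ℝ)) sum_fraxis
    change ∑ a, ∑ b, ∑ μ : Fin 3, ∑ ν : Fin 3, centered (pauliQuad .fraxis a b) μ ν ^ 2 =
      2 * (((3 : ℕ) : ℝ) + 2) * ((3 : ℕ) - 1)
    simp only [h2, div_pow, ← Finset.sum_div]
    rw [div_eq_iff (by norm_num)]
    push_cast at h3 ⊢
    rw [h3]
    norm_num
  | .nft n hn =>
    have hsq : n 0 ^ 2 + n 1 ^ 2 + n 2 ^ 2 = 1 := by
      have := EuclideanSpace.norm_sq_eq n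
      rw [hn, Fin.sum_univ_three] at this
      simpa using this.symm
    -- The squared Frobenius norm of the traceless part of a symmetric `2 × 2` matrix.
    have h2 : ∀ a b, ∑ μ : Fin 2, ∑ ν : Fin 2, centered (pauliQuad (.nft n hn) a b) μ ν ^ 2 =
        (pauliQuad (.nft n hn) a b (0 : Fin 2) (0 : Fin 2) -
          pauliQuad (.nft n hn) a b (1 : Fin 2) (1 : Fin 2)) ^ 2 / 2 +
        2 * pauliQuad (.nft n hn) a b (0 : Fin 2) (1 : Fin 2) ^ 2 := by
      intro a b
      have hc : ∀ μ ν : Fin 2, centered (pauliQuad (.nft n hn) a b) μ ν =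
          pauliQuad (.nft n hn) a b μ ν - if μ = ν then
            (∑ κ : Fin 2, pauliQuad (.nft n hn) a b κ κ) / (2 : ℕ) else 0 :=
        fun μ ν => centered_apply (p := 2) _ μ ν
      have h10 := pauliQuad_comm (.nft n hn) a b (1 : Fin 2) (0 : Fin 2)
      simp only [hc, Fin.sum_univ_two, h10]
      simp
      ring
    change ∑ a, ∑ b, ∑ μ : Fin 2, ∑ ν : Fin 2, centered (pauliQuad (.nft n hn) a b) μ ν ^ 2 =
      2 * (((2 : ℕ) : ℝ) + 2) * ((2 : ℕ) - 1)
    simp only [h2, pauliQuad_nft_zero_zero, pauliQuad_nft_zero_one, pauliQuad_nft_one_one,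
      Fin.sum_univ_three, Fin.sum_univ_four, pauliTable_eq]
    simp
    ring_nf
    -- The sum is `2(s + 1)²` with `s` the squared length of the axis, and `2(s + 1)² - 8 = (2s +
    -- 6)(s - 1)`.
    linear_combination (2 * (n 0 ^ 2 + n 1 ^ 2 + n 2 ^ 2) + 6) * hsq

end Optimizer

/-! ### The spectral radius of a symmetric matrix -/

/-- For a self-adjoint operator the spectral radius is the operator norm, which makes it continuous
in the matrix. -/
theorem spectralRadius_eq_norm {p : ℕ} {S : Matrix (Fin p) (Fin p) ℝ} (hS : S.IsHermitian) :
    (spectralRadius ℝ S).toReal = ‖Matrix.toEuclideanCLM (𝕜 := ℝ) S‖ := by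
  have hsa : IsSelfAdjoint (Matrix.toEuclideanCLM (𝕜 := ℝ) S) :=
    (show IsSelfAdjoint S from hS).map (Matrix.toEuclideanCLM (n := Fin p) (𝕜 := ℝ))
  have h1 := ContinuousLinearMap.spectralRadius_eq_nnnorm _ hsa
  rw [spectralRadius, AlgEquiv.spectrum_eq, ← spectralRadius] at h1
  rw [h1]
  rfl

/-- Each of the `p` columns is the image of a unit vector and has Euclidean norm at most the
operator norm. -/
theorem sum_sq_le_spectralRadius {p : ℕ} {S : Matrix (Fin p) (Fin p) ℝ} (hS : S.IsHermitian) :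
    ∑ μ, ∑ ν, S μ ν ^ 2 ≤ p * (spectralRadius ℝ S).toReal ^ 2 := by
  rw [spectralRadius_eq_norm hS, Finset.sum_comm]
  have h1 : ∀ ν, ∑ μ, S μ ν ^ 2 ≤ ‖Matrix.toEuclideanCLM (𝕜 := ℝ) S‖ ^ 2 := fun ν => by
    have h2 := (Matrix.toEuclideanCLM (𝕜 := ℝ) S).le_opNorm (EuclideanSpace.single ν 1)
    rw [PiLp.norm_single, norm_one, mul_one] at h2
    have h3 := pow_le_pow_left₀ (norm_nonneg _) h2 2
    rw [EuclideanSpace.norm_sq_eq] at h3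
    refine le_trans (le_of_eq (Finset.sum_congr rfl fun μ _ => ?_)) h3
    rw [Matrix.ofLp_toEuclideanCLM]
    simp
  refine (Finset.sum_le_sum fun ν _ => h1 ν).trans (le_of_eq ?_)
  simp

theorem continuous_spectralRadius {p : ℕ} {α : Type} [TopologicalSpace α]
    {S : α → Matrix (Fin p) (Fin p) ℝ} (hS : Continuous S) (hS' : ∀ a, (S a).IsHermitian) :
    Continuous fun a => (spectralRadius ℝ (S a)).toReal := by
  simp only [fun a => spectralRadius_eq_norm (hS' a)]
  have h : Continuous (Matrix.toEuclideanCLM (n := Fin p) (𝕜 := ℝ)).toAlgEquiv.toLinearMap :=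
    LinearMap.continuous_of_finiteDimensional _
  exact (h.comp hS).norm

namespace Setting

variable {m : ℕ} [NeZero m] (X : Setting m)

/-! ### The terms of the Hamiltonian in the forward light-cone -/

/-- The Pauli term `h_i` as a string on the ring. -/
noncomputable def termString (i : Fin X.N) : Qubit X.ξ m → Fin 4 :=
  Function.extend (fun a : Fin m => X.start i + ((a : ℕ) : Qubit X.ξ m)) (X.h i) 0

theorem injective_window (s : Qubit X.ξ m) :
    Function.Injective fun a : Fin m => s + ((a : ℕ) : Qubit X.ξ m) := by
  intro a b hab
  have h1 : ((a : ℕ) : Qubit X.ξ m) = ((b : ℕ) : Qubit X.ξ m) := add_left_cancel hab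
  have hle : m ≤ X.ξ * m := Nat.le_mul_of_pos_left _ (Nat.pos_of_ne_zero (NeZero.ne X.ξ))
  have h2 : (((a : ℕ) : ℤ) : ZMod (X.ξ * m)) = (((b : ℕ) : ℤ) : ZMod (X.ξ * m)) := by
    exact_mod_cast h1
  have h3 := eq_of_intCast_eq h2 (by have := a.2; omega) (by have := b.2; omega)
  exact Fin.ext (by exact_mod_cast h3)

theorem onQubits_term (i : Fin X.N) :
    onQubits (fun a : Fin m => X.start i + ((a : ℕ) : Qubit X.ξ m)) (pauliString (X.h i)) =
      pauliString (X.termString i) :=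
  onQubits_pauliString (X.injective_window _) _

theorem termString_injective : Function.Injective X.termString := by
  intro i i' h
  refine X.h_injective ?_
  simp only [onQubits_term, h]

theorem termString_eq_zero_iff (i : Fin X.N) : X.termString i = 0 ↔ X.h i = 0 :=
  extend_eq_zero_iff (X.injective_window _) _

theorem suppIn_termString {i : Fin X.N} {z a b : ℤ} (hz : (z : Qubit X.ξ m) = X.start i)
    (h : ∀ t : Fin m, X.h i t ≠ 0 → a ≤ z + (t : ℕ) ∧ z + (t : ℕ) < b) :
    SuppIn (X.termString i) a b := by
  intro q hq
  by_cases hr : ∃ t : Fin m, X.start i + ((t : ℕ) : Qubit X.ξ m) = q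
  · obtain ⟨t, rfl⟩ := hr
    rw [termString, (X.injective_window _).extend_apply] at hq
    refine ⟨z + (t : ℕ), (h t hq).1, (h t hq).2, ?_⟩
    push_cast
    rw [hz]
  · rw [termString, Function.extend_apply' _ _ _ hr] at hq
    exact absurd rfl hq

/-- The blocks of the last layer that meet the forward light-cone are close to its apex. -/
theorem blockStart_last_near {h : ℕ} (hm : m = h + h) {J : ℕ} (hJ : (X.layer : ℕ) + J + 1 = X.L)
    {z k : ℤ} (hz : z ∈ coneSites m (forwardCone m X.target))
    (hk : X.blockStart ⟨X.layer + J, by omega⟩ k ≤ z)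
    (hk' : z < X.blockStart ⟨X.layer + J, by omega⟩ k + m) :
    X.blockStart ⟨X.layer + J, by omega⟩ k - X.blockStart X.layer X.block ≤ J * h ∧
      X.blockStart X.layer X.block - X.blockStart ⟨X.layer + J, by omega⟩ k ≤ J * h := by
  have hmz : (m : ℤ) = h + h := by exact_mod_cast hm
  have hh : (0 : ℤ) < h := by
    have := NeZero.ne m
    omega
  simp only [coneSites, Set.mem_iUnion] at hz
  obtain ⟨b, hb, hzb⟩ := hz
  obtain ⟨h1, h2, h3⟩ := X.blockStart_sub_le hm hb
  have hzb1 : X.blockStart b.1 b.2 ≤ z ∧ z < X.blockStart b.1 b.2 + m := hzb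
  have hbL := b.1.2
  have hb1 : (((b.1 : ℕ) : ℤ) - (X.layer : ℕ)) * h ≤ J * h :=
    mul_le_mul_of_nonneg_right (by omega) hh.le
  change X.blockStart b.1 b.2 - X.blockStart X.layer X.block ≤ _ * _ at h2
  change X.blockStart X.layer X.block - X.blockStart b.1 b.2 ≤ _ * _ at h3
  change _ ≤ (((b.1 : ℕ) : ℤ) - (X.layer : ℕ)) * h at h2
  change _ ≤ (((b.1 : ℕ) : ℤ) - (X.layer : ℕ)) * h at h3
  -- Overlap with a cone block gives distance below `(J + 2) h`; as the distance is a multiple of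
  -- `h` with the parity of `J`, it is at most `J h`.
  have h4 : X.blockStart ⟨X.layer + J, by omega⟩ k - X.blockStart X.layer X.block < (J + 2) * h := by
    linarith
  have h5 : X.blockStart X.layer X.block - X.blockStart ⟨X.layer + J, by omega⟩ k < (J + 2) * h := by
    linarith
  obtain ⟨t, ht⟩ : ∃ t : ℤ, X.blockStart ⟨X.layer + J, by omega⟩ k -
      X.blockStart X.layer X.block = (J + 2 * t) * h := by
    have e1 : X.L - 1 - ((X.layer : ℕ) + J) = 0 := by omega
    have e2 : X.L - 1 - (X.layer : ℕ) = J := by omega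
    simp only [blockStart, layerShift, e1, e2, Even.zero, if_true]
    rcases Nat.even_or_odd J with hE | hO
    · obtain ⟨r, hr⟩ := id hE
      refine ⟨k - (X.block : ℕ) - r, ?_⟩
      rw [if_pos hE, hr]
      push_cast
      linear_combination (k - (X.block : ℕ)) * hmz
    · obtain ⟨r, hr⟩ := id hO
      refine ⟨k - (X.block : ℕ) - r - 1, ?_⟩
      have : m / 2 = h := by omega
      rw [if_neg (Nat.not_even_iff_odd.mpr hO), this, hr]
      push_cast
      linear_combination (k - (X.block : ℕ)) * hmz
  rw [ht] at h4
  have h5' : (-((J : ℤ) + 2)) * h < (J + 2 * t) * h := by linarith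
  have h6 := lt_of_mul_lt_mul_right h4 hh.le
  have h7 := lt_of_mul_lt_mul_right h5' hh.le
  have h8 : ((J : ℤ) + 2 * t) * h ≤ J * h := mul_le_mul_of_nonneg_right (by omega) hh.le
  have h9 : (-(J : ℤ)) * h ≤ (J + 2 * t) * h := mul_le_mul_of_nonneg_right (by omega) hh.le
  constructor <;> linarith

/-- The active sites of `h_i` meet one or two blocks of the last layer. If one, a path ends there
after `J` factors. If two, the path ends one layer earlier at the block below both, and the last
layer pays for both halves, `J + 1` factors in total. -/
theorem le_of_mem_forwardTerms {h : ℕ} (hm : m = h + h) {e : ℕ → (Qubit X.ξ m → Fin 4) → ℝ}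
    (he : ∀ j Q, 0 ≤ e j Q)
    (hrec : ∀ (J : ℕ) (hJ : (X.layer : ℕ) + J + 1 < X.L) P,
      e (J + 1) P = ∑ Q, X.kernel ⟨X.layer + J + 1, hJ⟩ Q P * e J Q)
    (hc : ∀ Q : Qubit X.ξ m → Fin 4, Q ≠ 0 → SuppIn Q (X.blockStart X.layer X.block)
      (X.blockStart X.layer X.block + m) → 1 ≤ e 0 Q)
    {J : ℕ} (hJ : (X.layer : ℕ) + J + 1 = X.L) {i : Fin X.N} (hi : i ∈ X.forwardTerms)
    (hne : X.h i ≠ 0) :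
    (((2 : ℝ) ^ m + 1) ^ (J + 1))⁻¹ ≤ e J (X.termString i) := by
  have hmz : (m : ℤ) = h + h := by exact_mod_cast hm
  have hm0 : (0 : ℤ) < m := by exact_mod_cast Nat.pos_of_ne_zero (NeZero.ne m)
  have hD : (1 : ℝ) ≤ (2 : ℝ) ^ m + 1 := by
    have : (0 : ℝ) < 2 ^ m := by positivity
    linarith
  simp only [forwardTerms, Finset.mem_filter, Finset.mem_univ, true_and] at hi
  obtain ⟨z, hz, hcone⟩ := hi
  have hP : X.termString i ≠ 0 := fun h0 => hne ((X.termString_eq_zero_iff i).mp h0)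
  set u := X.blockStart X.layer X.block with hu
  have hlast : ∀ k : ℤ, X.blockStart ⟨X.layer + J, by omega⟩ k = k * m := fun k => by
    have e1 : X.L - 1 - ((X.layer : ℕ) + J) = 0 := by omega
    simp [blockStart, layerShift, e1]
  have hnear := fun (z k : ℤ) (hz : z ∈ coneSites m (forwardCone m X.target)) h1 h2 =>
    X.blockStart_last_near hm hJ (z := z) (k := k) hz h1 h2
  simp only [hlast] at hnear
  set k := z / m with hk
  have hk1 : k * m ≤ z := Int.ediv_mul_le _ hm0.ne'
  have hk2 : z < k * m + m := by
    have := Int.lt_ediv_add_one_mul_self z hm0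
    linarith
  -- all sites on which the term acts non-trivially lie in one block
  have single : ∀ k' : ℤ, (∀ t : Fin m, X.h i t ≠ 0 →
      k' * m ≤ z + (t : ℕ) ∧ z + (t : ℕ) < k' * m + m) →
      (((2 : ℝ) ^ m + 1) ^ (J + 1))⁻¹ ≤ e J (X.termString i) := by
    intro k' hk'
    obtain ⟨t, ht⟩ := Function.ne_iff.mp hne
    have h1 := hnear _ k' (hcone t ht) (hk' t ht).1 (hk' t ht).2
    have h2 := X.le_forward hm he hrec (u := u) (c := 1) zero_le_one hc X.layer.2 ⟨_, rfl⟩ J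
      (by omega) (k := k') (by rw [hlast]; exact h1.1) (by rw [hlast]; exact h1.2) hP
      (by rw [hlast]; exact X.suppIn_termString hz hk')
    rw [mul_one] at h2
    refine le_trans ?_ h2
    gcongr
    omega
  by_cases hA : ∀ t : Fin m, X.h i t ≠ 0 → z + (t : ℕ) < k * m + m
  · exact single k fun t ht => ⟨by omega, hA t ht⟩
  by_cases hB : ∀ t : Fin m, X.h i t ≠ 0 → k * m + m ≤ z + (t : ℕ)
  · refine single (k + 1) fun t ht => ⟨by linarith [hB t ht], ?_⟩
    have := t.2
    linarith [(by exact_mod_cast this : ((t : ℕ) : ℤ) < m)]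
  push Not at hA hB
  obtain ⟨t₁, ht₁, hA⟩ := hA
  obtain ⟨t₀, ht₀, hB⟩ := hB
  have ht₁m : ((t₁ : ℕ) : ℤ) < m := by exact_mod_cast t₁.2
  have h1 := hnear _ (k + 1) (hcone t₁ ht₁) (by linarith) (by linarith)
  have h0 := hnear _ k (hcone t₀ ht₀) (by omega) hB
  rw [add_mul, one_mul] at h1
  -- For `J = 0` the cone is the target block alone, which cannot meet two blocks of its own layer.
  obtain ⟨J, rfl⟩ : ∃ J', J = J' + 1 := by
    refine ⟨J - 1, ?_⟩
    have : J ≠ 0 := by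
      rintro rfl
      simp only [Nat.cast_zero, zero_mul] at h1 h0
      omega
    omega
  obtain ⟨k', -, hk'⟩ := X.exists_blockStart_pred hm (j := X.layer + J) (by omega) k
  have hl' : ∀ k, X.blockStart ⟨X.layer + J + 1, by omega⟩ k = k * m := hlast
  rw [hl'] at hk'
  have hv1 : k * m + h - u ≤ J * h := by
    have := h1.1
    push_cast at this
    linarith
  have hv2 : u - (k * m + h) ≤ J * h := by
    have := h0.2
    push_cast at this
    linarith
  have h2 := X.le_of_suppIn hm he hrec (J := J) (by omega) hP (k := k) (w := 2)
    (by
      rw [hl']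
      refine X.suppIn_termString hz fun t _ => ⟨by omega, ?_⟩
      have : ((t : ℕ) : ℤ) < m := by exact_mod_cast t.2
      push_cast
      linarith)
    (v := k * m + h) (c := (((2 : ℝ) ^ m + 1) ^ J)⁻¹) (by positivity)
    (fun Q hQ hs => by
      have := X.le_forward hm he hrec (u := u) (c := 1) zero_le_one hc X.layer.2 ⟨_, rfl⟩ J
        (by omega) (k := k' + 1) (by rwa [← hk']) (by rwa [← hk']) hQ (by rwa [← hk'])
      rwa [mul_one] at this)
    {k, k + 1} (fun t h1 h2 => by
      rw [Finset.mem_insert, Finset.mem_singleton]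
      push_cast at h2
      omega)
    (fun t ht => by
      rw [Finset.mem_insert, Finset.mem_singleton] at ht
      rw [hl']
      rcases ht with rfl | rfl
      · exact Or.inr rfl
      · left
        linarith)
  refine le_trans (le_of_eq ?_) h2
  rw [Finset.card_pair (by omega), ← mul_inv, ← pow_add]
  congr 2
  omega

end Setting

/-! ### The matrix `S` in terms of Pauli coefficients -/

section Expansion

variable {ι : Type} [Fintype ι] [DecidableEq ι]

/-- The symmetrized conjugation in the definition of the matrix `S`. -/
def sandwich (A B M : Op ι) : Op ι := Aᴴ * M * B + Bᴴ * M * A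

theorem isHermitian_sandwich {M : Op ι} (hM : M.IsHermitian) (A B : Op ι) :
    (sandwich A B M).IsHermitian := by
  rw [Matrix.IsHermitian, sandwich, conjTranspose_add, conjTranspose_mul, conjTranspose_mul,
    conjTranspose_mul, conjTranspose_mul, hM.eq, conjTranspose_conjTranspose,
    conjTranspose_conjTranspose, add_comm]
  simp only [Matrix.mul_assoc]

theorem hs_sandwich (A B M N : Op ι) : hs N (sandwich A B M) = hs M (sandwich Aᴴ Bᴴ N) := by
  have h : ∀ A B : Op ι, (N * (Aᴴ * M * B)).trace = (M * (B * N * Aᴴ)).trace := fun A B => by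
    rw [Matrix.trace_mul_comm, Matrix.mul_assoc, Matrix.mul_assoc, Matrix.trace_mul_comm]
    simp only [Matrix.mul_assoc]
  simp only [hs, sandwich, Matrix.mul_add, Matrix.trace_add, h, conjTranspose_conjTranspose]
  rw [add_comm]

/-- The gate touches one qubit, so all other letters must agree and each contributes a trace `2`.
The prefactor compensates the `1/4` in `pauliQuad`. -/
theorem hs_sandwich_pauliString (o : Optimizer) (q : ι) (μ ν : Fin o.p) (R P : ι → Fin 4) :
    hs (pauliString R) (sandwich (onQubit q (o.gen μ)) (onQubit q (o.gen ν)) (pauliString P)) =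
      if ∀ i ≠ q, P i = R i then
        2 * 2 ^ Fintype.card ι * o.pauliQuad (R q) (P q) μ ν else 0 := by
  have h : ∀ A B : Matrix (Fin 2) (Fin 2) ℂ,
      (pauliString R * ((onQubit q A)ᴴ * pauliString P * onQubit q B)).trace =
      (if ∀ i ≠ q, P i = R i then 2 ^ (Fintype.card ι - 1) else 0) *
        (pauli (R q) * (Aᴴ * pauli (P q) * B)).trace := fun A B => by
    rw [onQubit_eq_ptens, onQubit_eq_ptens, pauliString_eq_ptens, pauliString_eq_ptens,
      conjTranspose_ptens, ptens_mul, ptens_mul, ptens_mul, trace_ptens,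
      ← Finset.prod_erase_mul _ _ (Finset.mem_univ q)]
    simp only [Function.update_self]
    congr 1
    have h1 : ∀ k ∈ Finset.univ.erase q, (pauli (R k) *
        ((Function.update (1 : ι → Matrix (Fin 2) (Fin 2) ℂ) q A k)ᴴ * pauli (P k) *
          Function.update (1 : ι → Matrix (Fin 2) (Fin 2) ℂ) q B k)).trace =
        if P k = R k then 2 else 0 := fun k hk => by
      rw [Function.update_of_ne (Finset.ne_of_mem_erase hk),
        Function.update_of_ne (Finset.ne_of_mem_erase hk)]
      simp [trace_pauli_mul, eq_comm]
    rw [Finset.prod_congr rfl h1, Finset.prod_ite_zero, Finset.prod_const,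
      Finset.card_erase_of_mem (Finset.mem_univ _), Finset.card_univ]
    simp
  have hcard : (2 : ℝ) ^ Fintype.card ι = 2 * 2 ^ (Fintype.card ι - 1) := by
    have : 0 < Fintype.card ι := Fintype.card_pos_iff.mpr ⟨q⟩
    rw [← pow_succ']
    congr 1
    omega
  rw [hs, sandwich, Matrix.mul_add, Matrix.trace_add, h, h, ← mul_add, ← Matrix.trace_add,
    ← Matrix.mul_add, hcard, Optimizer.pauliQuad, Matrix.of_apply]
  split_ifs
  · have : ((2 : ℂ) ^ (Fintype.card ι - 1)) = ((2 ^ (Fintype.card ι - 1) : ℝ) : ℂ) := by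
      push_cast
      rfl
    rw [this, Complex.re_ofReal_mul]
    ring
  · simp

theorem sum_update (q : ι) (R : ι → Fin 4) (f : (ι → Fin 4) → ℝ) :
    ∑ P : ι → Fin 4, (if ∀ i ≠ q, P i = R i then f P else 0) =
      ∑ b, f (Function.update R q b) := by
  rw [← Finset.sum_filter]
  symm
  refine Finset.sum_nbij' (fun b => Function.update R q b) (fun P => P q) ?_ ?_ ?_ ?_ ?_
  · intro b _
    rw [Finset.mem_filter]
    exact ⟨Finset.mem_univ _, fun i hi => Function.update_of_ne hi _ _⟩
  · intro P _
    exact Finset.mem_univ _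
  · intro b _
    exact Function.update_self _ _ _
  · intro P hP
    rw [Finset.mem_filter] at hP
    funext i
    by_cases hi : i = q
    · subst hi
      exact Function.update_self _ _ _
    · rw [Function.update_of_ne hi, hP.2 i hi]
  · intro b _
    rfl

/-- Expanding both operators in Pauli strings leaves pairs that differ at most in the letter on the
target qubit. -/
theorem quadMatrix_apply (o : Optimizer) (q : ι) {ρ H : Op ι} (hρ : ρ.IsHermitian)
    (hH : H.IsHermitian) (μ ν : Fin o.p) :
    quadMatrix ρ H (fun μ => onQubit q (o.gen μ)) μ ν = (2 ^ Fintype.card ι)⁻¹ *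
      ∑ R, ∑ b, hs (pauliString R) ρ * hs (pauliString (Function.update R q b)) H *
        o.pauliQuad (R q) b μ ν := by
  have hN : (2 : ℝ) ^ Fintype.card ι ≠ 0 := by positivity
  set A := onQubit q (o.gen μ) with hA
  set B := onQubit q (o.gen ν) with hB
  have h0 : quadMatrix ρ H (fun μ => onQubit q (o.gen μ)) μ ν = 1 / 2 * hs ρ (sandwich A B H) := by
    rw [quadMatrix, Matrix.of_apply, hs, sandwich]
    have : (1 / 2 : ℂ) = ((1 / 2 : ℝ) : ℂ) := by push_cast; rfl
    rw [this, Complex.re_ofReal_mul]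
  have h1 := hs_parseval hρ (isHermitian_sandwich hH A B)
  have h2 : ∀ R : ι → Fin 4, 2 ^ Fintype.card ι * hs (pauliString R) (sandwich A B H) =
      ∑ b, hs (pauliString (Function.update R q b)) H *
        (2 * 2 ^ Fintype.card ι * o.pauliQuad (R q) b μ ν) := fun R => by
    rw [hs_sandwich, ← hs_parseval hH (isHermitian_sandwich (isHermitian_pauliString R) _ _)]
    simp only [← hs_sandwich, hA, hB, hs_sandwich_pauliString, mul_ite, mul_zero]
    rw [sum_update q R fun P => hs (pauliString P) H *
      (2 * 2 ^ Fintype.card ι * o.pauliQuad (R q) (P q) μ ν)]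
    simp only [Function.update_self]
  have h3 : ∀ R : ι → Fin 4, hs (pauliString R) (sandwich A B H) =
      2 * ∑ b, hs (pauliString (Function.update R q b)) H * o.pauliQuad (R q) b μ ν := fun R => by
    refine mul_left_cancel₀ hN ((h2 R).trans ?_)
    rw [Finset.mul_sum, Finset.mul_sum]
    refine Finset.sum_congr rfl fun b _ => by ring
  rw [h0, eq_inv_mul_iff_mul_eq₀ hN, mul_left_comm, ← h1, Finset.mul_sum]
  refine Finset.sum_congr rfl fun R _ => ?_
  rw [h3]
  simp only [mul_assoc, ← Finset.mul_sum]
  ring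

theorem isHermitian_quadMatrix {p : ℕ} (ρ H : Op ι) (s : Fin p → Op ι) :
    (quadMatrix ρ H s).IsHermitian := by
  ext μ ν
  simp [quadMatrix, add_comm]

theorem isHermitian_centered {p : ℕ} {S : Matrix (Fin p) (Fin p) ℝ} (hS : S.IsHermitian) :
    (centered S).IsHermitian :=
  hS.sub (by
    rw [Matrix.IsHermitian, conjTranspose_smul, conjTranspose_one]
    rfl)

/-- Centering is linear, so it may be applied to the single-qubit matrices inside the expansion. -/
theorem centered_quadMatrix_apply (o : Optimizer) (q : ι) {ρ H : Op ι} (hρ : ρ.IsHermitian)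
    (hH : H.IsHermitian) (μ ν : Fin o.p) :
    centered (quadMatrix ρ H (fun μ => onQubit q (o.gen μ))) μ ν = (2 ^ Fintype.card ι)⁻¹ *
      ∑ R, hs (pauliString R) ρ * ∑ b, centered (o.pauliQuad (R q) b) μ ν *
        hs (pauliString (Function.update R q b)) H := by
  have hc : ∀ S : Matrix (Fin o.p) (Fin o.p) ℝ, centered S μ ν =
      S μ ν - if μ = ν then (∑ κ, S κ κ) / o.p else 0 := fun S => Optimizer.centered_apply S μ ν
  have hr : ∀ R : ι → Fin 4, ∀ F : Fin 4 → ℝ, ∑ b, hs (pauliString R) ρ *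
      hs (pauliString (Function.update R q b)) H * F b =
      hs (pauliString R) ρ * ∑ b, F b * hs (pauliString (Function.update R q b)) H :=
    fun R F => by
      rw [Finset.mul_sum]
      exact Finset.sum_congr rfl fun b _ => by ring
  simp only [hc, quadMatrix_apply o q hρ hH, hr]
  split_ifs with h
  · rw [← Finset.mul_sum, mul_div_assoc, ← mul_sub, Finset.sum_comm, Finset.sum_div,
      ← Finset.sum_sub_distrib]
    congr 1
    refine Finset.sum_congr rfl fun R _ => ?_
    rw [← Finset.mul_sum, mul_div_assoc, ← mul_sub, Finset.sum_comm, Finset.sum_div,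
      ← Finset.sum_sub_distrib]
    congr 1
    refine Finset.sum_congr rfl fun b _ => ?_
    rw [← Finset.sum_mul]
    ring
  · simp only [sub_zero]

/-- The sum of a function of one letter over all strings. -/
theorem sum_eval (q : ι) (f : Fin 4 → ℝ) :
    ∑ P : ι → Fin 4, f (P q) = 4 ^ (Fintype.card ι - 1) * ∑ a, f a := by
  have h := Finset.prod_univ_sum (fun _ : ι => (Finset.univ : Finset (Fin 4)))
    (fun i a => if i = q then f a else 1)
  rw [Fintype.piFinset_univ] at h
  have h1 : ∀ P : ι → Fin 4, ∏ i, (if i = q then f (P i) else 1) = f (P q) := fun P => by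
    rw [Finset.prod_ite_eq' Finset.univ q fun i => f (P i), if_pos (Finset.mem_univ _)]
  simp only [h1] at h
  rw [← h, ← Finset.prod_erase_mul _ _ (Finset.mem_univ q)]
  simp only [if_true]
  congr 1
  rw [Finset.prod_congr rfl fun i hi => by
    rw [show (∑ a, if i = q then f a else 1) = 4 by simp [Finset.ne_of_mem_erase hi]],
    Finset.prod_const, Finset.card_erase_of_mem (Finset.mem_univ _), Finset.card_univ]

theorem update_extend {κ : Type} [DecidableEq κ] {e : κ → ι} (he : Function.Injective e)
    (p : κ → Fin 4) (k : κ) (b : Fin 4) :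
    Function.update (Function.extend e p 0) (e k) b =
      Function.extend e (Function.update p k b) 0 := by
  funext i
  by_cases hi : ∃ k', e k' = i
  · obtain ⟨k', rfl⟩ := hi
    rw [he.extend_apply]
    by_cases hk : k' = k
    · subst hk
      simp
    · rw [Function.update_of_ne hk, Function.update_of_ne (he.ne hk), he.extend_apply]
  · rw [Function.extend_apply' _ _ _ hi, Function.update_of_ne, Function.extend_apply' _ _ _ hi]
    rintro rfl
    exact hi ⟨k, rfl⟩

end Expansion

namespace Setting

variable {m : ℕ} [NeZero m] (X : Setting m)

/-! ### Second moments of the Pauli coefficients before and after the target gate -/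

theorem isHermitian_H : X.H.IsHermitian := by
  have hs : ∀ (r : ℝ) {A : Op (Qubit X.ξ m)}, A.IsHermitian → ((r : ℂ) • A).IsHermitian :=
    fun r A hA => by
      rw [Matrix.IsHermitian, conjTranspose_smul, hA.eq, Complex.star_def, Complex.conj_ofReal]
  simp only [H, onQubits_term]
  refine (hs _ isHermitian_one).add ?_
  rw [Matrix.IsHermitian, conjTranspose_sum]
  exact Finset.sum_congr rfl fun i _ => hs _ (isHermitian_pauliString _)

theorem layerOp_conjTranspose_mul_self (g : X.Gates) (j : Fin X.L) :
    (X.layerOp g j)ᴴ * X.layerOp g j = 1 := by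
  have h1 := pauliString_eq_tensorOn (X.bijective_blockQubit j) 0
  rw [pauliString_zero] at h1
  rw [layerOp_eq_tensorOn, conjTranspose_tensorOn, tensorOn_mul (X.bijective_blockQubit j), h1]
  congr 1
  funext k
  rw [BlockUnitary.conjTranspose_mul_self]
  exact pauliString_zero.symm

theorem run_conjTranspose_mul_self (g : X.Gates) (i j : ℕ) :
    (X.run g i j)ᴴ * X.run g i j = 1 := by
  rw [run]
  generalize ((List.finRange X.L).filter fun t : Fin X.L => i ≤ (t : ℕ) ∧ (t : ℕ) < j).reverse = l
  induction l with
  | nil => simp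
  | cons a l ih =>
    rw [List.map_cons, List.prod_cons, conjTranspose_mul, Matrix.mul_assoc,
      ← Matrix.mul_assoc (X.layerOp g a)ᴴ, X.layerOp_conjTranspose_mul_self, Matrix.one_mul, ih]

theorem injective_blockQubit (j : Fin X.L) (k : Fin X.ξ) :
    Function.Injective (blockQubit X.ξ m X.L j k) := fun i i' h =>
  (Prod.ext_iff.mp ((X.bijective_blockQubit j).1 (a₁ := (k, i)) (a₂ := (k, i')) h)).2

/-- A string on the target block as a string on the ring. -/
noncomputable def onTarget (p : Fin m → Fin 4) : Qubit X.ξ m → Fin 4 :=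
  Function.extend (blockQubit X.ξ m X.L X.layer X.block) p 0

theorem onTarget_eq_zero_iff (p : Fin m → Fin 4) : X.onTarget p = 0 ↔ p = 0 :=
  extend_eq_zero_iff (X.injective_blockQubit _ _) p

theorem onTarget_blockQubit (p : Fin m → Fin 4) (k : Fin X.ξ) :
    (fun i => X.onTarget p (blockQubit X.ξ m X.L X.layer k i)) = if k = X.block then p else 0 := by
  funext i
  split_ifs with h
  · subst h
    exact (X.injective_blockQubit _ _).extend_apply _ _ _
  · refine Function.extend_apply' _ _ _ ?_
    rintro ⟨i', hi⟩
    exact h (Prod.ext_iff.mp ((X.bijective_blockQubit X.layer).1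
      (a₁ := (X.block, i')) (a₂ := (k, i)) hi)).1.symm

theorem onTarget_injective : Function.Injective X.onTarget := fun p p' h => by
  have h1 := X.onTarget_blockQubit p X.block
  rw [h, X.onTarget_blockQubit] at h1
  simpa using h1.symm

theorem kernel_onTarget (q p : Fin m → Fin 4) :
    X.kernel X.layer (X.onTarget q) (X.onTarget p) = twirl q p := by
  simp only [kernel, onTarget_blockQubit]
  rw [← Finset.mul_prod_erase _ _ (Finset.mem_univ X.block), if_pos rfl, if_pos rfl,
    Finset.prod_eq_one fun k hk => by
      rw [if_neg (Finset.ne_of_mem_erase hk), if_neg (Finset.ne_of_mem_erase hk)]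
      simp [twirl], mul_one]

theorem suppIn_target_iff (P : Qubit X.ξ m → Fin 4) :
    SuppIn P (X.blockStart X.layer X.block) (X.blockStart X.layer X.block + m) ↔
      ∀ q, P q ≠ 0 → q ∈ Set.range (blockQubit X.ξ m X.L X.layer X.block) := by
  have hb : ∀ i : Fin m, blockQubit X.ξ m X.L X.layer X.block i =
      ((X.blockStart X.layer X.block + (i : ℕ) : ℤ) : Qubit X.ξ m) := fun i => by
    simp [blockQubit, blockStart]
  refine forall_congr' fun q => imp_congr_right fun _ => ⟨?_, ?_⟩
  · rintro ⟨z, h1, h2, rfl⟩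
    refine ⟨⟨(z - X.blockStart X.layer X.block).toNat, by omega⟩, ?_⟩
    rw [hb]
    congr 1
    rw [Int.toNat_of_nonneg (by omega)]
    ring
  · rintro ⟨i, rfl⟩
    exact ⟨_, by omega, by have := i.2; omega, (hb i).symm⟩

theorem suppWeight_target (f : (Qubit X.ξ m → Fin 4) → ℝ) :
    X.suppWeight f (X.blockStart X.layer X.block) 1 =
      ∑ q, if q = 0 then 0 else f (X.onTarget q) := by
  have h := sum_extend (X.injective_blockQubit X.layer X.block)
    (fun P => if P = 0 then 0 else f P)
  have h1 : ∀ q : Fin m → Fin 4, (if q = 0 then 0 else f (X.onTarget q)) =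
      (fun P => if P = 0 then 0 else f P)
        (Function.extend (blockQubit X.ξ m X.L X.layer X.block) q 0) := fun q => by
    have := X.onTarget_eq_zero_iff q
    simp only [onTarget] at this ⊢
    simp only [this]
  rw [Finset.sum_congr rfl fun q _ => h1 q, h, suppWeight, mass, mass]
  refine Finset.sum_congr rfl fun P _ => ?_
  have := X.suppIn_target_iff P
  rw [Nat.cast_one, one_mul]
  by_cases hP : P = 0
  · simp [hP]
  · simp only [this, hP, ne_eq, not_false_eq_true, and_true, if_false]

theorem sum_onTarget_le {f : (Qubit X.ξ m → Fin 4) → ℝ} (hf : ∀ P, 0 ≤ f P) :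
    ∑ q, f (X.onTarget q) ≤ ∑ P, f P := by
  rw [← Finset.sum_image (f := f) fun p _ p' _ h => X.onTarget_injective h]
  exact Finset.sum_le_sum_of_subset_of_nonneg (Finset.subset_univ _) fun P _ _ => hf P

/-- The block `W_B` distributes the weight of the non-trivial strings on the target block evenly;
weight arriving from other strings is dropped. -/
theorem moment_target_ge {p : Fin m → Fin 4} (hp : p ≠ 0) :
    ((4 : ℝ) ^ m - 1)⁻¹ * X.suppWeight (X.moment X.ρ 0 X.layer) (X.blockStart X.layer X.block) 1 ≤
      X.moment X.ρ 0 (X.layer + 1) (X.onTarget p) := by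
  rw [X.moment_succ X.isHermitian_ρ 0 X.layer (Nat.zero_le _), suppWeight_target, Finset.mul_sum]
  refine le_trans (Finset.sum_le_sum fun q _ => ?_) (X.sum_onTarget_le fun P =>
    mul_nonneg (X.kernel_nonneg _ _ _) (X.moment_nonneg _ _ _ _))
  rw [kernel_onTarget, twirl, if_neg hp]
  split_ifs
  · rw [mul_zero]
    exact mul_nonneg le_rfl (X.moment_nonneg _ _ _ _)
  · rw [Fintype.card_fin]

/-- The Pauli coefficients of the Hamiltonian, evolved back to the layer of the target block. -/
noncomputable def backCoeff (Q : Qubit X.ξ m → Fin 4) (g : X.Gates) : ℝ :=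
  hs (pauliString Q) ((X.run g (X.layer + 1) X.L)ᴴ * X.H * X.run g (X.layer + 1) X.L)

/-- The Pauli coefficients of the Hamiltonian, evolved back to the target gate. -/
noncomputable def gateCoeff (P : Qubit X.ξ m → Fin 4) (g : X.Gates) : ℝ :=
  hs (pauliString P) ((X.U₂ g)ᴴ * X.H * X.U₂ g)

theorem continuous_backCoeff (Q : Qubit X.ξ m → Fin 4) : Continuous (X.backCoeff Q) :=
  continuous_hs continuous_const (((X.continuous_run _ _).matrix_conjTranspose.matrix_mul
    continuous_const).matrix_mul (X.continuous_run _ _))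

theorem transfer_target (w : Op (Fin m)) (p : Fin m → Fin 4)
    (Q : Qubit X.ξ m → Fin 4) :
    transfer (onQubits (blockQubit X.ξ m X.L X.layer X.block) w) (X.onTarget p) Q =
      if ∀ q, Q q ≠ 0 → q ∈ Set.range (blockQubit X.ξ m X.L X.layer X.block) then
        transfer w p (fun i => Q (blockQubit X.ξ m X.L X.layer X.block i)) else 0 := by
  have hb := X.bijective_blockQubit X.layer
  rw [onQubits_eq_tensorOn hb, transfer_tensorOn hb,
    ← Finset.mul_prod_erase _ _ (Finset.mem_univ X.block), Function.update_self,
    onTarget_blockQubit, if_pos rfl]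
  have h1 : ∀ k ∈ Finset.univ.erase X.block, transfer (Function.update (1 : Fin X.ξ → Op (Fin m)) X.block w k)
      (fun i => X.onTarget p (blockQubit X.ξ m X.L X.layer k i))
      (fun i => Q (blockQubit X.ξ m X.L X.layer k i)) =
      if (fun i => Q (blockQubit X.ξ m X.L X.layer k i)) = 0 then 1 else 0 := fun k hk => by
    rw [Function.update_of_ne (Finset.ne_of_mem_erase hk), onTarget_blockQubit,
      if_neg (Finset.ne_of_mem_erase hk), Pi.one_apply, transfer_one]
    simp only [eq_comm]
  rw [Finset.prod_congr rfl h1, Finset.prod_ite_zero, Finset.prod_const_one, mul_ite, mul_one,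
    mul_zero]
  have hiff : (∀ k ∈ Finset.univ.erase X.block,
      (fun i => Q (blockQubit X.ξ m X.L X.layer k i)) = 0) ↔
      ∀ q, Q q ≠ 0 → q ∈ Set.range (blockQubit X.ξ m X.L X.layer X.block) := by
    refine ⟨fun h q hq => ?_, fun h k hk => ?_⟩
    · obtain ⟨⟨k, i⟩, rfl⟩ := hb.2 q
      by_cases hk : k = X.block
      · subst hk
        exact ⟨i, rfl⟩
      · exact absurd (congrFun (h k (Finset.mem_erase.mpr ⟨hk, Finset.mem_univ _⟩)) i) hq
    · funext i
      by_contra hq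
      obtain ⟨i', hi⟩ := h _ hq
      exact Finset.ne_of_mem_erase hk (Prod.ext_iff.mp (hb.1
        (a₁ := (X.block, i')) (a₂ := (k, i)) hi)).1.symm
  by_cases h : ∀ k ∈ Finset.univ.erase X.block,
      (fun i => Q (blockQubit X.ξ m X.L X.layer k i)) = 0
  · rw [if_pos h, if_pos (hiff.mp h)]
  · rw [if_neg h, if_neg fun h' => h (hiff.mpr h')]

/-- `W_A` acts on the target block only, so a string on this block is expanded in strings on the
same block. -/
theorem gateCoeff_onTarget (p : Fin m → Fin 4) (g : X.Gates) :
    X.gateCoeff (X.onTarget p) g =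
      ∑ q, transfer (g none).1 p q * X.backCoeff (X.onTarget q) g := by
  set K := (X.run g (X.layer + 1) X.L)ᴴ * X.H * X.run g (X.layer + 1) X.L with hK
  have hKh : K.IsHermitian := isHermitian_conj X.isHermitian_H _
  set w := onQubits (blockQubit X.ξ m X.L X.layer X.block) (g none).1 with hw
  have hN : (2 : ℝ) ^ Fintype.card (Qubit X.ξ m) ≠ 0 := by positivity
  have h1 : X.gateCoeff (X.onTarget p) g = hs (w * pauliString (X.onTarget p) * wᴴ) K := by
    rw [← hs_conj, gateCoeff, U₂_eq_run, ← hw, conjTranspose_mul, hK]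
    simp only [Matrix.mul_assoc]
  have h2 : X.gateCoeff (X.onTarget p) g = ∑ Q, transfer w (X.onTarget p) Q * X.backCoeff Q g := by
    refine mul_left_cancel₀ hN ?_
    rw [h1, ← hs_parseval (isHermitian_conj' (isHermitian_pauliString _) _) hKh, Finset.mul_sum]
    refine Finset.sum_congr rfl fun Q _ => ?_
    rw [hs_comm (pauliString Q) (w * _ * _), ← hs_conj, ← mul_assoc, transfer,
      mul_div_cancel₀ _ hN]
    rfl
  have h3 := sum_extend (X.injective_blockQubit X.layer X.block) (fun P =>
    transfer (g none).1 p (fun i => P (blockQubit X.ξ m X.L X.layer X.block i)) * X.backCoeff P g)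
  have h4 : ∀ q : Fin m → Fin 4, (fun i => Function.extend (blockQubit X.ξ m X.L X.layer X.block) q 0
      (blockQubit X.ξ m X.L X.layer X.block i)) = q := fun q => by
    funext i
    exact (X.injective_blockQubit _ _).extend_apply _ _ _
  simp only [h4] at h3
  rw [h2]
  refine Eq.trans ?_ h3.symm
  rw [mass]
  refine Finset.sum_congr rfl fun Q _ => ?_
  rw [hw, transfer_target]
  split_ifs
  · rfl
  · rw [zero_mul]

theorem integral_transfer_none (p p' q q' : Fin m → Fin 4) :
    ∫ g, transfer (g none).1 p q * transfer (g none).1 p' q' ∂X.gatesLaw =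
      if q = q' ∧ p = p' then twirl p q else 0 := by
  rw [← (X.law_twoDesign none).integral_transfer, gatesLaw]
  have h := integral_prod_eval (κ := Unit) X.law (φ := fun _ => none) (fun _ _ _ => rfl)
    (fun _ U => transfer U.1 p q * transfer U.1 p' q')
  simpa using h

theorem integral_gateCoeff_mul (p p' : Fin m → Fin 4) :
    ∫ g, X.gateCoeff (X.onTarget p) g * X.gateCoeff (X.onTarget p') g ∂X.gatesLaw =
      if p = p' then ∑ q, twirl p q * ∫ g, X.backCoeff (X.onTarget q) g ^ 2 ∂X.gatesLaw
      else 0 := by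
  have hct : ∀ p q : Fin m → Fin 4, Continuous fun g : X.Gates => transfer (g none).1 p q :=
    fun p q => (continuous_transfer p q).comp (continuous_apply none)
  have h1 : ∀ g, X.gateCoeff (X.onTarget p) g * X.gateCoeff (X.onTarget p') g =
      ∑ q, ∑ q', (transfer (g none).1 p q * transfer (g none).1 p' q') *
        (X.backCoeff (X.onTarget q) g * X.backCoeff (X.onTarget q') g) := fun g => by
    rw [gateCoeff_onTarget, gateCoeff_onTarget, Finset.sum_mul_sum]
    refine Finset.sum_congr rfl fun Q _ => Finset.sum_congr rfl fun Q' _ => by ring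
  have h2 : ∀ q q', ∫ g, (transfer (g none).1 p q * transfer (g none).1 p' q') *
        (X.backCoeff (X.onTarget q) g * X.backCoeff (X.onTarget q') g) ∂X.gatesLaw =
      (if q = q' ∧ p = p' then twirl p q else 0) *
        ∫ g, X.backCoeff (X.onTarget q) g * X.backCoeff (X.onTarget q') g ∂X.gatesLaw :=
    fun q q' => by
      rw [← X.integral_transfer_none, gatesLaw]
      refine integral_mul_of_dependsOn X.law (s := {none}) ?_ ?_
      · intro g g' h
        simp only [h none rfl]
      · intro g g' h
        have : X.run g (X.layer + 1) X.L = X.run g' (X.layer + 1) X.L :=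
          X.run_congr fun t k _ _ => h _ (by simp)
        simp only [backCoeff, this]
  have hcc : ∀ q q', Continuous fun g : X.Gates =>
      (transfer (g none).1 p q * transfer (g none).1 p' q') *
        (X.backCoeff (X.onTarget q) g * X.backCoeff (X.onTarget q') g) := fun q q' =>
    ((hct _ _).mul (hct _ _)).mul ((X.continuous_backCoeff _).mul (X.continuous_backCoeff _))
  simp only [h1]
  rw [integral_finsetSum _ fun Q _ =>
    integrable_of_continuous (continuous_finsetSum _ fun Q' _ => hcc Q Q')]
  simp only [integral_finsetSum _ fun Q' _ => integrable_of_continuous (hcc _ Q'), h2]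
  by_cases hP : p = p'
  · simp [hP, sq]
  · simp [hP]

/-- Unitary evolution preserves the trace; for this reason `c₀` plays no role. -/
theorem coeff_pauliString_zero {Q : Qubit X.ξ m → Fin 4} (hQ : Q ≠ 0) (i j : ℕ) (g : X.Gates) :
    X.coeff (pauliString Q) i j 0 g = 0 := by
  rw [coeff, hs_comm, ← hs_conj, pauliString_zero, Matrix.mul_one,
    X.run_conjTranspose_mul_self, ← pauliString_zero, hs_pauliString, if_neg hQ]

/-- Duality: instead of evolving the Hamiltonian backward, the string is evolved forward and paired
with the terms `h_i`. -/
theorem backCoeff_eq {Q : Qubit X.ξ m → Fin 4} (hQ : Q ≠ 0) (g : X.Gates) :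
    X.backCoeff Q g =
      ∑ i, X.c i * X.coeff (pauliString Q) (X.layer + 1) X.L (X.termString i) g := by
  have h0 := X.coeff_pauliString_zero hQ (X.layer + 1) X.L g
  simp only [coeff, hs, pauliString_zero, Matrix.one_mul] at h0
  rw [backCoeff, hs_conj, hs_comm, H]
  simp only [onQubits_term, hs, Matrix.add_mul, Matrix.trace_add, Complex.add_re, Matrix.smul_mul,
    Matrix.trace_smul, smul_eq_mul, Complex.re_ofReal_mul, Matrix.one_mul, h0, mul_zero, zero_add,
    Matrix.sum_mul, Matrix.trace_sum, Complex.re_sum, coeff]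

theorem integral_coeff_pauliString_of_ne {Q P P' : Qubit X.ξ m → Fin 4} (hP : P ≠ P') {i j : ℕ}
    (hij : i ≤ j) (hj : j ≤ X.L) :
    ∫ g, X.coeff (pauliString Q) i j P g * X.coeff (pauliString Q) i j P' g ∂X.gatesLaw = 0 := by
  rcases hij.lt_or_eq with h | rfl
  · exact X.integral_coeff_of_ne (isHermitian_pauliString Q) h hj hP
  · simp only [coeff, run_self, conjTranspose_one, Matrix.one_mul, Matrix.mul_one, hs_pauliString]
    by_cases h : P = Q
    · rw [if_neg (fun h' : P' = Q => hP (h.trans h'.symm))]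
      simp
    · simp [h]

/-- Different terms `h_i` are different strings, whose coefficients are uncorrelated; if no layer
follows `W`, at most one of two such coefficients is non-zero. -/
theorem integral_backCoeff_sq {Q : Qubit X.ξ m → Fin 4} (hQ : Q ≠ 0) :
    ∫ g, X.backCoeff Q g ^ 2 ∂X.gatesLaw =
      ∑ i, X.c i ^ 2 * X.moment (pauliString Q) (X.layer + 1) X.L (X.termString i) := by
  have hL : (X.layer : ℕ) + 1 ≤ X.L := X.layer.2
  have hcc : ∀ i i', Continuous fun g => X.c i * X.c i' *
      (X.coeff (pauliString Q) (X.layer + 1) X.L (X.termString i) g *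
        X.coeff (pauliString Q) (X.layer + 1) X.L (X.termString i') g) := fun i i' =>
    continuous_const.mul ((X.continuous_coeff _ _ _ _).mul (X.continuous_coeff _ _ _ _))
  have h1 : ∀ g, X.backCoeff Q g ^ 2 = ∑ i, ∑ i', X.c i * X.c i' *
      (X.coeff (pauliString Q) (X.layer + 1) X.L (X.termString i) g *
        X.coeff (pauliString Q) (X.layer + 1) X.L (X.termString i') g) := fun g => by
    rw [X.backCoeff_eq hQ, sq, Finset.sum_mul_sum]
    refine Finset.sum_congr rfl fun i _ => Finset.sum_congr rfl fun i' _ => by ring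
  simp only [h1]
  rw [integral_finsetSum _ fun i _ =>
    integrable_of_continuous (continuous_finsetSum _ fun i' _ => hcc i i')]
  refine Finset.sum_congr rfl fun i _ => ?_
  rw [integral_finsetSum _ fun i' _ => integrable_of_continuous (hcc i i'),
    Finset.sum_eq_single i]
  · rw [integral_const_mul, moment]
    simp only [sq]
  · intro i' _ hi
    rw [integral_const_mul, X.integral_coeff_pauliString_of_ne
      (fun h => hi (X.termString_injective h).symm) hL le_rfl, mul_zero]
  · intro h
    exact absurd (Finset.mem_univ i) h

/-- The second moment of the Pauli coefficients of the Hamiltonian on the target block. -/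
noncomputable def backWeight : ℝ :=
  ∑ q, if q = 0 then 0 else ∫ g, X.backCoeff (X.onTarget q) g ^ 2 ∂X.gatesLaw

theorem integral_gateCoeff_sq_ge {p : Fin m → Fin 4} (hp : p ≠ 0) :
    ((4 : ℝ) ^ m - 1)⁻¹ * X.backWeight ≤
      ∫ g, X.gateCoeff (X.onTarget p) g ^ 2 ∂X.gatesLaw := by
  have h := X.integral_gateCoeff_mul p p
  rw [if_pos rfl] at h
  simp only [← sq] at h
  rw [h, backWeight, Finset.mul_sum]
  refine Finset.sum_le_sum fun q _ => ?_
  rw [twirl, if_neg hp]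
  split_ifs
  · simp
  · rw [Fintype.card_fin]

end Setting

namespace Setting

variable {m : ℕ} [NeZero m] (X : Setting m)

/-! ### The second moment of the spectral radius -/

theorem continuous_U₁ : Continuous X.U₁ := by
  rw [funext X.U₁_eq_run]
  exact X.continuous_run _ _

theorem continuous_U₂ : Continuous X.U₂ := by
  rw [funext X.U₂_eq_run]
  refine (X.continuous_run _ _).matrix_mul (continuous_matrix fun x y => ?_)
  simp only [onQubits, Matrix.of_apply]
  split_ifs
  · exact (continuous_subtype_val.comp (continuous_apply none)).matrix_elem _ _
  · exact continuous_const

theorem continuous_gateCoeff (P : Qubit X.ξ m → Fin 4) : Continuous (X.gateCoeff P) :=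
  continuous_hs continuous_const ((X.continuous_U₂.matrix_conjTranspose.matrix_mul
    continuous_const).matrix_mul X.continuous_U₂)

theorem continuous_centered_S : Continuous fun g => centered (X.S g) := by
  have hS : Continuous X.S := by
    refine continuous_matrix fun μ ν => ?_
    simp only [S, quadMatrix, Matrix.of_apply]
    refine Complex.continuous_re.comp (continuous_const.mul (Continuous.matrix_trace ?_))
    have hH := (X.continuous_U₂.matrix_conjTranspose.matrix_mul
      (continuous_const (y := X.H))).matrix_mul X.continuous_U₂
    refine ((X.continuous_U₁.matrix_mul continuous_const).matrix_mul
      X.continuous_U₁.matrix_conjTranspose).matrix_mul (Continuous.add ?_ ?_)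
    · exact (continuous_const.matrix_mul hH).matrix_mul continuous_const
    · exact (continuous_const.matrix_mul hH).matrix_mul continuous_const
  simp only [centered]
  exact hS.sub ((hS.matrix_trace.div_const _).smul continuous_const)

theorem isHermitian_centered_S (g : X.Gates) : (centered (X.S g)).IsHermitian :=
  isHermitian_centered (isHermitian_quadMatrix _ _ _)

theorem continuous_radiusSq : Continuous X.radiusSq :=
  (continuous_spectralRadius X.continuous_centered_S X.isHermitian_centered_S).pow 2

/-- The contribution of a Pauli string of the evolved state to the centered matrix. -/
noncomputable def response (μ ν : Fin X.p) (R : Qubit X.ξ m → Fin 4) (g : X.Gates) : ℝ :=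
  ∑ b, centered (X.opt.pauliQuad (R (blockQubit X.ξ m X.L X.layer X.block X.pos)) b) μ ν *
    X.gateCoeff (Function.update R (blockQubit X.ξ m X.L X.layer X.block X.pos) b) g

theorem continuous_response (μ ν : Fin X.p) (R : Qubit X.ξ m → Fin 4) :
    Continuous (X.response μ ν R) :=
  continuous_finsetSum _ fun _ _ => continuous_const.mul (X.continuous_gateCoeff _)

theorem centered_S_apply (μ ν : Fin X.p) (g : X.Gates) :
    centered (X.S g) μ ν = (2 ^ Fintype.card (Qubit X.ξ m))⁻¹ *
      ∑ R, X.coeff X.ρ 0 (X.layer + 1) R g * X.response μ ν R g := by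
  refine (centered_quadMatrix_apply X.opt (blockQubit X.ξ m X.L X.layer X.block X.pos)
    (isHermitian_conj' X.isHermitian_ρ (X.U₁ g)) (isHermitian_conj X.isHermitian_H (X.U₂ g))
    μ ν).trans ?_
  simp only [U₁_eq_run]
  rfl

/-- The state coefficients involve only `U₁`, the responses only `U₂`. Independence splits the mean,
and the state coefficients of different strings are uncorrelated. -/
theorem integral_centered_sq (μ ν : Fin X.p) :
    ∫ g, centered (X.S g) μ ν ^ 2 ∂X.gatesLaw = ((2 ^ Fintype.card (Qubit X.ξ m))⁻¹) ^ 2 *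
      ∑ R, X.moment X.ρ 0 (X.layer + 1) R * ∫ g, X.response μ ν R g ^ 2 ∂X.gatesLaw := by
  have h1 : ∀ g, centered (X.S g) μ ν ^ 2 = ((2 ^ Fintype.card (Qubit X.ξ m))⁻¹) ^ 2 *
      ∑ R, ∑ R', (X.coeff X.ρ 0 (X.layer + 1) R g * X.coeff X.ρ 0 (X.layer + 1) R' g) *
        (X.response μ ν R g * X.response μ ν R' g) := fun g => by
    rw [centered_S_apply, mul_pow]
    congr 1
    rw [sq, Finset.sum_mul_sum]
    refine Finset.sum_congr rfl fun R _ => Finset.sum_congr rfl fun R' _ => by ring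
  have hcc : ∀ R R', Continuous fun g =>
      (X.coeff X.ρ 0 (X.layer + 1) R g * X.coeff X.ρ 0 (X.layer + 1) R' g) *
        (X.response μ ν R g * X.response μ ν R' g) := fun R R' =>
    ((X.continuous_coeff _ _ _ _).mul (X.continuous_coeff _ _ _ _)).mul
      ((X.continuous_response _ _ _).mul (X.continuous_response _ _ _))
  have h2 : ∀ R R', ∫ g, (X.coeff X.ρ 0 (X.layer + 1) R g * X.coeff X.ρ 0 (X.layer + 1) R' g) *
        (X.response μ ν R g * X.response μ ν R' g) ∂X.gatesLaw =
      (∫ g, X.coeff X.ρ 0 (X.layer + 1) R g * X.coeff X.ρ 0 (X.layer + 1) R' g ∂X.gatesLaw) *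
        ∫ g, X.response μ ν R g * X.response μ ν R' g ∂X.gatesLaw := fun R R' => by
    rw [gatesLaw]
    refine integral_mul_of_dependsOn X.law (s := {b | ∃ t k, t ≤ X.layer ∧ b = some (t, k)}) ?_ ?_
    · intro g g' h
      have : X.run g 0 (X.layer + 1) = X.run g' 0 (X.layer + 1) :=
        X.run_congr fun t k _ ht => h _ ⟨t, k, Fin.le_def.mpr (by omega), rfl⟩
      simp only [coeff, this]
    · intro g g' h
      have h3 : X.run g (X.layer + 1) X.L = X.run g' (X.layer + 1) X.L :=
        X.run_congr fun t k ht _ => h _ (by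
          rintro ⟨t', k', ht', h'⟩
          simp only [Option.some.injEq, Prod.mk.injEq] at h'
          rw [← h'.1, Fin.le_def] at ht'
          omega)
      have h4 : g none = g' none := h _ (by
        rintro ⟨t', k', -, h'⟩
        simp at h')
      simp only [response, gateCoeff, U₂_eq_run, h3, h4]
  simp only [h1]
  rw [integral_const_mul, integral_finsetSum _ fun R _ =>
    integrable_of_continuous (continuous_finsetSum _ fun R' _ => hcc R R')]
  congr 1
  refine Finset.sum_congr rfl fun R _ => ?_
  rw [integral_finsetSum _ fun R' _ => integrable_of_continuous (hcc R R'),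
    Finset.sum_eq_single R]
  · rw [h2, moment]
    simp only [sq]
  · intro R' _ hR
    rw [h2, X.integral_coeff_of_ne X.isHermitian_ρ (Nat.succ_pos _) X.layer.2 hR.symm, zero_mul]
  · intro h
    exact absurd (Finset.mem_univ R) h

/-- Different letters on the target qubit give different strings on the block, which `W_A`
decorrelates. -/
theorem integral_response_sq (μ ν : Fin X.p) (p : Fin m → Fin 4) :
    ∫ g, X.response μ ν (X.onTarget p) g ^ 2 ∂X.gatesLaw =
      ∑ b, centered (X.opt.pauliQuad (p X.pos) b) μ ν ^ 2 *
        ∫ g, X.gateCoeff (X.onTarget (Function.update p X.pos b)) g ^ 2 ∂X.gatesLaw := by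
  have he : X.onTarget p (blockQubit X.ξ m X.L X.layer X.block X.pos) = p X.pos :=
    (X.injective_blockQubit _ _).extend_apply _ _ _
  have hu : ∀ b, Function.update (X.onTarget p) (blockQubit X.ξ m X.L X.layer X.block X.pos) b =
      X.onTarget (Function.update p X.pos b) :=
    update_extend (X.injective_blockQubit _ _) p X.pos
  have h1 : ∀ g, X.response μ ν (X.onTarget p) g ^ 2 = ∑ b, ∑ b',
      (centered (X.opt.pauliQuad (p X.pos) b) μ ν * centered (X.opt.pauliQuad (p X.pos) b') μ ν) *
      (X.gateCoeff (X.onTarget (Function.update p X.pos b)) g *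
        X.gateCoeff (X.onTarget (Function.update p X.pos b')) g) := fun g => by
    rw [response, he, sq, Finset.sum_mul_sum]
    refine Finset.sum_congr rfl fun b _ => Finset.sum_congr rfl fun b' _ => ?_
    rw [hu, hu]
    ring
  have hcc : ∀ b b', Continuous fun g =>
      (centered (X.opt.pauliQuad (p X.pos) b) μ ν * centered (X.opt.pauliQuad (p X.pos) b') μ ν) *
      (X.gateCoeff (X.onTarget (Function.update p X.pos b)) g *
        X.gateCoeff (X.onTarget (Function.update p X.pos b')) g) := fun b b' =>
    continuous_const.mul ((X.continuous_gateCoeff _).mul (X.continuous_gateCoeff _))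
  simp only [h1]
  rw [integral_finsetSum _ fun b _ =>
    integrable_of_continuous (continuous_finsetSum _ fun b' _ => hcc b b')]
  refine Finset.sum_congr rfl fun b _ => ?_
  rw [integral_finsetSum _ fun b' _ => integrable_of_continuous (hcc b b'),
    Finset.sum_eq_single b]
  · rw [integral_const_mul]
    simp only [sq]
  · intro b' _ hb
    rw [integral_const_mul, integral_gateCoeff_mul, if_neg, mul_zero]
    intro h
    have := congrFun h X.pos
    rw [Function.update_self, Function.update_self] at this
    exact hb this.symm
  · intro h
    exact absurd (Finset.mem_univ b) h

theorem backWeight_nonneg : 0 ≤ X.backWeight :=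
  Finset.sum_nonneg fun q _ => by
    split_ifs
    · exact le_rfl
    · exact integral_nonneg fun g => sq_nonneg _

/-- The second moment in terms of the weights of the evolved state and of the evolved Hamiltonian
on the target block. -/
theorem le_secondMoment :
    ((2 ^ Fintype.card (Qubit X.ξ m))⁻¹) ^ 2 * (4 ^ (m - 1) * (2 * ((X.p : ℝ) + 2) * (X.p - 1))) *
      (((4 : ℝ) ^ m - 1)⁻¹ *
        X.suppWeight (X.moment X.ρ 0 X.layer) (X.blockStart X.layer X.block) 1 *
      (((4 : ℝ) ^ m - 1)⁻¹ * X.backWeight)) ≤ X.p * X.secondMoment := by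
  set T := ((4 : ℝ) ^ m - 1)⁻¹ *
    X.suppWeight (X.moment X.ρ 0 X.layer) (X.blockStart X.layer X.block) 1 with hT
  set V := ((4 : ℝ) ^ m - 1)⁻¹ * X.backWeight with hV
  have h4 : (0 : ℝ) ≤ ((4 : ℝ) ^ m - 1)⁻¹ :=
    inv_nonneg.mpr (sub_nonneg.mpr (one_le_pow₀ (by norm_num)))
  have hV0 : 0 ≤ V := mul_nonneg h4 X.backWeight_nonneg
  have hcont : ∀ μ ν, Continuous fun g => centered (X.S g) μ ν ^ 2 := fun μ ν =>
    (X.continuous_centered_S.matrix_elem μ ν).pow 2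
  have h1 : ∑ μ, ∑ ν, ∫ g, centered (X.S g) μ ν ^ 2 ∂X.gatesLaw ≤ X.p * X.secondMoment := by
    have h2 : ∫ g, ∑ μ, ∑ ν, centered (X.S g) μ ν ^ 2 ∂X.gatesLaw ≤
        ∫ g, X.p * X.radiusSq g ∂X.gatesLaw := by
      refine integral_mono (integrable_of_continuous
        (continuous_finsetSum _ fun μ _ => continuous_finsetSum _ fun ν _ => hcont μ ν))
        (integrable_of_continuous (continuous_const.mul X.continuous_radiusSq)) fun g => ?_
      exact sum_sq_le_spectralRadius (X.isHermitian_centered_S g)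
    rw [integral_const_mul, integral_finsetSum _ fun μ _ => integrable_of_continuous
      (continuous_finsetSum _ fun ν _ => hcont μ ν)] at h2
    simp only [integral_finsetSum _ fun ν _ => integrable_of_continuous (hcont _ ν)] at h2
    exact h2
  refine le_trans ?_ h1
  simp only [integral_centered_sq, ← Finset.mul_sum]
  rw [mul_assoc]
  refine mul_le_mul_of_nonneg_left ?_ (by positivity)
  have h5 : ∀ μ ν : Fin X.p, ∑ p : Fin m → Fin 4, ∑ b,
      centered (X.opt.pauliQuad (p X.pos) b) μ ν ^ 2 * (T * V) ≤
      ∑ R, X.moment X.ρ 0 (X.layer + 1) R * ∫ g, X.response μ ν R g ^ 2 ∂X.gatesLaw := by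
    intro μ ν
    refine le_trans (Finset.sum_le_sum fun p _ => ?_) (X.sum_onTarget_le fun R =>
      mul_nonneg (X.moment_nonneg _ _ _ _) (integral_nonneg fun g => sq_nonneg _))
    rw [integral_response_sq, Finset.mul_sum]
    refine Finset.sum_le_sum fun b _ => ?_
    -- Identity letters on the target qubit contribute nothing. Otherwise both strings are
    -- non-trivial and the even spreading applies to each.
    by_cases h0 : p X.pos = 0 ∨ b = 0
    · have hz : centered (X.opt.pauliQuad (p X.pos) b) μ ν = 0 := by
        rw [Optimizer.centered_pauliQuad_eq_zero X.opt h0]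
        rfl
      rw [hz]
      simp
    · push Not at h0
      have hp : p ≠ 0 := fun h => h0.1 (congrFun h _)
      have hp' : Function.update p X.pos b ≠ 0 := fun h => h0.2 (by
        simpa using congrFun h X.pos)
      have h6 := mul_le_mul (X.moment_target_ge hp) (X.integral_gateCoeff_sq_ge hp') hV0
        (X.moment_nonneg _ _ _ _)
      calc _ ≤ centered (X.opt.pauliQuad (p X.pos) b) μ ν ^ 2 * _ :=
            mul_le_mul_of_nonneg_left h6 (sq_nonneg _)
        _ = _ := by ring
  refine le_trans (le_of_eq ?_) (Finset.sum_le_sum fun μ _ => Finset.sum_le_sum fun ν _ => h5 μ ν)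
  -- The `m - 1` letters off the target qubit are free, whence `4^(m-1)`.
  have h7 := sum_eval X.pos fun a =>
    ∑ b, ∑ μ, ∑ ν, centered (X.opt.pauliQuad a b) μ ν ^ 2
  rw [Optimizer.sum_centered_pauliQuad, Fintype.card_fin] at h7
  have h8 : ∀ F : (Fin m → Fin 4) → Fin 4 → Fin X.opt.p → Fin X.opt.p → ℝ,
      ∑ p, ∑ b, ∑ μ, ∑ ν, F p b μ ν = ∑ μ, ∑ ν, ∑ p, ∑ b, F p b μ ν := fun F => by
    have h9 := Finset.sum_comm (s := (Finset.univ : Finset ((Fin m → Fin 4) × Fin 4)))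
      (t := (Finset.univ : Finset (Fin X.opt.p × Fin X.opt.p)))
      (f := fun x y => F x.1 x.2 y.1 y.2)
    simpa only [Fintype.sum_prod_type] using h9
  rw [h8] at h7
  simp only [← Finset.sum_mul]
  congr 1
  exact h7.symm

end Setting

theorem Optimizer.two_le_p (o : Optimizer) : 2 ≤ o.p := by
  cases o <;> simp [Optimizer.p]

namespace Setting

variable {m : ℕ} [NeZero m] (X : Setting m)

/-! ### The lower bound -/

theorem backWeight_eq : X.backWeight = ∑ i, X.c i ^ 2 * ∑ q, if q = 0 then 0 else
    X.moment (pauliString (X.onTarget q)) (X.layer + 1) X.L (X.termString i) := by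
  simp only [backWeight, Finset.mul_sum]
  rw [Finset.sum_comm]
  refine Finset.sum_congr rfl fun q _ => ?_
  split_ifs with hq
  · simp
  · exact X.integral_backCoeff_sq fun h => hq ((X.onTarget_eq_zero_iff q).mp h)

theorem backWeight_ge {h : ℕ} (hm : m = h + h) :
    (2 ^ Fintype.card (Qubit X.ξ m)) ^ 2 * (((2 : ℝ) ^ m + 1) ^ (X.L - X.layer))⁻¹ *
      ∑ i ∈ X.forwardTerms, (if X.h i = 0 then 0 else X.c i ^ 2) ≤ X.backWeight := by
  have hN : (0 : ℝ) < 2 ^ Fintype.card (Qubit X.ξ m) := by positivity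
  -- Sum over all non-trivial starting strings on the target block, normalized to be at least `1` on
  -- such strings before the first step.
  set e : ℕ → (Qubit X.ξ m → Fin 4) → ℝ := fun J P =>
    ((2 ^ Fintype.card (Qubit X.ξ m)) ^ 2)⁻¹ * ∑ q, if q = 0 then 0 else
      X.moment (pauliString (X.onTarget q)) (X.layer + 1) (X.layer + 1 + J) P with he_def
  have he : ∀ J P, 0 ≤ e J P := fun J P =>
    mul_nonneg (by positivity) (Finset.sum_nonneg fun q _ => by
      split_ifs
      · exact le_rfl
      · exact X.moment_nonneg _ _ _ _)
  have hrec : ∀ (J : ℕ) (hJ : (X.layer : ℕ) + J + 1 < X.L) P,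
      e (J + 1) P = ∑ Q, X.kernel ⟨X.layer + J + 1, hJ⟩ Q P * e J Q := by
    intro J hJ P
    have h1 : ∀ q, X.moment (pauliString (X.onTarget q)) (X.layer + 1) (X.layer + 1 + (J + 1)) P =
        ∑ Q, X.kernel ⟨X.layer + J + 1, hJ⟩ Q P *
          X.moment (pauliString (X.onTarget q)) (X.layer + 1) (X.layer + 1 + J) Q := fun q => by
      have h2 := X.moment_succ (isHermitian_pauliString (X.onTarget q)) (X.layer + 1)
        ⟨X.layer + J + 1, hJ⟩ (by simp only; omega) P
      simp only at h2
      rw [show (X.layer : ℕ) + 1 + (J + 1) = X.layer + J + 1 + 1 by ring, h2,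
        show (X.layer : ℕ) + 1 + J = X.layer + J + 1 by ring]
    simp only [he_def, h1, Finset.mul_sum]
    rw [Finset.sum_comm]
    refine Finset.sum_congr rfl fun q _ => ?_
    split_ifs
    · simp
    · rw [Finset.mul_sum]
      exact Finset.sum_congr rfl fun Q _ => by ring
  have hc : ∀ Q : Qubit X.ξ m → Fin 4, Q ≠ 0 → SuppIn Q (X.blockStart X.layer X.block)
      (X.blockStart X.layer X.block + m) → 1 ≤ e 0 Q := by
    intro Q hQ hs
    obtain ⟨q, rfl⟩ : ∃ q, X.onTarget q = Q := by
      refine ⟨fun i => Q (blockQubit X.ξ m X.L X.layer X.block i), ?_⟩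
      funext i
      by_cases hi : ∃ a, blockQubit X.ξ m X.L X.layer X.block a = i
      · obtain ⟨a, rfl⟩ := hi
        exact (X.injective_blockQubit _ _).extend_apply _ _ _
      · rw [onTarget, Function.extend_apply' _ _ _ hi]
        by_contra h0
        exact hi ((X.suppIn_target_iff Q).mp hs i (Ne.symm h0))
    simp only [he_def, add_zero, moment_self]
    rw [← div_eq_inv_mul, one_le_div (by positivity)]
    refine le_trans (le_of_eq ?_) (Finset.single_le_sum (fun q' _ => ?_) (Finset.mem_univ q))
    · rw [if_neg fun h => hQ ((X.onTarget_eq_zero_iff q).mpr h), hs_pauliString, if_pos rfl]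
    · split_ifs
      · exact le_rfl
      · exact sq_nonneg _
  have hJ : (X.layer : ℕ) + (X.L - 1 - X.layer) + 1 = X.L := by
    have := X.layer.2
    omega
  have hJ' : X.L - 1 - (X.layer : ℕ) + 1 = X.L - X.layer := by
    have := X.layer.2
    omega
  have h1 : X.backWeight = ∑ i, (2 ^ Fintype.card (Qubit X.ξ m)) ^ 2 *
      (X.c i ^ 2 * e (X.L - 1 - X.layer) (X.termString i)) := by
    rw [backWeight_eq]
    refine Finset.sum_congr rfl fun i _ => ?_
    simp only [he_def]
    rw [show (X.layer : ℕ) + 1 + (X.L - 1 - X.layer) = X.L by omega]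
    field_simp
  rw [h1, Finset.mul_sum]
  refine le_trans (Finset.sum_le_sum fun i hi => ?_) (Finset.sum_le_sum_of_subset_of_nonneg
    (Finset.subset_univ X.forwardTerms) fun i _ _ =>
      mul_nonneg (by positivity) (mul_nonneg (sq_nonneg _) (he _ _)))
  split_ifs with h0
  · rw [mul_zero]
    exact mul_nonneg (by positivity) (mul_nonneg (sq_nonneg _) (he _ _))
  · have h2 := X.le_of_mem_forwardTerms hm he hrec hc hJ hi h0
    rw [hJ'] at h2
    rw [mul_assoc, mul_comm _ (X.c i ^ 2)]
    exact mul_le_mul_of_nonneg_left (mul_le_mul_of_nonneg_left h2 (sq_nonneg _)) (by positivity)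

theorem epsilon_nonneg {n : Type} [Fintype n] [DecidableEq n] (M : Matrix n n ℂ) :
    0 ≤ epsilon M :=
  (Complex.le_def.mp (posSemidef_conjTranspose_mul_self _).trace_nonneg).1

/-- The exponent `2 * layer` comes from the induction over the cone, the extra `1` from the
alignment with the groups `S_k`. -/
theorem sum_epsilon_le {h : ℕ} (hm : m = h + h) :
    ((2 : ℝ) ^ m) ^ ((X.layer : ℕ) + 1) * ∑ kk ∈ X.pairs, epsilon (X.ρred kk.1 kk.2) ≤
      ((2 : ℝ) ^ m + 1) ^ (2 * (X.layer : ℕ) + 1) *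
        X.suppWeight (X.moment X.ρ 0 X.layer) (X.blockStart X.layer X.block) 1 := by
  have h1 := X.sum_pairs_le hm (e := X.moment X.ρ 0 0) fun Q => X.moment_nonneg _ _ _ _
  have h2 := X.coneSum_le hm (e := X.moment X.ρ 0) (fun j Q => X.moment_nonneg _ _ _ _)
    (fun j hj P => X.moment_succ X.isHermitian_ρ 0 ⟨j, hj⟩ (Nat.zero_le _) P) X.layer X.layer.2
    X.block
  refine le_trans (le_of_eq ?_) (h1.trans ((mul_le_mul_of_nonneg_left h2
    (by positivity)).trans (le_of_eq ?_)))
  · rw [Finset.mul_sum]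
    refine Finset.sum_congr rfl fun kk hkk => ?_
    rw [pairs, Set.Finite.mem_toFinset] at hkk
    rw [X.epsilon_ρred hkk.2.2.1 hkk.2.2.2, funext (X.moment_self X.ρ 0)]
  · rw [← mul_assoc, ← pow_mul, ← pow_succ']

theorem integrable_radiusSq : Integrable X.radiusSq X.gatesLaw :=
  integrable_of_continuous X.continuous_radiusSq

theorem term_nonneg (i : Fin X.N) (kk : ℤ × ℤ) : 0 ≤ X.term i kk :=
  mul_nonneg (mul_nonneg (sq_nonneg _) (epsilon_nonneg _)) (epsilon_nonneg _)

theorem sum_term : ∑ i ∈ X.forwardTerms, ∑ kk ∈ X.pairs, X.term i kk =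
    2 ^ m * (∑ i ∈ X.forwardTerms, (if X.h i = 0 then 0 else X.c i ^ 2)) *
      ∑ kk ∈ X.pairs, epsilon (X.ρred kk.1 kk.2) := by
  rw [mul_assoc, Finset.sum_mul, Finset.mul_sum]
  refine Finset.sum_congr rfl fun i _ => ?_
  rw [Finset.mul_sum, Finset.mul_sum]
  refine Finset.sum_congr rfl fun kk _ => ?_
  rw [term, epsilon_pauliString, Fintype.card_fin]
  split_ifs <;> ring

theorem secondMoment_ge (hm : Even m) :
    (((X.p : ℝ) + 2) * ((X.p : ℝ) - 1) * 2 ^ (m * (X.l + 1) - 1) /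
        ((X.p : ℝ) * (2 ^ (2 * m) - 1) ^ 2 * (2 ^ m + 1) ^ (X.L + X.l))) *
      ∑ i ∈ X.forwardTerms, ∑ kk ∈ X.pairs, X.term i kk ≤ X.secondMoment := by
  obtain ⟨h, hh⟩ := hm
  have hm0 : 0 < m := Nat.pos_of_ne_zero (NeZero.ne m)
  have h1 := X.le_secondMoment
  have h2 := X.backWeight_ge hh
  have h3 := X.sum_epsilon_le hh
  have hL := X.layer.2
  rw [sum_term]
  set T := X.suppWeight (X.moment X.ρ 0 X.layer) (X.blockStart X.layer X.block) 1 with hT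
  set E := ∑ kk ∈ X.pairs, epsilon (X.ρred kk.1 kk.2) with hE
  set C := ∑ i ∈ X.forwardTerms, (if X.h i = 0 then 0 else X.c i ^ 2) with hC
  set N : ℝ := 2 ^ Fintype.card (Qubit X.ξ m) with hN
  have hN0 : 0 < N := by positivity
  have hC0 : 0 ≤ C := Finset.sum_nonneg fun i _ => by
    split_ifs
    · exact le_rfl
    · exact sq_nonneg _
  have hp2 : (2 : ℝ) ≤ X.p := by exact_mod_cast X.opt.two_le_p
  have e1 : (2 : ℝ) ^ (m * (X.l + 1) - 1) = ((2 : ℝ) ^ m) ^ ((X.layer : ℕ) + 2) / 2 := by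
    rw [eq_div_iff two_ne_zero, ← pow_succ, ← pow_mul, l]
    congr 1
    have : 0 < m * ((X.layer : ℕ) + 1 + 1) := by positivity
    rw [Nat.sub_add_cancel this]
  have e2 : (4 : ℝ) ^ (m - 1) = ((2 : ℝ) ^ m) ^ 2 / 4 := by
    rw [eq_div_iff (by norm_num), ← pow_succ, Nat.sub_add_cancel hm0, ← pow_mul, mul_comm m,
      pow_mul]
    norm_num
  have e3 : (4 : ℝ) ^ m = ((2 : ℝ) ^ m) ^ 2 := by
    rw [← pow_mul, mul_comm m, pow_mul]
    norm_num
  have e4 : (2 : ℝ) ^ (2 * m) = ((2 : ℝ) ^ m) ^ 2 := by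
    rw [← pow_mul, mul_comm m]
  rw [e1, e4]
  rw [e2, e3] at h1
  have hD : (2 : ℝ) ≤ 2 ^ m := by
    calc (2 : ℝ) = 2 ^ 1 := by norm_num
      _ ≤ 2 ^ m := pow_le_pow_right₀ (by norm_num) hm0
  set D : ℝ := 2 ^ m with hDdef
  have hD1 : 0 < D ^ 2 - 1 := by nlinarith
  have h4 : D ^ ((X.layer : ℕ) + 1) * E * (((D + 1) ^ (X.L + X.l))⁻¹ * C) ≤
      T * (N⁻¹ ^ 2 * X.backWeight) := by
    have h5 : ((D + 1) ^ (2 * (X.layer : ℕ) + 1))⁻¹ * (D ^ ((X.layer : ℕ) + 1) * E) ≤ T := by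
      rw [inv_mul_le_iff₀ (by positivity)]
      exact h3
    have h6 : ((D + 1) ^ (X.L - X.layer))⁻¹ * C ≤ N⁻¹ ^ 2 * X.backWeight := by
      rw [inv_pow, le_inv_mul_iff₀ (by positivity), ← mul_assoc]
      exact h2
    have hE0 : 0 ≤ E := Finset.sum_nonneg fun kk _ => epsilon_nonneg _
    have h7 := mul_le_mul h5 h6 (by positivity) (le_trans (by positivity) h5)
    refine le_trans (le_of_eq ?_) h7
    -- The factors of the state side and of the Hamiltonian side, with `l = layer + 1`.
    have e5 : X.L + X.l = (2 * (X.layer : ℕ) + 1) + (X.L - X.layer) := by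
      rw [l]
      omega
    rw [e5, pow_add (D + 1), mul_inv]
    ring
  -- The constant of `le_secondMoment`, as `4^(m-1) * 2 = D²/2`.
  have hK : 0 ≤ ((X.p : ℝ) + 2) * (X.p - 1) / 2 * D ^ 2 * ((D ^ 2 - 1)⁻¹) ^ 2 := by
    have : (0 : ℝ) ≤ X.p - 1 := by linarith
    positivity
  have h8 := mul_le_mul_of_nonneg_left h4 hK
  have h9 : X.p * ((((X.p : ℝ) + 2) * ((X.p : ℝ) - 1) * (D ^ ((X.layer : ℕ) + 2) / 2) /
        ((X.p : ℝ) * (D ^ 2 - 1) ^ 2 * (D + 1) ^ (X.L + X.l))) * (D * C * E)) ≤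
      X.p * X.secondMoment := by
    refine le_trans (le_of_eq ?_) (h8.trans (le_trans (le_of_eq ?_) h1))
    · have : (X.p : ℝ) ≠ 0 := by linarith
      field_simp
      ring
    · field_simp
      ring
  exact le_of_mul_le_mul_left h9 (by linarith)

end Setting

namespace Setting

variable {m : ℕ} [NeZero m] (X : Setting m)

/-! ### Logarithmic and polylogarithmic depth -/

/-- A single term of the sum bounds the second moment, up to a factor exponential in the depth. -/
theorem secondMoment_ge_term (hm : Even m) {i : Fin X.N} (hi : i ∈ X.forwardTerms) {kk : ℤ × ℤ}
    (hkk : kk ∈ X.pairs) :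
    (((2 : ℝ) ^ (2 * m) - 1) ^ 2)⁻¹ * (2 ^ (2 * (m + 1) * X.L))⁻¹ * X.term i kk ≤
      X.secondMoment := by
  have hm0 : 0 < m := Nat.pos_of_ne_zero (NeZero.ne m)
  have hp : (2 : ℝ) ≤ X.p := by exact_mod_cast X.opt.two_le_p
  have hl : X.l ≤ X.L := X.layer.2
  have hA : (0 : ℝ) < (2 ^ (2 * m) - 1) ^ 2 := by
    have : (1 : ℝ) < 2 ^ (2 * m) := one_lt_pow₀ (by norm_num) (by omega)
    exact pow_pos (by linarith) 2
  have h1 : X.term i kk ≤ ∑ i ∈ X.forwardTerms, ∑ kk ∈ X.pairs, X.term i kk :=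
    (Finset.single_le_sum (f := fun kk => X.term i kk) (fun kk _ => X.term_nonneg i kk) hkk).trans
      (Finset.single_le_sum (f := fun i => ∑ kk ∈ X.pairs, X.term i kk)
        (fun i _ => Finset.sum_nonneg fun kk _ => X.term_nonneg i kk) hi)
  refine le_trans ?_ (X.secondMoment_ge hm)
  refine mul_le_mul ?_ h1 (X.term_nonneg i kk) ?_
  · have h2 : ((2 : ℝ) ^ m + 1) ^ (X.L + X.l) ≤ 2 ^ (2 * (m + 1) * X.L) := by
      have h3 : (2 : ℝ) ^ m + 1 ≤ 2 ^ (m + 1) := by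
        have : (1 : ℝ) ≤ 2 ^ m := one_le_pow₀ (by norm_num)
        rw [pow_succ]
        linarith
      calc ((2 : ℝ) ^ m + 1) ^ (X.L + X.l) ≤ ((2 : ℝ) ^ m + 1) ^ (2 * X.L) := by
            refine pow_le_pow_right₀ ?_ (by omega)
            have : (0 : ℝ) < 2 ^ m := by positivity
            linarith
        _ ≤ (2 ^ (m + 1)) ^ (2 * X.L) := pow_le_pow_left₀ (by positivity) h3 _
        _ = 2 ^ (2 * (m + 1) * X.L) := by
            rw [← pow_mul]
            congr 1
            ring
    have h4 : (1 : ℝ) ≤ 2 ^ (m * (X.l + 1) - 1) := one_le_pow₀ (by norm_num)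
    rw [← mul_inv, ← one_div, div_le_div_iff₀ (by positivity) (by positivity), one_mul]
    -- For `p ≥ 2` this makes the gate constant together with the power of two at least `1`, so both
    -- can be dropped.
    have h5 : (X.p : ℝ) ≤ ((X.p : ℝ) + 2) * (X.p - 1) * 2 ^ (m * (X.l + 1) - 1) := by
      have : (X.p : ℝ) ≤ ((X.p : ℝ) + 2) * (X.p - 1) := by nlinarith
      nlinarith
    calc (X.p : ℝ) * (2 ^ (2 * m) - 1) ^ 2 * (2 ^ m + 1) ^ (X.L + X.l)
        ≤ ((X.p : ℝ) + 2) * (X.p - 1) * 2 ^ (m * (X.l + 1) - 1) * (2 ^ (2 * m) - 1) ^ 2 *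
          2 ^ (2 * (m + 1) * X.L) :=
        mul_le_mul (mul_le_mul_of_nonneg_right h5 hA.le) h2 (by positivity)
          (mul_nonneg (le_trans (by positivity) h5) hA.le)
      _ = _ := by ring
  · have : (0 : ℝ) ≤ X.p - 1 := by linarith
    positivity

theorem one_le_n : 1 ≤ X.n :=
  Nat.pos_of_ne_zero (mul_ne_zero (NeZero.ne X.ξ) (NeZero.ne m))

theorem secondMoment_ge_of_log_depth (hm : Even m) (X : ℕ → Setting m)
    (hL : ∃ C : ℝ, ∀ᶠ t in Filter.atTop, ((X t).L : ℝ) ≤ C * Real.log (X t).n)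
    (hterm : ∃ κ : ℝ, 0 < κ ∧ ∃ a : ℕ, ∀ᶠ t in Filter.atTop,
      ∃ i ∈ (X t).forwardTerms, ∃ kk ∈ (X t).pairs, κ / ((X t).n : ℝ) ^ a ≤ (X t).term i kk) :
    ∃ κ : ℝ, 0 < κ ∧ ∃ a : ℕ, ∀ᶠ t in Filter.atTop,
      κ / ((X t).n : ℝ) ^ a ≤ (X t).secondMoment := by
  obtain ⟨C, hC⟩ := hL
  obtain ⟨κ, hκ, a, ha⟩ := hterm
  have hm0 : 0 < m := Nat.pos_of_ne_zero (NeZero.ne m)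
  have hA : (0 : ℝ) < (2 ^ (2 * m) - 1) ^ 2 := by
    have : (1 : ℝ) < 2 ^ (2 * m) := one_lt_pow₀ (by norm_num) (by omega)
    exact pow_pos (by linarith) 2
  -- Chosen so that `2^(2(m+1)L) ≤ e^(2(m+1)L) ≤ n^b` under the depth bound.
  obtain ⟨b, hb⟩ := exists_nat_ge ((2 * (m + 1) : ℕ) * C)
  refine ⟨((2 ^ (2 * m) - 1) ^ 2)⁻¹ * κ, by positivity, b + a, ?_⟩
  filter_upwards [hC, ha] with t hCt hat
  obtain ⟨i, hi, kk, hkk, hik⟩ := hat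
  refine le_trans ?_ ((X t).secondMoment_ge_term hm hi hkk)
  have hn : (1 : ℝ) ≤ (X t).n := by exact_mod_cast (X t).one_le_n
  have h1 : (2 : ℝ) ^ (2 * (m + 1) * (X t).L) ≤ ((X t).n : ℝ) ^ b := by
    calc (2 : ℝ) ^ (2 * (m + 1) * (X t).L) ≤ Real.exp 1 ^ (2 * (m + 1) * (X t).L) :=
          pow_le_pow_left₀ (by norm_num) (by linarith [Real.add_one_le_exp (1 : ℝ)]) _
      _ = Real.exp ((2 * (m + 1) : ℕ) * (X t).L) := by
          rw [← Real.exp_nat_mul]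
          push_cast
          ring_nf
      _ ≤ Real.exp (b * Real.log (X t).n) := by
          refine Real.exp_le_exp.mpr ?_
          calc ((2 * (m + 1) : ℕ) : ℝ) * (X t).L ≤ (2 * (m + 1) : ℕ) * (C * Real.log (X t).n) :=
                mul_le_mul_of_nonneg_left hCt (Nat.cast_nonneg _)
            _ = (2 * (m + 1) : ℕ) * C * Real.log (X t).n := by ring
            _ ≤ b * Real.log (X t).n := mul_le_mul_of_nonneg_right hb (Real.log_nonneg hn)
      _ = ((X t).n : ℝ) ^ b := by
          rw [Real.exp_nat_mul, Real.exp_log (by linarith)]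
  calc ((2 ^ (2 * m) - 1) ^ 2)⁻¹ * κ / ((X t).n : ℝ) ^ (b + a)
      = ((2 ^ (2 * m) - 1) ^ 2)⁻¹ * (((X t).n : ℝ) ^ b)⁻¹ * (κ / ((X t).n : ℝ) ^ a) := by
        rw [pow_add, div_eq_mul_inv, div_eq_mul_inv, mul_inv]
        ring
    _ ≤ ((2 ^ (2 * m) - 1) ^ 2)⁻¹ * (2 ^ (2 * (m + 1) * (X t).L))⁻¹ * (X t).term i kk := by
        gcongr

theorem secondMoment_ge_of_polylog_depth (hm : Even m) (X : ℕ → Setting m)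
    (hn : Filter.Tendsto (fun t => (X t).n) Filter.atTop Filter.atTop)
    (hL : ∃ C : ℝ, ∃ a : ℕ, ∀ᶠ t in Filter.atTop, ((X t).L : ℝ) ≤ C * Real.log (X t).n ^ a)
    (hterm : ∃ κ : ℝ, 0 < κ ∧ ∃ C : ℝ, ∃ a : ℕ, ∀ᶠ t in Filter.atTop,
      ∃ i ∈ (X t).forwardTerms, ∃ kk ∈ (X t).pairs,
        κ * (2 : ℝ) ^ (-(C * Real.log (X t).n ^ a)) ≤ (X t).term i kk) :
    ∃ κ : ℝ, 0 < κ ∧ ∃ C : ℝ, ∃ a : ℕ, ∀ᶠ t in Filter.atTop,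
      κ * (2 : ℝ) ^ (-(C * Real.log (X t).n ^ a)) ≤ (X t).secondMoment := by
  obtain ⟨C, a, hC⟩ := hL
  obtain ⟨κ, hκ, C', a', ha⟩ := hterm
  have hm0 : 0 < m := Nat.pos_of_ne_zero (NeZero.ne m)
  have hA : (0 : ℝ) < (2 ^ (2 * m) - 1) ^ 2 := by
    have : (1 : ℝ) < 2 ^ (2 * m) := one_lt_pow₀ (by norm_num) (by omega)
    exact pow_pos (by linarith) 2
  -- The exponents of the depth loss and of the term add. Absolute values allow negative constants,
  -- and the power `a + a'` dominates both powers once `log n ≥ 1`, for which `n ≥ 3` suffices.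
  refine ⟨((2 ^ (2 * m) - 1) ^ 2)⁻¹ * κ, by positivity,
    (2 * (m + 1) : ℕ) * |C| + |C'|, a + a', ?_⟩
  filter_upwards [hC, ha, hn.eventually_ge_atTop 3] with t hCt hat hnt
  obtain ⟨i, hi, kk, hkk, hik⟩ := hat
  refine le_trans ?_ ((X t).secondMoment_ge_term hm hi hkk)
  set x := Real.log (X t).n with hx
  have hx1 : 1 ≤ x := by
    rw [hx, Real.le_log_iff_exp_le (by positivity)]
    have : (3 : ℝ) ≤ (X t).n := by exact_mod_cast hnt
    linarith [Real.exp_one_lt_d9]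
  have h1 : x ^ a ≤ x ^ (a + a') := pow_le_pow_right₀ hx1 (by omega)
  have h2 : x ^ a' ≤ x ^ (a + a') := pow_le_pow_right₀ hx1 (by omega)
  have h3 : ((2 * (m + 1) * (X t).L : ℕ) : ℝ) ≤ (2 * (m + 1) : ℕ) * |C| * x ^ (a + a') := by
    rw [Nat.cast_mul, mul_assoc]
    refine mul_le_mul_of_nonneg_left (hCt.trans ?_) (Nat.cast_nonneg _)
    exact mul_le_mul (le_abs_self _) h1 (by positivity) (abs_nonneg _)
  have h4 : C' * x ^ a' ≤ |C'| * x ^ (a + a') :=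
    mul_le_mul (le_abs_self _) h2 (by positivity) (abs_nonneg _)
  calc ((2 ^ (2 * m) - 1) ^ 2)⁻¹ * κ *
        (2 : ℝ) ^ (-(((2 * (m + 1) : ℕ) * |C| + |C'|) * x ^ (a + a')))
      ≤ ((2 ^ (2 * m) - 1) ^ 2)⁻¹ * κ *
        (2 : ℝ) ^ (-((2 * (m + 1) * (X t).L : ℕ) : ℝ) + -(C' * x ^ a')) := by
        refine mul_le_mul_of_nonneg_left (Real.rpow_le_rpow_of_exponent_le (by norm_num) ?_)
          (by positivity)
        linarith
    _ = ((2 ^ (2 * m) - 1) ^ 2)⁻¹ * (2 ^ (2 * (m + 1) * (X t).L))⁻¹ *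
        (κ * (2 : ℝ) ^ (-(C' * x ^ a'))) := by
        rw [Real.rpow_add (by norm_num), Real.rpow_neg (by norm_num), Real.rpow_natCast]
        ring
    _ ≤ ((2 ^ (2 * m) - 1) ^ 2)⁻¹ * (2 ^ (2 * (m + 1) * (X t).L))⁻¹ * (X t).term i kk :=
        mul_le_mul_of_nonneg_left hik (by positivity)

end Setting

end ALA

/-- Lower bound on the second moment of the spectral radius of the centered matrix, and its
consequences for logarithmic and for polylogarithmic depth. -/
theorem theorem2 (m : ℕ) [NeZero m] (hm : Even m) :
    (∀ X : ALA.Setting m,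
      MeasureTheory.Integrable X.radiusSq X.gatesLaw ∧
      (((X.p : ℝ) + 2) * ((X.p : ℝ) - 1) * 2 ^ (m * (X.l + 1) - 1) /
          ((X.p : ℝ) * (2 ^ (2 * m) - 1) ^ 2 * (2 ^ m + 1) ^ (X.L + X.l))) *
        ∑ i ∈ X.forwardTerms, ∑ kk ∈ X.pairs, X.term i kk ≤ X.secondMoment) ∧
    (∀ X : ℕ → ALA.Setting m,
      Filter.Tendsto (fun t => (X t).n) Filter.atTop Filter.atTop →
      (∃ C : ℝ, ∀ᶠ t in Filter.atTop, ((X t).L : ℝ) ≤ C * Real.log (X t).n) →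
      (∃ κ : ℝ, 0 < κ ∧ ∃ a : ℕ, ∀ᶠ t in Filter.atTop,
        ∃ i ∈ (X t).forwardTerms, ∃ kk ∈ (X t).pairs,
          κ / ((X t).n : ℝ) ^ a ≤ (X t).term i kk) →
      ∃ κ : ℝ, 0 < κ ∧ ∃ a : ℕ, ∀ᶠ t in Filter.atTop,
        κ / ((X t).n : ℝ) ^ a ≤ (X t).secondMoment) ∧
    (∀ X : ℕ → ALA.Setting m,
      Filter.Tendsto (fun t => (X t).n) Filter.atTop Filter.atTop →
      (∃ C : ℝ, ∃ a : ℕ, ∀ᶠ t in Filter.atTop,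
        ((X t).L : ℝ) ≤ C * Real.log (X t).n ^ a) →
      (∃ κ : ℝ, 0 < κ ∧ ∃ C : ℝ, ∃ a : ℕ, ∀ᶠ t in Filter.atTop,
        ∃ i ∈ (X t).forwardTerms, ∃ kk ∈ (X t).pairs,
          κ * (2 : ℝ) ^ (-(C * Real.log (X t).n ^ a)) ≤ (X t).term i kk) →
      ∃ κ : ℝ, 0 < κ ∧ ∃ C : ℝ, ∃ a : ℕ, ∀ᶠ t in Filter.atTop,
        κ * (2 : ℝ) ^ (-(C * Real.log (X t).n ^ a)) ≤ (X t).secondMoment) := by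
  refine ⟨fun X => ⟨X.integrable_radiusSq, X.secondMoment_ge hm⟩, fun X _ hL hterm => ?_,
    fun X hn hL hterm => ?_⟩
  · exact ALA.Setting.secondMoment_ge_of_log_depth hm X hL hterm
  · exact ALA.Setting.secondMoment_ge_of_polylog_depth hm X hn hL hterm
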